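/- Let $B$ be a compact smooth manifold without boundary. **Flat complexes.** Let $(E,v,\nabla^E)$ be a flat cochain complex over $B$: smooth complex vector bundles $E^0,\dots,E^n$ with smooth bundle maps $0\to E^0\xrightarrow{v}E^1\xrightarrow{v}\cdots\xrightarrow{v}E^n\to 0$, $v^2=0$, and flat connections $\nabla^{E^i}$ that commute with $v$. Let $h^E=\bigoplus_i h^{E^i}$ be a smooth $\mathbf Z$-graded Hermitian metric. Let $H^i(E,v)$ be the cohomology bundle, with fibre $H^i(E,v)_b=\ker(v_b|_{E^i_b})/v_b(E^{i-1}_b)$, with its canonical flat connection $\nabla^{H^i(E,v)}[t]=[\nabla^{E^i}t]$ (for smooth local sections $t$ of $\ker v$), and with the metric $h^{H^i(E,v)}$ induced by the isomorphism $H(E,v)\simeq\ker(v+v^*)\subset E$. For a flat bundle $(F,\nabla^F)$ with Hermitian metric $h^F$ let $(\nabla^F)^*$ be the adjoint connection, $\omega(F,h^F)=(\nabla^F)^*-\nabla^F$, and $\nabla^{F,e}=\nabla^F+\frac12\omega(F,h^F)$, a Hermitian connection. **Lott's group.** An $\mathbf R/\mathbf Z$ K-generator is a quadruple $(V,h,\nabla,\omega)$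 of a smooth complex vector bundle $V$ over $B$, a Hermitian metric $h$, a Hermitian connection $\nabla$ and a class $\omega\in\Omega^{\rm odd}(B)/\mathrm{im}\,d$ of real forms with $d\omega=\mathrm{ch}(V,\nabla)-\mathrm{rk}\,V$, where $\mathrm{ch}(V,\nabla)=\mathrm{Tr}\exp(-\nabla^2/2\pi\sqrt{-1})$. For a short exact sequence $0\to V_1\to V_2\to V_3\to0$, identify $V_2$ with $V_1\oplus V_3$ by a splitting and put $CS(\nabla_1,\nabla_2,\nabla_3)=CS(\nabla_1\oplus\nabla_3,\nabla_2)$ modulo exact forms, where $CS(\nabla_0',\nabla_1')$ is the Chern–Simons form of two connections on one bundle, normalized by $d\,CS(\nabla_0',\nabla_1')=\mathrm{ch}(\nabla_1')-\mathrm{ch}(\nabla_0')$; in degree $2k+1$ it is $-(2\pi\sqrt{-1})^{-k-1}\int_0^1\mathrm{Tr}\big[(\nabla_1'-\nabla_0')\wedge(-\nabla_t'^2)^k/k!\big]\,dt$, with $\nabla_t'=(1-t)\nabla_0'+t\nabla_1'$. Let $MK_{\mathbf R/\mathbf Z}(B)$ be the free abelian group on the generators modulo the relations $(V_2,h_2,\nabla_2,\omega_2)=(V_1,h_1,\nabla_1,\omega_1)+(V_3,h_3,\nabla_3,\omega_3)$,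 one for each such short exact sequence with $\omega_2=\omega_1+\omega_3+CS(\nabla_1,\nabla_2,\nabla_3)$. Its subgroup of elements of virtual rank zero is $K^{-1}_{\mathbf R/\mathbf Z}(B)$. **Theorem.** All $(E^i,h^{E^i},\nabla^{E^i,e},0)$ and $(H^i(E,v),h^{H^i(E,v)},\nabla^{H^i(E,v),e},0)$ are $\mathbf R/\mathbf Z$ K-generators, and $$\sum_{i=0}^n(-1)^i\,(E^i,h^{E^i},\nabla^{E^i,e},0)=\sum_{i=0}^n(-1)^i\,(H^i(E,v),h^{H^i(E,v)},\nabla^{H^i(E,v),e},0)\quad\text{in } MK_{\mathbf R/\mathbf Z}(B).$$ If moreover the virtual rank $\sum_i(-1)^i\,\mathrm{rk}\,E^i$ is a constant $m$ on $B$ (which is automatic if $B$ is connected), then, with $\mathbf C$ the class of the trivial line bundle with trivial metric, trivial connection and form $0$ (also a generator), both sides minus $m\,\mathbf C$ lie in $K^{-1}_{\mathbf R/\mathbf Z}(B)$ and are equal there. In particular, if $m=0$, both sides themselves lie in $K^{-1}_{\mathbf R/\mathbf Z}(B)$ and are equal there. -/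

import Mathlib

/-!
Smooth complex vector bundles, connections, Chern character and Chern-Simons forms, Lott's group of
`R/Z` K-generators, flat cochain complexes and their cohomology bundles, over a smooth manifold `B`
of dimension `d` without boundary. The degree of differentiability is always `∞` (smooth).

Several objects are given by `Classical.epsilon`: "the element satisfying ...". In each such case
the defining condition has exactly one solution in the situation where the object is used.
-/

open scoped Manifold ContDiff Topology
open Filter

namespace LottK

universe u w

section Forms

variable (d : ℕ) (B : Type u) [TopologicalSpace B] [ChartedSpace (EuclideanSpace ℝ (Fin d)) B]
  [IsManifold (𝓡 d) ∞ B] (A : Type*) [NormedAddCommGroup A] [NormedSpace ℝ A]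

/-- Not necessarily continuous `k`-forms on `B` with values in `A`. -/
abbrev RawForm (k : ℕ) : Type _ :=
  (b : B) → TangentSpace (𝓡 d) b [⋀^Fin k]→L[ℝ] A

variable {d B A}

/-- The expression of a form in the preferred chart at `x` (meaningful on the chart's target). -/
noncomputable def formInChart {k : ℕ} (α : RawForm d B A k) (x : B)
    (y : EuclideanSpace ℝ (Fin d)) : EuclideanSpace ℝ (Fin d) [⋀^Fin k]→L[ℝ] A :=
  ContinuousAlternatingMap.compContinuousLinearMap
    (α ((extChartAt (𝓡 d) x).symm y) : EuclideanSpace ℝ (Fin d) [⋀^Fin k]→L[ℝ] A)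
    (tangentCoordChange (𝓡 d) x ((extChartAt (𝓡 d) x).symm y) ((extChartAt (𝓡 d) x).symm y))

variable (d B A) in
/-- `Ω^k(B; A)`: the forms that are smooth in every chart. -/
noncomputable def smoothForms (k : ℕ) : Submodule ℝ (RawForm d B A k) where
  carrier := {α | ∀ x : B, ContDiffOn ℝ ∞ (formInChart α x) (extChartAt (𝓡 d) x).target}
  add_mem' hα hη x := (hα x).add (hη x)
  zero_mem' _ := contDiffOn_const (c := 0)
  smul_mem' c _ hα x := (hα x).const_smul c

/-- The exterior derivative. Its value at `b` is computed in the preferred chart at `b`, in which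
the tangent space at `b` is identified with the model space. -/
noncomputable def extDer {k : ℕ} : smoothForms d B A k →ₗ[ℝ] RawForm d B A (k + 1) where
  toFun α b := extDeriv (formInChart α.1 b) (extChartAt (𝓡 d) b b)
  map_add' α η := by
    funext b
    have key : ∀ θ : smoothForms d B A k,
        DifferentiableAt ℝ (formInChart θ.1 b) (extChartAt (𝓡 d) b b) := fun θ =>
      ((θ.2 b).contDiffAt (extChartAt_target_mem_nhds b)).differentiableAt (by simp)
    exact extDeriv_add (key α) (key η)
  map_smul' c α := by
    funext b
    exact extDeriv_smul c (formInChart α.1 b)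

variable (d B)

/-- `Ω^odd(B)`: families of real forms, the `k`-th one of degree `2k+1` (it is zero as soon as
`2k+1` exceeds the dimension). -/
abbrev OddForms : Type _ := (k : ℕ) → smoothForms d B ℝ (2 * k + 1)

/-- The odd part of the image of the exterior derivative. -/
noncomputable def exactOddForms : Submodule ℝ (OddForms d B) where
  carrier := {η | ∃ β : (k : ℕ) → smoothForms d B ℝ (2 * k), ∀ k, extDer (β k) = (η k).1}
  add_mem' := by
    rintro η η' ⟨β, hβ⟩ ⟨β', hβ'⟩
    exact ⟨β + β', fun k => by simp [hβ, hβ']⟩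
  zero_mem' := ⟨0, fun k => by simp⟩
  smul_mem' := by
    rintro c η ⟨β, hβ⟩
    exact ⟨c • β, fun k => by simp [hβ]⟩

/-- `Ω^odd(B) / im d`. -/
abbrev OddClass : Type _ := OddForms d B ⧸ exactOddForms d B

end Forms

section Bundles

variable (d : ℕ) {B : Type u} [TopologicalSpace B] [ChartedSpace (EuclideanSpace ℝ (Fin d)) B]
  [IsManifold (𝓡 d) ∞ B]

/-- The function `f` is smooth on a neighbourhood of `x`. -/
def SmoothNear (f : B → ℂ) (x : B) : Prop :=
  ∀ᶠ y in 𝓝 x, ContMDiffAt (𝓡 d) 𝓘(ℝ, ℂ) ∞ f y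

variable (B) in
/-- A family of complex vector spaces over `B` together with a notion of smooth section:
`V.SmoothAt s x` says that the section `s` is smooth on a neighbourhood of `x`. -/
structure Family where
  /-- the fibres -/
  fiber : B → Type w
  [addCommGroup : ∀ b, AddCommGroup (fiber b)]
  [module : ∀ b, Module ℂ (fiber b)]
  /-- smoothness of a section on a neighbourhood of a point -/
  SmoothAt : ((b : B) → fiber b) → B → Prop

attribute [instance] Family.addCommGroup Family.module

/-- Sections of a family, without any regularity. -/
abbrev Family.Sec (V : Family.{u, w} B) : Type _ := (b : B) → V.fiber b

/-- The family is a smooth complex vector bundle: near each point there is a local frame for which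
the smooth sections are those with smooth coefficients. Such frames are the same thing as local
trivializations with smooth transition functions. (The rank is locally constant, and may differ
from one component of `B` to another; Mathlib's bundles have one model fibre, and are smooth over
the scalar field of the manifold only.) -/
def IsVectorBundle (V : Family.{u, w} B) : Prop :=
  ∀ x : B, ∃ (r : ℕ) (U : Set B) (e : Fin r → V.Sec), IsOpen U ∧ x ∈ U ∧
    (∀ y ∈ U, LinearIndependent ℂ (fun j => e j y) ∧
      Submodule.span ℂ (Set.range fun j => e j y) = ⊤) ∧
    ∀ y ∈ U, ∀ (s : V.Sec) (c : Fin r → B → ℂ),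
      (∀ᶠ z in 𝓝 y, s z = ∑ j, c j z • e j z) →
        (V.SmoothAt s y ↔ ∀ j, SmoothNear d (c j) y)

/-- Families of fibrewise linear maps. -/
abbrev FiberHom (V W : Family.{u, w} B) : Type _ := (b : B) → V.fiber b →ₗ[ℂ] W.fiber b

/-- A fibrewise linear map is a smooth bundle map when it preserves smooth sections. -/
def IsSmoothHom {V W : Family.{u, w} B} (φ : FiberHom V W) : Prop :=
  ∀ (s : V.Sec) (x : B), V.SmoothAt s x → W.SmoothAt (fun b => φ b (s b)) x

/-- A function of two vectors in each fibre (the underlying data of a Hermitian metric). -/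
abbrev Pairing (V : Family.{u, w} B) : Type _ := (b : B) → V.fiber b → V.fiber b → ℂ

/-- Smooth positive definite Hermitian metrics, conjugate-linear in the first variable. -/
structure IsHermitianMetric (V : Family.{u, w} B) (h : Pairing V) : Prop where
  add_right : ∀ b x y z, h b x (y + z) = h b x y + h b x z
  smul_right : ∀ b x (c : ℂ) y, h b x (c • y) = c * h b x y
  conj_symm : ∀ b x y, (starRingEnd ℂ) (h b x y) = h b y x
  pos : ∀ b x, x ≠ 0 → 0 < (h b x x).re
  smooth : ∀ (s t : V.Sec) (x : B), V.SmoothAt s x → V.SmoothAt t x →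
    SmoothNear d (fun b => h b (s b) (t b)) x

/-- The underlying data of a connection: `D s b X` is `(∇_X s)(b)`, for a tangent vector `X` at `b`
and a section `s` that is smooth near `b` (the values for other `s` are irrelevant). -/
abbrev Oper (V : Family.{u, w} B) : Type _ := V.Sec → (b : B) → TangentSpace (𝓡 d) b → V.fiber b

variable {d} in
/-- The vector field near `b` with value `X` at `b` that is constant in the preferred chart at `b`.
Near `b`, these fields commute, and a basis of tangent vectors at `b` gives a frame. -/
noncomputable def coordField (b : B) (X : TangentSpace (𝓡 d) b) (y : B) : TangentSpace (𝓡 d) y :=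
  tangentCoordChange (𝓡 d) b y y X

variable {d}

/-- Smooth connections on `V`. -/
structure IsConnection (V : Family.{u, w} B) (D : Oper d V) : Prop where
  add : ∀ (s t : V.Sec) (b : B) (X : TangentSpace (𝓡 d) b), V.SmoothAt s b → V.SmoothAt t b →
    D (s + t) b X = D s b X + D t b X
  leibniz : ∀ (f : B → ℂ) (s : V.Sec) (b : B) (X : TangentSpace (𝓡 d) b),
    SmoothNear d f b → V.SmoothAt s b →
    D (fun y => f y • s y) b X = (mvfderiv (𝓡 d) f b X : ℂ) • s b + f b • D s b X
  add_vector : ∀ (s : V.Sec) (b : B) (X Y : TangentSpace (𝓡 d) b), V.SmoothAt s b →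
    D s b (X + Y) = D s b X + D s b Y
  smul_vector : ∀ (s : V.Sec) (b : B) (c : ℝ) (X : TangentSpace (𝓡 d) b), V.SmoothAt s b →
    D s b (c • X) = (c : ℂ) • D s b X
  smooth : ∀ (s : V.Sec) (b : B) (X : TangentSpace (𝓡 d) b), V.SmoothAt s b →
    V.SmoothAt (fun y => D s y (coordField b X y)) b

/-- The connection is Hermitian: `d h(s,t) = h(∇s,t) + h(s,∇t)`. -/
def IsMetricConnection (V : Family.{u, w} B) (h : Pairing V) (D : Oper d V) : Prop :=
  ∀ (s t : V.Sec) (b : B) (X : TangentSpace (𝓡 d) b), V.SmoothAt s b → V.SmoothAt t b →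
    (mvfderiv (𝓡 d) (fun y => h y (s y) (t y)) b X : ℂ) = h b (D s b X) (t b) + h b (s b) (D t b X)

/-- `∇_X ∇_Y s - ∇_Y ∇_X s` at `b`, where `X`, `Y` are extended to commuting vector fields. -/
noncomputable def curvatureOn {V : Family.{u, w} B} (D : Oper d V) (b : B)
    (X Y : TangentSpace (𝓡 d) b) (s : V.Sec) : V.fiber b :=
  D (fun y => D s y (coordField b Y y)) b X - D (fun y => D s y (coordField b X y)) b Y

/-- `∇² = 0`. -/
def IsFlat {V : Family.{u, w} B} (D : Oper d V) : Prop :=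
  ∀ (s : V.Sec) (b : B) (X Y : TangentSpace (𝓡 d) b), V.SmoothAt s b → curvatureOn D b X Y s = 0

/-- The endomorphism of the fibre at `b` through which a tensorial operator `P` acts on sections. -/
noncomputable def endoAt {V : Family.{u, w} B} (b : B) (P : V.Sec → V.fiber b) :
    Module.End ℂ (V.fiber b) :=
  Classical.epsilon fun L : Module.End ℂ (V.fiber b) => ∀ s : V.Sec, V.SmoothAt s b → L (s b) = P s

/-- The curvature `R(X,Y)` of a connection, as an endomorphism of the fibre. -/
noncomputable def curvature {V : Family.{u, w} B} (D : Oper d V) (b : B)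
    (X Y : TangentSpace (𝓡 d) b) : Module.End ℂ (V.fiber b) :=
  endoAt b (curvatureOn D b X Y)

/-- The endomorphism `(∇₁ - ∇₀)(X)` of the fibre. -/
noncomputable def difference {V : Family.{u, w} B} (D₀ D₁ : Oper d V) (b : B)
    (X : TangentSpace (𝓡 d) b) : Module.End ℂ (V.fiber b) :=
  endoAt b fun s => D₁ s b X - D₀ s b X

/-- The component of degree `2(k+1)` of the Chern character form `Tr exp(-∇²/2πi)`, that is,
`(1/(k+1)!) (-1/2πi)^(k+1) Tr(R ∧ ... ∧ R)`, the wedge product of `k+1` two-forms being written out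
as an alternating sum. -/
noncomputable def chernForm {V : Family.{u, w} B} (D : Oper d V) (k : ℕ) (b : B)
    (X : Fin (2 * k + 1 + 1) → TangentSpace (𝓡 d) b) : ℂ :=
  (1 / ((k + 1).factorial : ℂ)) * (-1 / (2 * Real.pi * Complex.I)) ^ (k + 1) *
    ((1 / 2 ^ (k + 1)) * ∑ σ : Equiv.Perm (Fin (2 * k + 1 + 1)), ((Equiv.Perm.sign σ : ℤ) : ℂ) *
      LinearMap.trace ℂ (V.fiber b) (List.ofFn fun j : Fin (k + 1) =>
        curvature D b (X (σ ⟨2 * j.1, by omega⟩)) (X (σ ⟨2 * j.1 + 1, by omega⟩))).prod)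

/-- The straight path `(1-t)∇₀ + t∇₁` of connections. -/
noncomputable def connectionPath {V : Family.{u, w} B} (D₀ D₁ : Oper d V) (t : ℝ) : Oper d V :=
  fun s b X => ((1 - t : ℝ) : ℂ) • D₀ s b X + (t : ℂ) • D₁ s b X

/-- The component of degree `2k+1` of the Chern-Simons form `CS(∇₀,∇₁)`, which satisfies
`d CS(∇₀,∇₁) = ch(∇₁) - ch(∇₀)`. With `∇_t` the straight path and `R_t` its curvature it is
`-(1/2πi)^(k+1) ∫₀¹ Tr((∇₁-∇₀) ∧ (-R_t)^k/k!) dt`. -/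
noncomputable def chernSimonsForm {V : Family.{u, w} B} (D₀ D₁ : Oper d V) (k : ℕ) (b : B)
    (X : Fin (2 * k + 1) → TangentSpace (𝓡 d) b) : ℂ :=
  -(1 / (2 * Real.pi * Complex.I)) ^ (k + 1) * ((-1) ^ k / (k.factorial : ℂ)) *
    ∫ t in (0 : ℝ)..1, (1 / 2 ^ k) * ∑ σ : Equiv.Perm (Fin (2 * k + 1)),
      ((Equiv.Perm.sign σ : ℤ) : ℂ) * LinearMap.trace ℂ (V.fiber b)
        (difference D₀ D₁ b (X (σ 0)) * (List.ofFn fun j : Fin k =>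
          curvature (connectionPath D₀ D₁ t) b (X (σ ⟨2 * j.1 + 1, by omega⟩))
            (X (σ ⟨2 * j.1 + 2, by omega⟩))).prod)

/-- The adjoint connection: `d h(s,t) = h(∇s,t) + h(s,∇*t)`. -/
noncomputable def adjointConnection {V : Family.{u, w} B} (h : Pairing V) (D : Oper d V) :
    Oper d V :=
  fun t b X => Classical.epsilon fun z : V.fiber b => ∀ s : V.Sec, V.SmoothAt s b →
    (mvfderiv (𝓡 d) (fun y => h y (s y) (t y)) b X : ℂ) = h b (D s b X) (t b) + h b (s b) z

/-- `ω(V,h) = ∇* - ∇`. -/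
noncomputable def omega {V : Family.{u, w} B} (h : Pairing V) (D : Oper d V) : Oper d V :=
  fun s b X => adjointConnection h D s b X - D s b X

/-- The Hermitian connection `∇^e = ∇ + (1/2) ω(V,h)`. -/
noncomputable def unitaryConnection {V : Family.{u, w} B} (h : Pairing V) (D : Oper d V) :
    Oper d V :=
  fun s b X => D s b X + (1 / 2 : ℂ) • omega h D s b X

end Bundles

section KGroup

variable (d : ℕ) (B : Type u) [TopologicalSpace B] [ChartedSpace (EuclideanSpace ℝ (Fin d)) B]
  [IsManifold (𝓡 d) ∞ B]

variable {d B} in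
/-- `(V, h, ∇, α)` is an `R/Z` K-generator: `V` is a complex vector bundle, `h` a Hermitian metric,
`∇` a Hermitian connection and `α ∈ Ω^odd(B)/im d` with `dα = ch(V,∇) - rk V`. (In degree zero the
last equation reads `0 = rk V - rk V`.) -/
structure IsKGenerator (V : Family.{u, w} B) (h : Pairing V) (D : Oper d V) (α : OddClass d B) :
    Prop where
  bundle : IsVectorBundle d V
  metric : IsHermitianMetric d V h
  connection : IsConnection V D
  compatible : IsMetricConnection V h D
  form : ∃ η : OddForms d B, Submodule.Quotient.mk η = α ∧
    ∀ (k : ℕ) (b : B) (X : Fin (2 * k + 1 + 1) → TangentSpace (𝓡 d) b),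
      ((extDer (η k) b X : ℝ) : ℂ) = chernForm D k b X

/-- `R/Z` K-generators over `B`. -/
structure KGenerator where
  /-- the bundle -/
  V : Family.{u, w} B
  /-- the metric -/
  h : Pairing V
  /-- the connection -/
  D : Oper d V
  /-- the class of odd forms -/
  α : OddClass d B
  isKGenerator : IsKGenerator V h D α

variable {d B}

/-- A short exact sequence `0 → V₁ → V₂ → V₃ → 0` of vector bundles with maps `i`, `j`, with a
splitting `σ : V₃ → V₂`, and the corresponding projection `p : V₂ → V₁`. -/
structure IsSplitShortExact {V₁ V₂ V₃ : Family.{u, w} B} (i : FiberHom V₁ V₂) (j : FiberHom V₂ V₃)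
    (σ : FiberHom V₃ V₂) (p : FiberHom V₂ V₁) : Prop where
  smooth_i : IsSmoothHom i
  smooth_j : IsSmoothHom j
  smooth_splitting : IsSmoothHom σ
  smooth_projection : IsSmoothHom p
  injective : ∀ b, Function.Injective (i b)
  exact : ∀ b, LinearMap.range (i b) = LinearMap.ker (j b)
  surjective : ∀ b, Function.Surjective (j b)
  splitting : ∀ b x, j b (σ b x) = x
  projection : ∀ b x, i b (p b x) = x - σ b (j b x)

/-- The connection on `V₂` that corresponds to `∇₁ ⊕ ∇₃` under the isomorphism
`i ⊕ σ : V₁ ⊕ V₃ → V₂`, whose inverse is `(p, j)`. -/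
def sumConnection {V₁ V₂ V₃ : Family.{u, w} B} (i : FiberHom V₁ V₂) (j : FiberHom V₂ V₃)
    (σ : FiberHom V₃ V₂) (p : FiberHom V₂ V₁) (D₁ : Oper d V₁) (D₃ : Oper d V₃) : Oper d V₂ :=
  fun s b X => i b (D₁ (fun y => p y (s y)) b X) + σ b (D₃ (fun y => j y (s y)) b X)

/-- The `R/Z` K-relation: there is a short exact sequence `0 → V₁ → V₂ → V₃ → 0` such that
`α₂ = α₁ + α₃ + CS(∇₁,∇₂,∇₃)` modulo exact forms, where `CS(∇₁,∇₂,∇₃) = CS(∇₁ ⊕ ∇₃, ∇₂)`, so that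
`d CS(∇₁,∇₂,∇₃) = ch(∇₂) - ch(∇₁) - ch(∇₃)`. -/
def KRelation (g₁ g₂ g₃ : KGenerator.{u, w} d B) : Prop :=
  ∃ (i : FiberHom g₁.V g₂.V) (j : FiberHom g₂.V g₃.V)
    (σ : FiberHom g₃.V g₂.V) (p : FiberHom g₂.V g₁.V),
    IsSplitShortExact i j σ p ∧
    ∃ η₁ η₂ η₃ : OddForms d B, Submodule.Quotient.mk η₁ = g₁.α ∧
      Submodule.Quotient.mk η₂ = g₂.α ∧ Submodule.Quotient.mk η₃ = g₃.α ∧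
      ∃ β : (k : ℕ) → smoothForms d B ℂ (2 * k),
        ∀ (k : ℕ) (b : B) (X : Fin (2 * k + 1) → TangentSpace (𝓡 d) b),
          (((η₂ k).1 b X : ℝ) : ℂ) = (((η₁ k).1 b X : ℝ) : ℂ) + (((η₃ k).1 b X : ℝ) : ℂ) +
            chernSimonsForm (sumConnection i j σ p g₁.D g₃.D) g₂.D k b X + extDer (β k) b X

variable (d B)

/-- The subgroup generated by the `R/Z` K-relations `g₂ = g₁ + g₃`. -/
def relations : AddSubgroup (FreeAbelianGroup (KGenerator.{u, w} d B)) :=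
  AddSubgroup.closure {x | ∃ g₁ g₂ g₃ : KGenerator.{u, w} d B, KRelation g₁ g₂ g₃ ∧
    x = FreeAbelianGroup.of g₂ - FreeAbelianGroup.of g₁ - FreeAbelianGroup.of g₃}

/-- `MK_{R/Z}(B)`: the free abelian group on the `R/Z` K-generators modulo the `R/Z` K-relations. -/
abbrev MK : Type _ := FreeAbelianGroup (KGenerator.{u, w} d B) ⧸ relations.{u, w} d B

/-- The virtual rank, a function on `B`. -/
noncomputable def virtualRank : FreeAbelianGroup (KGenerator.{u, w} d B) →+ (B → ℤ) :=
  FreeAbelianGroup.lift fun g b => (Module.finrank ℂ (g.V.fiber b) : ℤ)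

/-- `K^{-1}_{R/Z}(B)`: the subgroup of `MK_{R/Z}(B)` of the elements of virtual rank zero. -/
noncomputable def KMinusOne : AddSubgroup (MK.{u, w} d B) :=
  (virtualRank.{u, w} d B).ker.map (QuotientAddGroup.mk' (relations.{u, w} d B))

variable {d B}

/-- The class in `MK_{R/Z}(B)` of the `R/Z` K-generator `(V, h, ∇, α)`. -/
def classOf {V : Family.{u, w} B} {h : Pairing V} {D : Oper d V} {α : OddClass d B}
    (H : IsKGenerator V h D α) : MK.{u, w} d B :=
  QuotientAddGroup.mk' (relations.{u, w} d B) (FreeAbelianGroup.of ⟨V, h, D, α, H⟩)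

variable (d B)

/-- The trivial complex line bundle. -/
abbrev trivialLine : Family.{u, w} B where
  fiber _ := ULift.{w} ℂ
  SmoothAt s x := SmoothNear d (fun b => (s b).down) x

/-- The trivial metric on the trivial line bundle. -/
noncomputable def trivialMetric : Pairing (trivialLine.{u, w} d B) :=
  fun _ x y => (starRingEnd ℂ) x.down * y.down

/-- The trivial connection on the trivial line bundle. -/
noncomputable def trivialConnection : Oper d (trivialLine.{u, w} d B) :=
  fun s b X => ULift.up (mvfderiv (𝓡 d) (fun y => (s y).down) b X : ℂ)

end KGroup

section Complexes

variable (d : ℕ) (B : Type u) [TopologicalSpace B] [ChartedSpace (EuclideanSpace ℝ (Fin d)) B]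
  [IsManifold (𝓡 d) ∞ B]

/-- Flat cochain complexes `0 → E^0 → E^1 → ... → E^n → 0` of complex vector bundles over `B`;
the bundles `E^i` with `i > n` are zero. -/
structure FlatComplex where
  /-- the length -/
  n : ℕ
  /-- the bundles -/
  E : ℕ → Family.{u, w} B
  /-- the differential -/
  v : (i : ℕ) → FiberHom (E i) (E (i + 1))
  /-- the connections -/
  D : (i : ℕ) → Oper d (E i)
  bundle : ∀ i, IsVectorBundle d (E i)
  zero_of_gt : ∀ i, n < i → ∀ b, Subsingleton ((E i).fiber b)
  smooth_v : ∀ i, IsSmoothHom (v i)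
  v_comp_v : ∀ i b x, v (i + 1) b (v i b x) = 0
  connection : ∀ i, IsConnection (E i) (D i)
  flat : ∀ i, IsFlat (D i)
  commute : ∀ (i : ℕ) (s : (E i).Sec) (b : B) (X : TangentSpace (𝓡 d) b), (E i).SmoothAt s b →
    D (i + 1) (fun y => v i y (s y)) b X = v i b (D i s b X)

variable {d B}

namespace FlatComplex

variable (C : FlatComplex.{u, w} d B)

/-- `ker v` in the fibre of `E^i`. -/
def cycles (i : ℕ) (b : B) : Submodule ℂ ((C.E i).fiber b) := LinearMap.ker (C.v i b)

/-- `im v` in the fibre of `E^i`. -/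
def boundaries : (i : ℕ) → (b : B) → Submodule ℂ ((C.E i).fiber b)
  | 0, _ => ⊥
  | i + 1, b => LinearMap.range (C.v i b)

/-- The cohomology `H^i(E,v)_b` of the fibre over `b`. -/
abbrev cohomologyFiber (i : ℕ) (b : B) : Type w :=
  C.cycles i b ⧸ (C.boundaries i b).submoduleOf (C.cycles i b)

/-- The class in `H^i(E,v)_b` of a cocycle. -/
def toCohomology (i : ℕ) (b : B) : C.cycles i b →ₗ[ℂ] C.cohomologyFiber i b :=
  ((C.boundaries i b).submoduleOf (C.cycles i b)).mkQ

/-- `t` is a smooth lift near `x` of the section `s` of `H^i(E,v)` to a section of `ker v`. -/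
def IsLift (i : ℕ) (t : (b : B) → C.cycles i b) (s : (b : B) → C.cohomologyFiber i b) (x : B) :
    Prop :=
  (C.E i).SmoothAt (fun b => (t b : (C.E i).fiber b)) x ∧
    ∀ᶠ y in 𝓝 x, C.toCohomology i y (t y) = s y

/-- `H^i(E,v)`: its smooth sections are locally the classes of smooth sections of `ker v`. -/
abbrev H (i : ℕ) : Family.{u, w} B where
  fiber b := C.cohomologyFiber i b
  SmoothAt s x := ∃ t : (b : B) → C.cycles i b, C.IsLift i t s x

/-- The canonical connection on `H^i(E,v)`: `∇[t] = [∇t]` for smooth sections `t` of `ker v`. -/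
noncomputable def DH (i : ℕ) : Oper d (C.H i) :=
  fun s b X => Classical.epsilon fun c : C.cohomologyFiber i b =>
    ∃ t : (b : B) → C.cycles i b, C.IsLift i t s b ∧ ∃ z : C.cycles i b,
      (z : (C.E i).fiber b) = C.D i (fun y => (t y : (C.E i).fiber y)) b X ∧
        c = C.toCohomology i b z

variable (h : (i : ℕ) → Pairing (C.E i))

/-- The harmonic representative of a class: the representative in `ker (v + v*)`. In `E^i` this
kernel is `ker v ∩ ker v*`, and `ker v*` is the orthogonal complement of `im v`. -/
noncomputable def harmonic (i : ℕ) (b : B) (c : C.cohomologyFiber i b) : C.cycles i b :=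
  Classical.epsilon fun z : C.cycles i b =>
    C.toCohomology i b z = c ∧ ∀ y ∈ C.boundaries i b, h i b y (z : (C.E i).fiber b) = 0

/-- The metric on `H^i(E,v)` that the isomorphism with the subbundle `ker (v + v*)` induces. -/
noncomputable def hH (i : ℕ) : Pairing (C.H i) :=
  fun b c c' => h i b (C.harmonic h i b c : (C.E i).fiber b)
    (C.harmonic h i b c' : (C.E i).fiber b)

end FlatComplex

end Complexes

end LottK

/-!
Let `F` be a flat bundle with a Hermitian metric `h`. Its Hermitian connection `∇^e` is the mean of
the two flat connections `∇` and `∇*`, so its curvature is `-ω²/4` with `ω = ∇* - ∇`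
(`curvature_of_mean`). A cyclic permutation of an even number of factors is odd, hence the traces of
the even powers of `ω` vanish and the Chern character form of `∇^e` is the rank. Thus `(F, h, ∇^e, 0)`
is a generator (`isKGenerator_of_flat`); its class is `F.cls h`.

The theorem follows once these classes are known to be additive in short exact sequences of flat
bundles, for arbitrary metrics (`IsFlatExact.cls_eq_add`): the sequences `0 → ker v → E^i → im v → 0`
and `0 → im v → ker v → H^i → 0` express `E^i` by `H^i` and images of `v`, and the latter cancel in the
alternating sum. Additivity is proved in two steps.

* *Induced metrics.* Let `0 → F₁ → F₂ → F₃ → 0` be an exact sequence of flat bundles whose outer terms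
  carry the metrics induced from the middle one, and split it orthogonally. The automorphism `r ⊕ 1`
  conjugates `∇₂`, which is upper triangular, to a connection with off-diagonal entry multiplied by
  `r`, and its inverse does the same to the lower triangular `∇₂*`. Hence each connection `∇_r` of the
  straight path from `∇₁^e ⊕ ∇₃^e` to `∇₂^e` is again the mean of two flat connections, with a
  difference `ω_r`, and `∇₂^e - ∇₁^e ⊕ ∇₃^e` is a multiple of `[ε, ω_r]` with `ε = 1 ⊕ (-1)`. The
  Chern-Simons integrand is a multiple of `Tr([ε, ω_r] ω_r^{2k})`, which vanishes because a cyclic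
  permutation of an odd number of factors is even. So the Chern-Simons form is zero, not merely exact
  (`IsOrthogonalExtension.chernSimonsForm_eq_zero`).

* *Independence of the metric* (`FlatBundle.cls_eq_cls`). For a smooth functional `τ` on `F`, the
  metric `|x|² + |τ x + c|²` on the flat bundle `F ⊕ ℂ` exhibits it as an extension of `ℂ` by
  `(F, h + |τ|²)`, and as an extension of `(F, h)` by `ℂ`. Therefore `h` and `h + |τ|²` give the same
  class, provided that the class of the trivial line does not depend on its metric; there the
  Chern-Simons form is a multiple of `dψ`, for the metric `e^ψ` (`cls_lineBundle`). On a compact base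
  every metric is a difference of sums of squares of functionals (`exists_add_sumsOfSquares`), so
  that `h`, `h + k` and `k` have the same class.

That `ker v` and `im v` are bundles is a statement about parallel maps between flat bundles
(`exists_adapted_frame`). Instead of parallel transport, the proof uses that the coefficients which
measure the failure of a section to lie in the kernel satisfy a linear first order system, to which
Grönwall's inequality applies along rays in a chart.
-/


namespace LottK

universe u w

/-! ### Smooth functions and their derivatives along coordinate fields -/

section SmoothFunctions

variable {d : ℕ} {B : Type u} [TopologicalSpace B] [ChartedSpace (EuclideanSpace ℝ (Fin d)) B]

namespace SmoothNear

variable {f g : B → ℂ} {x : B}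

theorem contMDiffAt (hf : SmoothNear d f x) : ContMDiffAt (𝓡 d) 𝓘(ℝ, ℂ) ∞ f x := hf.self_of_nhds

theorem mdifferentiableAt (hf : SmoothNear d f x) : MDifferentiableAt (𝓡 d) 𝓘(ℝ, ℂ) f x :=
  hf.contMDiffAt.mdifferentiableAt (by simp)

theorem eventually (hf : SmoothNear d f x) : ∀ᶠ y in 𝓝 x, SmoothNear d f y :=
  eventually_eventually_nhds.2 hf

theorem congr (hf : SmoothNear d f x) (h : ∀ᶠ y in 𝓝 x, g y = f y) : SmoothNear d g x := by
  filter_upwards [hf, eventually_eventually_nhds.2 h] with y hy hy'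
  exact hy.congr_of_eventuallyEq hy'

theorem const (c : ℂ) (x : B) : SmoothNear d (fun _ => c) x :=
  Eventually.of_forall fun _ => contMDiffAt_const

theorem add (hf : SmoothNear d f x) (hg : SmoothNear d g x) :
    SmoothNear d (fun y => f y + g y) x := by
  filter_upwards [hf, hg] with y hy hy' using hy.add hy'

theorem comp_contDiffAt {φ : ℂ → ℂ} (hf : SmoothNear d f x)
    (h : ∀ᶠ y in 𝓝 x, ContDiffAt ℝ ∞ φ (f y)) : SmoothNear d (fun y => φ (f y)) x := by
  filter_upwards [hf, h] with y hy hy'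
  exact hy'.contMDiffAt.comp y hy

theorem comp_contDiff {φ : ℂ → ℂ} (hφ : ContDiff ℝ ∞ φ) (hf : SmoothNear d f x) :
    SmoothNear d (fun y => φ (f y)) x :=
  hf.comp_contDiffAt (Eventually.of_forall fun _ => hφ.contDiffAt)

theorem mul (hf : SmoothNear d f x) (hg : SmoothNear d g x) :
    SmoothNear d (fun y => f y * g y) x := by
  filter_upwards [hf, hg] with y hy hy'
  have h : ContDiff ℝ ∞ (fun p : ℂ × ℂ => p.1 * p.2) := contDiff_fst.mul contDiff_snd
  exact h.contDiffAt.contMDiffAt.comp y (hy.prodMk_space hy')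

theorem neg (hf : SmoothNear d f x) : SmoothNear d (fun y => -f y) x :=
  hf.comp_contDiff contDiff_neg

theorem sub (hf : SmoothNear d f x) (hg : SmoothNear d g x) :
    SmoothNear d (fun y => f y - g y) x := by
  simpa only [sub_eq_add_neg] using hf.add hg.neg

theorem conj (hf : SmoothNear d f x) : SmoothNear d (fun y => (starRingEnd ℂ) (f y)) x :=
  hf.comp_contDiff (φ := fun z => (starRingEnd ℂ) z) Complex.conjCLE.contDiff

theorem inv (hf : SmoothNear d f x) (h : f x ≠ 0) : SmoothNear d (fun y => (f y)⁻¹) x := by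
  refine hf.comp_contDiffAt (φ := fun z => z⁻¹) ?_
  filter_upwards [hf.contMDiffAt.continuousAt.eventually_ne h] with y hy
  exact contDiffAt_inv ℝ hy

theorem sum {ι : Type*} {s : Finset ι} {f : ι → B → ℂ} (h : ∀ i ∈ s, SmoothNear d (f i) x) :
    SmoothNear d (fun y => ∑ i ∈ s, f i y) x := by
  classical
  induction s using Finset.induction_on with
  | empty => simpa using const 0 x
  | insert a s ha ih =>
    simp only [Finset.sum_insert ha]
    exact (h a (by simp)).add (ih fun i hi => h i (by simp [hi]))

theorem prod {ι : Type*} {s : Finset ι} {f : ι → B → ℂ} (h : ∀ i ∈ s, SmoothNear d (f i) x) :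
    SmoothNear d (fun y => ∏ i ∈ s, f i y) x := by
  classical
  induction s using Finset.induction_on with
  | empty => simpa using const 1 x
  | insert a s ha ih =>
    simp only [Finset.prod_insert ha]
    exact (h a (by simp)).mul (ih fun i hi => h i (by simp [hi]))

theorem det {ι : Type*} [Fintype ι] [DecidableEq ι] {A : B → Matrix ι ι ℂ}
    (h : ∀ i j, SmoothNear d (fun y => A y i j) x) : SmoothNear d (fun y => (A y).det) x := by
  simp only [Matrix.det_apply']
  exact sum fun σ _ => (const _ x).mul (prod fun i _ => h _ _)

theorem matrix_inv {ι : Type*} [Fintype ι] [DecidableEq ι] {A : B → Matrix ι ι ℂ}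
    (h : ∀ i j, SmoothNear d (fun y => A y i j) x) (hx : (A x).det ≠ 0) (i j : ι) :
    SmoothNear d (fun y => (A y)⁻¹ i j) x := by
  simp only [Matrix.inv_def, Matrix.smul_apply, smul_eq_mul, Ring.inverse_eq_inv',
    Matrix.adjugate_apply]
  refine ((det h).inv hx).mul (det fun k l => ?_)
  by_cases hk : k = j
  · subst hk
    simpa using const _ x
  · simpa [Matrix.updateRow_ne hk] using h k l

end SmoothNear

/-- The tangent space at `b`, identified with the model space by the preferred chart at `b`. The two
spaces are the same type by definition. -/
def toModel (b : B) : TangentSpace (𝓡 d) b ≃ₗ[ℝ] EuclideanSpace ℝ (Fin d) :=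
  LinearEquiv.refl ℝ (EuclideanSpace ℝ (Fin d))

section Derivatives

variable {f g : B → ℂ} {x : B}

theorem hasFDerivAt_chart_self (hf : SmoothNear d f x) :
    ∃ L : EuclideanSpace ℝ (Fin d) →L[ℝ] ℂ,
      HasFDerivAt (f ∘ (extChartAt (𝓡 d) x).symm) L (extChartAt (𝓡 d) x x) ∧
      ∀ X : TangentSpace (𝓡 d) x, mvfderiv (𝓡 d) f x X = L (toModel x X) := by
  obtain ⟨L, h, hL⟩ : ∃ L : EuclideanSpace ℝ (Fin d) →L[ℝ] ℂ,
      HasFDerivWithinAt (f ∘ (extChartAt (𝓡 d) x).symm) L (Set.range (𝓡 d))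
        (extChartAt (𝓡 d) x x) ∧
      ∀ X : TangentSpace (𝓡 d) x, mvfderiv (𝓡 d) f x X = L (toModel x X) :=
    ⟨mfderiv (𝓡 d) 𝓘(ℝ, ℂ) f x, hf.mdifferentiableAt.hasMFDerivAt.2, fun X => rfl⟩
  rw [ModelWithCorners.range_eq_univ, hasFDerivWithinAt_univ] at h
  exact ⟨L, h, hL⟩

/-- The derivative of a function at `x`, computed in the preferred chart at `x`. -/
theorem mvfderiv_eq_fderiv (hf : SmoothNear d f x) (X : TangentSpace (𝓡 d) x) :
    mvfderiv (𝓡 d) f x X =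
      fderiv ℝ (f ∘ (extChartAt (𝓡 d) x).symm) (extChartAt (𝓡 d) x x) (toModel x X) := by
  obtain ⟨L, hL, h⟩ := hasFDerivAt_chart_self hf
  rw [h, hL.fderiv]

theorem differentiableAt_chart_self (hf : SmoothNear d f x) :
    DifferentiableAt ℝ (f ∘ (extChartAt (𝓡 d) x).symm) (extChartAt (𝓡 d) x x) := by
  obtain ⟨L, hL, h⟩ := hasFDerivAt_chart_self hf
  exact hL.differentiableAt

theorem mvfderiv_congr (h : ∀ᶠ y in 𝓝 x, f y = g y) (X : TangentSpace (𝓡 d) x) :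
    mvfderiv (𝓡 d) f x X = mvfderiv (𝓡 d) g x X := by
  have h' : f =ᶠ[𝓝 x] g := h
  exact DFunLike.congr_fun h'.mfderiv_eq X

theorem mvfderiv_add_apply (hf : SmoothNear d f x) (hg : SmoothNear d g x)
    (X : TangentSpace (𝓡 d) x) : mvfderiv (𝓡 d) (fun y => f y + g y) x X =
      mvfderiv (𝓡 d) f x X + mvfderiv (𝓡 d) g x X := by
  rw [mvfderiv_eq_fderiv hf, mvfderiv_eq_fderiv hg, mvfderiv_eq_fderiv (hf.add hg),
    ← add_apply,
    ← fderiv_add (differentiableAt_chart_self hf) (differentiableAt_chart_self hg)]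
  rfl

theorem mvfderiv_mul_apply (hf : SmoothNear d f x) (hg : SmoothNear d g x)
    (X : TangentSpace (𝓡 d) x) : mvfderiv (𝓡 d) (fun y => f y * g y) x X =
      mvfderiv (𝓡 d) f x X * g x + f x * mvfderiv (𝓡 d) g x X := by
  have h := fderiv_mul (differentiableAt_chart_self hf) (differentiableAt_chart_self hg)
  rw [mvfderiv_eq_fderiv hf, mvfderiv_eq_fderiv hg, mvfderiv_eq_fderiv (hf.mul hg)]
  refine (DFunLike.congr_fun h _).trans ?_
  simp only [add_apply, smul_apply, smul_eq_mul,
    Function.comp_apply, extChartAt_to_inv]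
  ring

theorem mvfderiv_clm (L : ℂ →L[ℝ] ℂ) (hf : SmoothNear d f x) (X : TangentSpace (𝓡 d) x) :
    mvfderiv (𝓡 d) (fun y => L (f y)) x X = L (mvfderiv (𝓡 d) f x X) := by
  have h := L.hasFDerivAt.comp _ (differentiableAt_chart_self hf).hasFDerivAt
  rw [mvfderiv_eq_fderiv hf, mvfderiv_eq_fderiv (hf.comp_contDiff L.contDiff)]
  exact DFunLike.congr_fun h.fderiv _

theorem mvfderiv_conj (hf : SmoothNear d f x) (X : TangentSpace (𝓡 d) x) :
    mvfderiv (𝓡 d) (fun y => (starRingEnd ℂ) (f y)) x X =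
      (starRingEnd ℂ) (mvfderiv (𝓡 d) f x X) :=
  mvfderiv_clm (Complex.conjCLE : ℂ →L[ℝ] ℂ) hf X

theorem mvfderiv_const_apply (c : ℂ) (X : TangentSpace (𝓡 d) x) :
    mvfderiv (𝓡 d) (fun _ : B => c) x X = 0 := by
  rw [mvfderiv_const]; rfl

theorem mvfderiv_const_mul (c : ℂ) (hf : SmoothNear d f x) (X : TangentSpace (𝓡 d) x) :
    mvfderiv (𝓡 d) (fun y => c * f y) x X = c * mvfderiv (𝓡 d) f x X := by
  rw [mvfderiv_mul_apply (SmoothNear.const c x) hf, mvfderiv_const_apply]; simp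

theorem mvfderiv_sum_apply {ι : Type*} {s : Finset ι} {f : ι → B → ℂ}
    (h : ∀ i ∈ s, SmoothNear d (f i) x) (X : TangentSpace (𝓡 d) x) :
    mvfderiv (𝓡 d) (fun y => ∑ i ∈ s, f i y) x X = ∑ i ∈ s, mvfderiv (𝓡 d) (f i) x X := by
  classical
  induction s using Finset.induction_on with
  | empty => simpa using mvfderiv_const_apply 0 X
  | insert a s ha ih =>
    simp only [Finset.sum_insert ha]
    rw [mvfderiv_add_apply (h a (by simp)) (SmoothNear.sum fun i hi => h i (by simp [hi])),
      ih fun i hi => h i (by simp [hi])]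

end Derivatives

variable [IsManifold (𝓡 d) ∞ B]

theorem coordField_self (b : B) (X : TangentSpace (𝓡 d) b) : coordField b X b = X :=
  tangentCoordChange_self (I := 𝓡 d) (v := toModel b X) (mem_extChartAt_source b)

/-- Differentiating along a coordinate field is differentiating in the chart in a fixed
direction. -/
theorem mvfderiv_coordField {f : B → ℂ} {b y : B} (hf : SmoothNear d f y)
    (hy : y ∈ (extChartAt (𝓡 d) b).source) (X : TangentSpace (𝓡 d) b) :
    mvfderiv (𝓡 d) f y (coordField b X y) =
      fderiv ℝ (f ∘ (extChartAt (𝓡 d) b).symm) (extChartAt (𝓡 d) b y)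
        (toModel b X) := by
  obtain ⟨L, h1, hL⟩ := hasFDerivAt_chart_self hf
  have h2 := hasFDerivWithinAt_tangentCoordChange (I := 𝓡 d) (x := b) (y := y) (z := y)
    ⟨hy, mem_extChartAt_source y⟩
  rw [ModelWithCorners.range_eq_univ, hasFDerivWithinAt_univ] at h2
  have e : extChartAt (𝓡 d) y y =
      ((extChartAt (𝓡 d) y) ∘ (extChartAt (𝓡 d) b).symm) (extChartAt (𝓡 d) b y) := by
    rw [Function.comp_apply, (extChartAt (𝓡 d) b).left_inv hy]
  rw [e] at h1
  have h3 := h1.comp _ h2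
  have h4 : HasFDerivAt (f ∘ (extChartAt (𝓡 d) b).symm)
      (L.comp (tangentCoordChange (𝓡 d) b y y)) (extChartAt (𝓡 d) b y) := by
    refine h3.congr_of_eventuallyEq ?_
    have hc : ContinuousAt (extChartAt (𝓡 d) b).symm (extChartAt (𝓡 d) b y) :=
      continuousAt_extChartAt_symm' hy
    have hmem : (extChartAt (𝓡 d) y).source ∈ 𝓝 ((extChartAt (𝓡 d) b).symm
        (extChartAt (𝓡 d) b y)) := by
      rw [(extChartAt (𝓡 d) b).left_inv hy]
      exact extChartAt_source_mem_nhds y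
    filter_upwards [hc hmem] with z hz
    simp only [Function.comp_apply]
    rw [(extChartAt (𝓡 d) y).left_inv hz]
  rw [h4.fderiv, hL]
  rfl

theorem SmoothNear.contDiffAt_chart {f : B → ℂ} {b y : B} (hf : SmoothNear d f y)
    (hy : y ∈ (extChartAt (𝓡 d) b).source) :
    ContDiffAt ℝ ∞ (f ∘ (extChartAt (𝓡 d) b).symm) (extChartAt (𝓡 d) b y) := by
  have h1 : ContMDiffAt 𝓘(ℝ, EuclideanSpace ℝ (Fin d)) (𝓡 d) ∞ (extChartAt (𝓡 d) b).symm
      (extChartAt (𝓡 d) b y) :=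
    (contMDiffOn_extChartAt_symm b).contMDiffAt
      (extChartAt_target_mem_nhds' ((extChartAt (𝓡 d) b).map_source hy))
  have h2 := hf.contMDiffAt
  rw [← (extChartAt (𝓡 d) b).left_inv hy] at h2
  exact (h2.comp _ h1).contDiffAt

theorem smoothNear_comp_chart {F : EuclideanSpace ℝ (Fin d) → ℂ} {b x : B}
    (hx : x ∈ (extChartAt (𝓡 d) b).source)
    (hF : ∀ᶠ y in 𝓝 x, ContDiffAt ℝ ∞ F (extChartAt (𝓡 d) b y)) :
    SmoothNear d (fun y => F (extChartAt (𝓡 d) b y)) x := by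
  filter_upwards [hF, extChartAt_source_mem_nhds' hx] with y hy hy'
  rw [extChartAt_source] at hy'
  exact hy.contMDiffAt.comp y (contMDiffAt_extChartAt' hy')

theorem SmoothNear.mvfderiv_coordField {f : B → ℂ} {b x : B} (hf : SmoothNear d f x)
    (hx : x ∈ (extChartAt (𝓡 d) b).source) (X : TangentSpace (𝓡 d) b) :
    SmoothNear d (fun y => mvfderiv (𝓡 d) f y (coordField b X y)) x := by
  have hF : ∀ᶠ y in 𝓝 x, ContDiffAt ℝ ∞ (fun z => fderiv ℝ (f ∘ (extChartAt (𝓡 d) b).symm) z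
      (toModel b X)) (extChartAt (𝓡 d) b y) := by
    filter_upwards [hf.eventually, extChartAt_source_mem_nhds' hx] with y hy hy'
    exact ((hy.contDiffAt_chart hy').fderiv_right (m := ∞) (by simp)).clm_apply contDiffAt_const
  refine (smoothNear_comp_chart hx hF).congr ?_
  filter_upwards [hf.eventually, extChartAt_source_mem_nhds' hx] with y hy hy'
  exact LottK.mvfderiv_coordField hy hy' X

/-- Coordinate fields commute: second derivatives in the chart are symmetric. -/
theorem mvfderiv_mvfderiv_comm {f : B → ℂ} {b : B} (hf : SmoothNear d f b)
    (X Y : TangentSpace (𝓡 d) b) :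
    mvfderiv (𝓡 d) (fun y => mvfderiv (𝓡 d) f y (coordField b X y)) b Y =
      mvfderiv (𝓡 d) (fun y => mvfderiv (𝓡 d) f y (coordField b Y y)) b X := by
  have hb := mem_extChartAt_source (I := 𝓡 d) b
  have hs := (hf.contDiffAt_chart hb).isSymmSndFDerivAt (by
    rw [minSmoothness_of_isRCLikeNormedField]
    exact WithTop.coe_le_coe.2 (le_top (a := (2 : ℕ∞))))
  have hd : DifferentiableAt ℝ (fderiv ℝ (f ∘ (extChartAt (𝓡 d) b).symm))
      (extChartAt (𝓡 d) b b) :=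
    ((hf.contDiffAt_chart hb).fderiv_right (m := ∞) (by simp)).differentiableAt (by simp)
  have key : ∀ X Y : TangentSpace (𝓡 d) b,
      mvfderiv (𝓡 d) (fun y => mvfderiv (𝓡 d) f y (coordField b X y)) b Y =
      fderiv ℝ (fderiv ℝ (f ∘ (extChartAt (𝓡 d) b).symm)) (extChartAt (𝓡 d) b b)
        (toModel b Y) (toModel b X) := by
    intro X Y
    conv_lhs => rw [← coordField_self b Y]
    rw [LottK.mvfderiv_coordField (hf.mvfderiv_coordField hb X) hb Y]
    have : (fun y => mvfderiv (𝓡 d) f y (coordField b X y)) ∘ (extChartAt (𝓡 d) b).symm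
        =ᶠ[𝓝 (extChartAt (𝓡 d) b b)] fun z =>
          fderiv ℝ (f ∘ (extChartAt (𝓡 d) b).symm) z (toModel b X) := by
      have h1 : ∀ᶠ z in 𝓝 (extChartAt (𝓡 d) b b), SmoothNear d f ((extChartAt (𝓡 d) b).symm z) :=
        (continuousAt_extChartAt_symm (I := 𝓡 d) b).eventually
          (by rw [(extChartAt (𝓡 d) b).left_inv hb]; exact hf.eventually)
      filter_upwards [h1, extChartAt_target_mem_nhds (I := 𝓡 d) b] with z hz hz'
      have := LottK.mvfderiv_coordField hz ((extChartAt (𝓡 d) b).map_target hz') X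
      rw [(extChartAt (𝓡 d) b).right_inv hz'] at this
      exact this
    rw [this.fderiv_eq, fderiv_clm_apply hd (differentiableAt_const _)]
    simp
  rw [key, key]
  exact hs _ _

end SmoothFunctions

/-! ### Local frames of vector bundles -/

section Frames

variable {d : ℕ} {B : Type u} [TopologicalSpace B] [ChartedSpace (EuclideanSpace ℝ (Fin d)) B]

variable (d) in
/-- The sections `e j` form a local frame of `V` near `x`, and near `x` the smooth sections are those
whose coefficients with respect to the frame are smooth. -/
def IsFrame (V : Family.{u, w} B) {ι : Type*} [Fintype ι] (e : ι → V.Sec) (x : B) : Prop :=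
  ∀ᶠ y in 𝓝 x, (LinearIndependent ℂ (fun j => e j y) ∧
      Submodule.span ℂ (Set.range fun j => e j y) = ⊤) ∧
    ∀ (s : V.Sec) (c : ι → B → ℂ), (∀ᶠ z in 𝓝 y, s z = ∑ j, c j z • e j z) →
      (V.SmoothAt s y ↔ ∀ j, SmoothNear d (c j) y)

theorem exists_coeff_of_span_eq_top {K M ι : Type*} [Field K] [AddCommGroup M] [Module K M]
    [Fintype ι] {e : ι → M} (h : Submodule.span K (Set.range e) = ⊤) (u : M) :
    ∃ c : ι → K, u = ∑ j, c j • e j := by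
  have hu : u ∈ Submodule.span K (Set.range e) := by rw [h]; trivial
  obtain ⟨c, hc⟩ := (Submodule.mem_span_range_iff_exists_fun K).1 hu
  exact ⟨c, hc.symm⟩

/-- A linearly independent family can be completed to a basis. -/
theorem exists_basis_sum_elim {K M ι : Type*} [Field K] [AddCommGroup M] [Module K M]
    [Module.Finite K M] {v : ι → M} (h : LinearIndependent K v) :
    ∃ (k : ℕ) (g : Fin k → M), LinearIndependent K (Sum.elim v g) ∧
      Submodule.span K (Set.range (Sum.elim v g)) = ⊤ := by
  obtain ⟨W, hW⟩ := Submodule.exists_isCompl (Submodule.span K (Set.range v))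
  let b := ((Module.Basis.span h).prod (Module.finBasis K W)).map
    (Submodule.prodEquivOfIsCompl _ W hW)
  have hb : Sum.elim v (fun k => (Module.finBasis K W k : M)) = b := by
    funext j
    rcases j with j | k
    · simp [b, Module.Basis.span_apply]
    · simp [b]
  refine ⟨_, fun k => Module.finBasis K W k, ?_, ?_⟩
  · rw [hb]; exact b.linearIndependent
  · rw [hb]; exact b.span_eq

variable {V : Family.{u, w} B} {x : B} {ι κ : Type*} [Fintype ι] [Fintype κ]

namespace IsFrame

variable {e : ι → V.Sec}

theorem eventually (he : IsFrame d V e x) : ∀ᶠ y in 𝓝 x, IsFrame d V e y :=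
  eventually_eventually_nhds.2 he

theorem linearIndependent (he : IsFrame d V e x) : LinearIndependent ℂ fun j => e j x :=
  he.self_of_nhds.1.1

theorem span_eq_top (he : IsFrame d V e x) :
    Submodule.span ℂ (Set.range fun j => e j x) = ⊤ :=
  he.self_of_nhds.1.2

theorem smoothAt_iff (he : IsFrame d V e x) {s : V.Sec} {c : ι → B → ℂ}
    (hs : ∀ᶠ z in 𝓝 x, s z = ∑ j, c j z • e j z) :
    V.SmoothAt s x ↔ ∀ j, SmoothNear d (c j) x :=
  he.self_of_nhds.2 s c hs

theorem exists_coeff (he : IsFrame d V e x) (s : V.Sec) :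
    ∃ c : ι → B → ℂ, ∀ᶠ z in 𝓝 x, s z = ∑ j, c j z • e j z := by
  classical
  refine ⟨fun j z => if h : ∃ c : ι → ℂ, s z = ∑ j, c j • e j z then h.choose j else 0, ?_⟩
  filter_upwards [he] with z hz
  have h := exists_coeff_of_span_eq_top hz.1.2 (s z)
  simp only [dif_pos h]
  exact h.choose_spec

theorem smooth (he : IsFrame d V e x) (j : ι) : V.SmoothAt (e j) x := by
  classical
  refine (he.smoothAt_iff (c := fun i _ => if i = j then 1 else 0) ?_).2
    fun i => SmoothNear.const _ x
  simp

theorem exists_smooth_coeff (he : IsFrame d V e x) {s : V.Sec} (hs : V.SmoothAt s x) :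
    ∃ c : ι → B → ℂ, (∀ᶠ z in 𝓝 x, s z = ∑ j, c j z • e j z) ∧ ∀ j, SmoothNear d (c j) x := by
  obtain ⟨c, hc⟩ := he.exists_coeff s
  exact ⟨c, hc, (he.smoothAt_iff hc).1 hs⟩

theorem reindex (he : IsFrame d V e x) (σ : κ ≃ ι) : IsFrame d V (fun k => e (σ k)) x := by
  filter_upwards [he] with y hy
  refine ⟨⟨hy.1.1.comp _ σ.injective, ?_⟩, fun s c hs => ?_⟩
  · rw [← hy.1.2]
    congr 1
    exact σ.surjective.range_comp fun j => e j y
  · rw [hy.2 s (fun j => c (σ.symm j))]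
    · exact ⟨fun h k => by simpa using h (σ k), fun h j => h _⟩
    · filter_upwards [hs] with z hz
      rw [hz]
      exact Fintype.sum_equiv σ _ _ fun k => by simp

end IsFrame

theorem IsVectorBundle.exists_frame (hV : IsVectorBundle d V) (x : B) :
    ∃ (r : ℕ) (e : Fin r → V.Sec), IsFrame d V e x := by
  obtain ⟨r, U, e, hU, hx, h1, h2⟩ := hV x
  refine ⟨r, e, ?_⟩
  filter_upwards [hU.mem_nhds hx] with y hy
  exact ⟨h1 y hy, fun s c hs => h2 y hy s c hs⟩

theorem isVectorBundle_of_frames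
    (h : ∀ x : B, ∃ (r : ℕ) (e : Fin r → V.Sec), IsFrame d V e x) : IsVectorBundle d V := by
  intro x
  obtain ⟨r, e, he⟩ := h x
  obtain ⟨U, hU, hUo, hx⟩ := eventually_nhds_iff.1 he
  exact ⟨r, U, e, hUo, hx, fun y hy => (hU y hy).1, fun y hy => (hU y hy).2⟩

theorem isVectorBundle_of_frames' {ι : B → Type*} [∀ x, Fintype (ι x)]
    (h : ∀ x : B, ∃ e : ι x → V.Sec, IsFrame d V e x) : IsVectorBundle d V := by
  refine isVectorBundle_of_frames fun x => ?_
  obtain ⟨e, he⟩ := h x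
  exact ⟨_, _, he.reindex (Fintype.equivFin (ι x)).symm⟩

namespace IsVectorBundle

variable {s t : V.Sec} (hV : IsVectorBundle d V)

include hV

theorem smoothAt_congr (hs : V.SmoothAt s x) (h : ∀ᶠ y in 𝓝 x, t y = s y) : V.SmoothAt t x := by
  obtain ⟨r, e, he⟩ := hV.exists_frame x
  obtain ⟨c, hc, hc'⟩ := he.exists_smooth_coeff hs
  refine (he.smoothAt_iff ?_).2 hc'
  filter_upwards [hc, h] with z hz hz'
  rw [hz', hz]

theorem smoothAt_eventually (hs : V.SmoothAt s x) : ∀ᶠ y in 𝓝 x, V.SmoothAt s y := by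
  obtain ⟨r, e, he⟩ := hV.exists_frame x
  obtain ⟨c, hc, hc'⟩ := he.exists_smooth_coeff hs
  filter_upwards [eventually_eventually_nhds.2 hc, he.eventually,
    eventually_all.2 fun j => (hc' j).eventually] with y hy hy' hy''
  exact (hy'.smoothAt_iff hy).2 hy''

theorem smoothAt_sum_smul {e : ι → V.Sec} {c : ι → B → ℂ} (he : ∀ j, V.SmoothAt (e j) x)
    (hc : ∀ j, SmoothNear d (c j) x) : V.SmoothAt (fun y => ∑ j, c j y • e j y) x := by
  obtain ⟨r, f, hf⟩ := hV.exists_frame x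
  choose a ha ha' using fun j => hf.exists_smooth_coeff (he j)
  refine (hf.smoothAt_iff (c := fun k y => ∑ j, c j y * a j k y) ?_).2
    fun k => SmoothNear.sum fun j _ => (hc j).mul (ha' j k)
  filter_upwards [eventually_all.2 ha] with z hz
  simp only [hz, Finset.smul_sum, Finset.sum_smul, mul_smul]
  exact Finset.sum_comm

theorem smoothAt_zero (x : B) : V.SmoothAt (fun _ => 0) x := by
  simpa using hV.smoothAt_sum_smul (x := x) (ι := Empty) (e := fun j => j.elim)
    (c := fun j => j.elim) (fun j => j.elim) (fun j => j.elim)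

theorem smoothAt_smul {f : B → ℂ} (hf : SmoothNear d f x) (hs : V.SmoothAt s x) :
    V.SmoothAt (fun y => f y • s y) x := by
  simpa using hV.smoothAt_sum_smul (ι := Unit) (e := fun _ => s) (c := fun _ => f)
    (fun _ => hs) (fun _ => hf)

theorem smoothAt_add (hs : V.SmoothAt s x) (ht : V.SmoothAt t x) :
    V.SmoothAt (fun y => s y + t y) x := by
  simpa using hV.smoothAt_sum_smul (ι := Fin 2) (e := ![s, t]) (c := fun _ _ => 1)
    (by simp [Fin.forall_fin_two, hs, ht]) (fun _ => SmoothNear.const 1 x)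

theorem smoothAt_const_smul (c : ℂ) (hs : V.SmoothAt s x) : V.SmoothAt (fun y => c • s y) x :=
  hV.smoothAt_smul (SmoothNear.const c x) hs

theorem smoothAt_sub (hs : V.SmoothAt s x) (ht : V.SmoothAt t x) :
    V.SmoothAt (fun y => s y - t y) x := by
  simpa [sub_eq_add_neg] using hV.smoothAt_add hs (hV.smoothAt_const_smul (-1) ht)

theorem exists_section (x : B) (a : V.fiber x) : ∃ s : V.Sec, V.SmoothAt s x ∧ s x = a := by
  obtain ⟨r, e, he⟩ := hV.exists_frame x
  obtain ⟨c, hc⟩ := exists_coeff_of_span_eq_top he.span_eq_top a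
  exact ⟨_, hV.smoothAt_sum_smul he.smooth fun j => SmoothNear.const (c j) x, hc.symm⟩

theorem finite_fiber (x : B) : Module.Finite ℂ (V.fiber x) := by
  obtain ⟨r, e, he⟩ := hV.exists_frame x
  exact Module.Finite.of_basis (Module.Basis.mk he.linearIndependent he.span_eq_top.ge)

omit hV in
/-- The transition matrix `A` from a frame `f` to the family `e` is invertible at `x`, hence near `x`,
and its inverse is smooth there. -/
theorem isFrame_of_basis_aux [DecidableEq ι] {e f : ι → V.Sec} (hf : IsFrame d V f x)
    (he : ∀ j, V.SmoothAt (e j) x) (h1 : LinearIndependent ℂ fun j => e j x)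
    (h2 : Submodule.span ℂ (Set.range fun j => e j x) = ⊤) : IsFrame d V e x := by
  choose a ha ha' using fun j => hf.exists_smooth_coeff (he j)
  set A : B → Matrix ι ι ℂ := fun y => Matrix.of fun i j => a j i y with hA
  have hdet : ∀ y, (∀ j, e j y = ∑ i, a j i y • f i y) →
      (LinearIndependent ℂ (fun j => f j y) ∧
        Submodule.span ℂ (Set.range fun j => f j y) = ⊤) →
      ((LinearIndependent ℂ (fun j => e j y) ∧
        Submodule.span ℂ (Set.range fun j => e j y) = ⊤) ↔ (A y).det ≠ 0) := by
    intro y hy hfy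
    set b := Module.Basis.mk hfy.1 hfy.2.ge
    rw [Module.Basis.is_basis_iff_det b, Module.Basis.det_apply, isUnit_iff_ne_zero]
    have : b.toMatrix (fun j => e j y) = A y := by
      ext i j
      rw [Module.Basis.toMatrix_apply]
      have : e j y = ∑ i, a j i y • b i := by simp [b, hy j]
      rw [this, b.repr_sum_self]
      rfl
    rw [this]
  have hsm : ∀ i j, SmoothNear d (fun y => A y i j) x := fun i j => ha' j i
  have hx : (A x).det ≠ 0 :=
    (hdet x (fun j => (ha j).self_of_nhds) hf.self_of_nhds.1).1 ⟨h1, h2⟩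
  have hne : ∀ᶠ y in 𝓝 x, (A y).det ≠ 0 :=
    (SmoothNear.det hsm).contMDiffAt.continuousAt.eventually_ne hx
  have hae : ∀ᶠ y in 𝓝 x, ∀ j, e j y = ∑ i, a j i y • f i y := eventually_all.2 ha
  have hsm' : ∀ᶠ y in 𝓝 x, ∀ i j, SmoothNear d (fun y => A y i j) y :=
    eventually_all.2 fun i => eventually_all.2 fun j => (hsm i j).eventually
  filter_upwards [hf.eventually, hne, eventually_eventually_nhds.2 hae, hsm',
    eventually_eventually_nhds.2 hne] with y hfy hny hay hsy hny'
  refine ⟨(hdet y hay.self_of_nhds hfy.self_of_nhds.1).2 hny, fun s c hs => ?_⟩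
  rw [hfy.smoothAt_iff (c := fun i z => ∑ j, A z i j * c j z)]
  · refine ⟨fun h j => ?_, fun h i => SmoothNear.sum fun j _ => (hsy i j).mul (h j)⟩
    refine (SmoothNear.sum fun i (_ : i ∈ Finset.univ) =>
      (SmoothNear.matrix_inv hsy hny j i).mul (h i)).congr ?_
    filter_upwards [hny'] with z hz
    have : ((A z)⁻¹.mulVec ((A z).mulVec fun k => c k z)) j = c j z := by
      rw [Matrix.mulVec_mulVec, Matrix.nonsing_inv_mul _ (isUnit_iff_ne_zero.2 hz),
        Matrix.one_mulVec]
    exact this.symm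
  · filter_upwards [hs, hay] with z hz hz'
    rw [hz]
    simp only [hz', Finset.smul_sum, Finset.sum_smul, smul_smul]
    rw [Finset.sum_comm]
    simp [hA, mul_comm]

/-- Smooth sections that form a basis of the fibre at `x` are a local frame near `x`. -/
theorem isFrame_of_basis {e : ι → V.Sec}
    (he : ∀ j, V.SmoothAt (e j) x) (h1 : LinearIndependent ℂ fun j => e j x)
    (h2 : Submodule.span ℂ (Set.range fun j => e j x) = ⊤) : IsFrame d V e x := by
  classical
  obtain ⟨r, f, hf⟩ := hV.exists_frame x
  let b := Module.Basis.mk h1 h2.ge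
  let b' := Module.Basis.mk hf.linearIndependent hf.span_eq_top.ge
  exact isFrame_of_basis_aux (hf.reindex (b.indexEquiv b')) he h1 h2

/-- Smooth sections that are linearly independent at one point can be completed to a local frame. -/
theorem exists_frame_extend {e : ι → V.Sec}
    (he : ∀ j, V.SmoothAt (e j) x) (h1 : LinearIndependent ℂ fun j => e j x) :
    ∃ (k : ℕ) (f : Fin k → V.Sec), IsFrame d V (Sum.elim e f) x := by
  have := hV.finite_fiber x
  obtain ⟨k, g, h2, h3⟩ := exists_basis_sum_elim h1
  choose f hf hf' using fun j => hV.exists_section x (g j)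
  have hb : (fun j => Sum.elim e f j x) = Sum.elim (fun j => e j x) g := by
    funext j
    rcases j with j | j <;> simp [hf']
  refine ⟨k, f, hV.isFrame_of_basis ?_ (by rwa [hb]) (by rwa [hb])⟩
  rintro (j | j)
  exacts [he j, hf j]

end IsVectorBundle

end Frames

/-! ### Connections -/

section Connections

variable {d : ℕ} {B : Type u} [TopologicalSpace B] [ChartedSpace (EuclideanSpace ℝ (Fin d)) B]
  [IsManifold (𝓡 d) ∞ B]

variable {V W : Family.{u, w} B} {D D₀ D₁ : Oper d V} {s t : V.Sec} {b : B}
  {X : TangentSpace (𝓡 d) b} {ι : Type*} [Fintype ι]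

namespace IsConnection

variable (hD : IsConnection V D)

include hD

/-- The derivative of a section depends on its germ only. -/
theorem congr (hV : IsVectorBundle d V) (hs : V.SmoothAt s b) (h : ∀ᶠ y in 𝓝 b, t y = s y) :
    D t b X = D s b X := by
  classical
  have ht := hV.smoothAt_congr hs h
  -- Multiplication by the indicator function of the set where `s = t` does not change the germs.
  let f : B → ℂ := fun y => if t y = s y then 1 else 0
  have hf1 : ∀ᶠ y in 𝓝 b, f y = 1 := by
    filter_upwards [h] with y hy
    simp [f, hy]
  have hf : SmoothNear d f b := (SmoothNear.const 1 b).congr hf1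
  have hdf : mvfderiv (𝓡 d) f b X = 0 := by
    rw [mvfderiv_congr hf1, mvfderiv_const_apply]
  have e : (fun y => f y • t y) = fun y => f y • s y := by
    funext y
    by_cases hy : t y = s y <;> simp [f, hy]
  have h1 := hD.leibniz f s b X hf hs
  have h2 := hD.leibniz f t b X hf ht
  rw [hdf, hf1.self_of_nhds] at h1 h2
  rw [e, h1] at h2
  simpa using h2.symm

theorem map_zero (hV : IsVectorBundle d V) : D (fun _ => 0) b X = 0 := by
  have h0 := hV.smoothAt_zero b
  have h := hD.add _ _ b X h0 h0
  have e : (fun _ => 0 : V.Sec) + (fun _ => 0) = fun _ => 0 := by funext; simp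
  rw [e] at h
  simpa using h

theorem map_add (hs : V.SmoothAt s b) (ht : V.SmoothAt t b) :
    D (fun y => s y + t y) b X = D s b X + D t b X :=
  hD.add s t b X hs ht

theorem map_const_smul (c : ℂ) (hs : V.SmoothAt s b) :
    D (fun y => c • s y) b X = c • D s b X := by
  rw [hD.leibniz (fun _ => c) s b X (SmoothNear.const c b) hs, mvfderiv_const_apply]
  simp

theorem map_sub (hV : IsVectorBundle d V) (hs : V.SmoothAt s b) (ht : V.SmoothAt t b) :
    D (fun y => s y - t y) b X = D s b X - D t b X := by
  have h := hD.map_add (X := X) hs (hV.smoothAt_const_smul (-1) ht)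
  rw [hD.map_const_smul (-1) ht] at h
  simpa [sub_eq_add_neg] using h

theorem map_sum_smul (hV : IsVectorBundle d V) {e : ι → V.Sec} {c : ι → B → ℂ}
    (he : ∀ j, V.SmoothAt (e j) b) (hc : ∀ j, SmoothNear d (c j) b) :
    D (fun y => ∑ j, c j y • e j y) b X =
      ∑ j, (mvfderiv (𝓡 d) (c j) b X • e j b + c j b • D (e j) b X) := by
  classical
  suffices h : ∀ S : Finset ι, V.SmoothAt (fun y => ∑ j ∈ S, c j y • e j y) b ∧
      D (fun y => ∑ j ∈ S, c j y • e j y) b X =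
        ∑ j ∈ S, (mvfderiv (𝓡 d) (c j) b X • e j b + c j b • D (e j) b X) from (h _).2
  intro S
  induction S using Finset.induction_on with
  | empty => simpa using ⟨hV.smoothAt_zero b, hD.map_zero hV⟩
  | insert a S ha ih =>
    have h1 := hV.smoothAt_smul (hc a) (he a)
    simp only [Finset.sum_insert ha]
    exact ⟨hV.smoothAt_add h1 ih.1, by
      rw [hD.map_add h1 ih.1, ih.2, hD.leibniz _ _ _ _ (hc a) (he a)]⟩

end IsConnection

omit [IsManifold (𝓡 d) ∞ B] in
/-- The endomorphism chosen in `endoAt` is unique, since every vector is the value of a section. -/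
theorem endoAt_eq (hV : IsVectorBundle d V) {P : V.Sec → V.fiber b}
    {L : Module.End ℂ (V.fiber b)} (h : ∀ s : V.Sec, V.SmoothAt s b → L (s b) = P s) :
    endoAt b P = L := by
  have h' : ∀ s : V.Sec, V.SmoothAt s b → endoAt b P (s b) = P s :=
    Classical.epsilon_spec (p := fun L : Module.End ℂ (V.fiber b) =>
      ∀ s : V.Sec, V.SmoothAt s b → L (s b) = P s) ⟨L, h⟩
  ext a
  obtain ⟨s, hs, rfl⟩ := hV.exists_section b a
  rw [h' s hs, h s hs]

/-- The difference of two connections is tensorial, so that `difference` is given by its defining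
property. -/
theorem difference_apply (hV : IsVectorBundle d V) (h₀ : IsConnection V D₀)
    (h₁ : IsConnection V D₁) (hs : V.SmoothAt s b) :
    difference D₀ D₁ b X (s b) = D₁ s b X - D₀ s b X := by
  obtain ⟨r, e, he⟩ := hV.exists_frame b
  let β := Module.Basis.mk he.linearIndependent he.span_eq_top.ge
  have key : ∀ s : V.Sec, V.SmoothAt s b →
      β.constr ℂ (fun j => D₁ (e j) b X - D₀ (e j) b X) (s b) = D₁ s b X - D₀ s b X := by
    intro s hs
    obtain ⟨c, hc, hc'⟩ := he.exists_smooth_coeff hs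
    have hsum := hV.smoothAt_sum_smul he.smooth hc'
    rw [h₁.congr hV hsum hc, h₀.congr hV hsum hc, h₁.map_sum_smul hV he.smooth hc',
      h₀.map_sum_smul hV he.smooth hc', ← Finset.sum_sub_distrib, hc.self_of_nhds]
    simp only [_root_.map_sum, map_smul]
    refine Finset.sum_congr rfl fun j _ => ?_
    have hj : e j b = β j := by simp [β]
    rw [hj, Module.Basis.constr_basis, smul_sub]
    abel
  rw [difference, endoAt_eq hV key, key s hs]

/-- The bundle map `φ` intertwines the connections `D` and `D'`. -/
def IsParallel (φ : FiberHom V W) (D : Oper d V) (D' : Oper d W) : Prop :=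
  ∀ (s : V.Sec) (b : B) (X : TangentSpace (𝓡 d) b), V.SmoothAt s b →
    D' (fun y => φ y (s y)) b X = φ b (D s b X)

/-- A parallel bundle map intertwines the curvatures. -/
theorem curvatureOn_map {φ : FiberHom V W} {D' : Oper d W} (hV : IsVectorBundle d V)
    (hW : IsVectorBundle d W) (hD : IsConnection V D) (hD' : IsConnection W D')
    (hφ : IsSmoothHom φ) (h : IsParallel φ D D') (hs : V.SmoothAt s b)
    (X Y : TangentSpace (𝓡 d) b) :
    curvatureOn D' b X Y (fun y => φ y (s y)) = φ b (curvatureOn D b X Y s) := by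
  have key : ∀ X Y : TangentSpace (𝓡 d) b,
      D' (fun y => D' (fun y => φ y (s y)) y (coordField b Y y)) b X =
        φ b (D (fun y => D s y (coordField b Y y)) b X) := by
    intro X Y
    have h1 := hD.smooth s b Y hs
    rw [← h _ b X h1]
    refine hD'.congr hW (hφ _ _ h1) ?_
    filter_upwards [hV.smoothAt_eventually hs] with y hy
    exact h s y _ hy
  simp only [curvatureOn, key, map_sub]

/-- Connections that agree on smooth sections have the same curvature. -/
theorem curvatureOn_congr (hV : IsVectorBundle d V) (h₀ : IsConnection V D₀)
    (h : ∀ (s : V.Sec) (b : B) (X : TangentSpace (𝓡 d) b), V.SmoothAt s b → D₁ s b X = D₀ s b X)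
    (hs : V.SmoothAt s b) (X Y : TangentSpace (𝓡 d) b) :
    curvatureOn D₁ b X Y s = curvatureOn D₀ b X Y s := by
  have key : ∀ X Y : TangentSpace (𝓡 d) b,
      D₁ (fun y => D₁ s y (coordField b Y y)) b X = D₀ (fun y => D₀ s y (coordField b Y y)) b X := by
    intro X Y
    have h1 := h₀.smooth s b Y hs
    have h2 : ∀ᶠ y in 𝓝 b, D₁ s y (coordField b Y y) = D₀ s y (coordField b Y y) := by
      filter_upwards [hV.smoothAt_eventually hs] with y hy using h s y _ hy
    rw [h _ b X (hV.smoothAt_congr h1 h2), h₀.congr hV h1 h2]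
  simp only [curvatureOn, key]

theorem isConnection_affine (hV : IsVectorBundle d V) (h₀ : IsConnection V D₀)
    (h₁ : IsConnection V D₁) {a c : ℂ} (hac : a + c = 1) :
    IsConnection V (fun s b X => a • D₀ s b X + c • D₁ s b X) where
  add s t b X hs ht := by
    simp only [h₀.add s t b X hs ht, h₁.add s t b X hs ht, smul_add]
    abel
  leibniz f s b X hf hs := by
    simp only [h₀.leibniz f s b X hf hs, h₁.leibniz f s b X hf hs, smul_add, smul_comm _ (f b)]
    have : ∀ z : V.fiber b, z = a • z + c • z := fun z => by rw [← add_smul, hac, one_smul]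
    conv_rhs => rw [this (mvfderiv (𝓡 d) f b X • s b)]
    abel
  add_vector s b X Y hs := by
    simp only [h₀.add_vector s b X Y hs, h₁.add_vector s b X Y hs, smul_add]
    abel
  smul_vector s b r X hs := by
    simp only [h₀.smul_vector s b r X hs, h₁.smul_vector s b r X hs, smul_add,
      smul_comm _ (r : ℂ)]
  smooth s b X hs := hV.smoothAt_add (hV.smoothAt_const_smul a (h₀.smooth s b X hs))
    (hV.smoothAt_const_smul c (h₁.smooth s b X hs))

/-- The mean of two flat connections `D₀`, `D₁` has curvature `-[ω(X), ω(Y)] / 4` with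
`ω = D₁ - D₀`: in the expansion of `(D₀ + D₁)² / 4` the squares of `D₀` and `D₁` drop out, and the
mixed terms are those of `-(D₁ - D₀)² / 4`. -/
theorem curvature_of_mean (hV : IsVectorBundle d V) (h₀ : IsConnection V D₀)
    (h₁ : IsConnection V D₁) (hf₀ : IsFlat D₀) (hf₁ : IsFlat D₁)
    (h : ∀ (s : V.Sec) (b : B) (X : TangentSpace (𝓡 d) b), V.SmoothAt s b →
      D s b X = (1 / 2 : ℂ) • D₀ s b X + (1 / 2 : ℂ) • D₁ s b X)
    (X Y : TangentSpace (𝓡 d) b) :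
    curvature D b X Y = (-1 / 4 : ℂ) • (difference D₀ D₁ b X * difference D₀ D₁ b Y -
      difference D₀ D₁ b Y * difference D₀ D₁ b X) := by
  refine endoAt_eq hV fun s hs => ?_
  have hm := isConnection_affine hV h₀ h₁ (a := 1 / 2) (c := 1 / 2) (by norm_num)
  rw [curvatureOn_congr hV hm h hs]
  have key : ∀ X Y : TangentSpace (𝓡 d) b,
      difference D₀ D₁ b X (difference D₀ D₁ b Y (s b)) =
        D₁ (fun y => D₁ s y (coordField b Y y)) b X - D₁ (fun y => D₀ s y (coordField b Y y)) b X -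
          (D₀ (fun y => D₁ s y (coordField b Y y)) b X -
            D₀ (fun y => D₀ s y (coordField b Y y)) b X) := by
    intro X Y
    have s0 := h₀.smooth s b Y hs
    have s1 := h₁.smooth s b Y hs
    have h1 := difference_apply (X := X) hV h₀ h₁ (hV.smoothAt_sub s1 s0)
    rw [h₁.map_sub hV s1 s0, h₀.map_sub hV s1 s0] at h1
    rw [← h1, coordField_self, difference_apply hV h₀ h₁ hs]
  have key2 : ∀ (E : Oper d V), IsConnection V E → ∀ X Y : TangentSpace (𝓡 d) b,
      E (fun y => (1 / 2 : ℂ) • D₀ s y (coordField b Y y) +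
        (1 / 2 : ℂ) • D₁ s y (coordField b Y y)) b X =
      (1 / 2 : ℂ) • E (fun y => D₀ s y (coordField b Y y)) b X +
        (1 / 2 : ℂ) • E (fun y => D₁ s y (coordField b Y y)) b X := by
    intro E hE X Y
    have s0 := h₀.smooth s b Y hs
    have s1 := h₁.smooth s b Y hs
    rw [hE.map_add (hV.smoothAt_const_smul _ s0) (hV.smoothAt_const_smul _ s1),
      hE.map_const_smul _ s0, hE.map_const_smul _ s1]
  have f0 := sub_eq_zero.1 (hf₀ s b X Y hs)
  have f1 := sub_eq_zero.1 (hf₁ s b X Y hs)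
  simp only [curvatureOn, key2 D₀ h₀, key2 D₁ h₁, LinearMap.smul_apply, LinearMap.sub_apply,
    Module.End.mul_apply, key, f0, f1]
  module

end Connections

/-! ### Hermitian metrics and adjoint connections -/

section Metrics

variable {d : ℕ} {B : Type u} [TopologicalSpace B] [ChartedSpace (EuclideanSpace ℝ (Fin d)) B]

variable {V : Family.{u, w} B} {h : Pairing V} {b : B} {ι : Type*} [Fintype ι]

namespace IsHermitianMetric

variable (hh : IsHermitianMetric d V h)

include hh

theorem add_left (b : B) (x y z : V.fiber b) : h b (x + y) z = h b x z + h b y z := by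
  rw [← hh.conj_symm, hh.add_right, map_add, hh.conj_symm, hh.conj_symm]

theorem smul_left (b : B) (c : ℂ) (x y : V.fiber b) :
    h b (c • x) y = (starRingEnd ℂ) c * h b x y := by
  rw [← hh.conj_symm, hh.smul_right, map_mul, hh.conj_symm]

theorem zero_right (b : B) (x : V.fiber b) : h b x 0 = 0 := by
  simpa using hh.smul_right b x 0 0

theorem zero_left (b : B) (x : V.fiber b) : h b 0 x = 0 := by
  simpa using hh.smul_left b 0 0 x

theorem neg_right (b : B) (x y : V.fiber b) : h b x (-y) = -h b x y := by
  simpa using hh.smul_right b x (-1) y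

theorem sub_right (b : B) (x y z : V.fiber b) : h b x (y - z) = h b x y - h b x z := by
  rw [sub_eq_add_neg, hh.add_right, hh.neg_right, sub_eq_add_neg]

theorem sum_right (b : B) (x : V.fiber b) (c : ι → ℂ) (e : ι → V.fiber b) :
    h b x (∑ j, c j • e j) = ∑ j, c j * h b x (e j) := by
  let L : V.fiber b →ₗ[ℂ] ℂ :=
    { toFun := h b x, map_add' := hh.add_right b x, map_smul' := hh.smul_right b x }
  exact (map_sum L _ _).trans (Finset.sum_congr rfl fun j _ => hh.smul_right b x _ _)

theorem sum_left (b : B) (x : V.fiber b) (c : ι → ℂ) (e : ι → V.fiber b) :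
    h b (∑ j, c j • e j) x = ∑ j, (starRingEnd ℂ) (c j) * h b (e j) x := by
  rw [← hh.conj_symm, hh.sum_right, map_sum]
  simp [hh.conj_symm]

theorem eq_zero_of_self {x : V.fiber b} (hx : h b x x = 0) : x = 0 := by
  by_contra hne
  have := hh.pos b x hne
  rw [hx] at this
  simp at this

theorem ext {x y : V.fiber b} (hxy : ∀ z, h b z x = h b z y) : x = y := by
  rw [← sub_eq_zero]
  refine hh.eq_zero_of_self ?_
  rw [hh.sub_right, hxy, sub_self]

theorem ext_section (hV : IsVectorBundle d V) {x y : V.fiber b}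
    (hxy : ∀ s : V.Sec, V.SmoothAt s b → h b (s b) x = h b (s b) y) : x = y := by
  refine hh.ext fun z => ?_
  obtain ⟨s, hs, rfl⟩ := hV.exists_section b z
  exact hxy s hs

theorem det_gram_ne_zero [DecidableEq ι] {e : ι → V.fiber b} (he : LinearIndependent ℂ e) :
    (Matrix.of fun i j => h b (e i) (e j)).det ≠ 0 := by
  intro hdet
  obtain ⟨c, hc, hc'⟩ := Matrix.exists_mulVec_eq_zero_iff.2 hdet
  refine hc ?_
  have h0 : ∑ j, c j • e j = 0 := by
    refine hh.eq_zero_of_self ?_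
    rw [hh.sum_left]
    refine Finset.sum_eq_zero fun i _ => ?_
    rw [hh.sum_right]
    have := congrFun hc' i
    simp only [Matrix.mulVec, dotProduct, Matrix.of_apply, Pi.zero_apply] at this
    simp only [mul_comm (c _), this, mul_zero]
  funext j
  exact Fintype.linearIndependent_iff.1 he c h0 j

theorem exists_dual_of_basis {e : ι → V.fiber b} (he : LinearIndependent ℂ e) (v : ι → ℂ) :
    ∃ z, ∀ j, h b (e j) z = v j := by
  classical
  set G : Matrix ι ι ℂ := Matrix.of fun i j => h b (e i) (e j) with hG
  refine ⟨∑ j, (G⁻¹.mulVec v) j • e j, fun i => ?_⟩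
  rw [hh.sum_right]
  have : G.mulVec (G⁻¹.mulVec v) i = v i := by
    rw [Matrix.mulVec_mulVec,
      Matrix.mul_nonsing_inv _ (isUnit_iff_ne_zero.2 (hh.det_gram_ne_zero he)), Matrix.one_mulVec]
  rw [← this]
  simp [Matrix.mulVec, dotProduct, hG, mul_comm]

/-- Every conjugate-linear functional on a fibre is represented by a vector. -/
theorem exists_dual (hV : IsVectorBundle d V) (b : B) (l : V.fiber b → ℂ)
    (hadd : ∀ x y, l (x + y) = l x + l y)
    (hsmul : ∀ (c : ℂ) x, l (c • x) = (starRingEnd ℂ) c * l x) :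
    ∃ z, ∀ x, h b x z = l x := by
  obtain ⟨r, e, he⟩ := hV.exists_frame b
  obtain ⟨z, hz⟩ := hh.exists_dual_of_basis he.linearIndependent fun j => l (e j b)
  refine ⟨z, fun x => ?_⟩
  obtain ⟨c, rfl⟩ := exists_coeff_of_span_eq_top he.span_eq_top x
  rw [hh.sum_left]
  let L : V.fiber b →ₛₗ[starRingEnd ℂ] ℂ :=
    { toFun := l, map_add' := hadd, map_smul' := fun c x => by simpa using hsmul c x }
  refine Eq.trans ?_ (map_sum L _ _).symm
  refine Finset.sum_congr rfl fun j _ => ?_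
  rw [hz j]
  exact (hsmul _ _).symm

/-- Smoothness of a section can be tested by pairing with smooth sections. -/
theorem smoothAt_of_pairing (hV : IsVectorBundle d V) {t : V.Sec}
    (ht : ∀ s : V.Sec, V.SmoothAt s b → SmoothNear d (fun y => h y (s y) (t y)) b) :
    V.SmoothAt t b := by
  classical
  obtain ⟨r, e, he⟩ := hV.exists_frame b
  obtain ⟨c, hc⟩ := he.exists_coeff t
  rw [he.smoothAt_iff hc]
  intro j
  let G : B → Matrix (Fin r) (Fin r) ℂ := fun y => Matrix.of fun i j => h y (e i y) (e j y)
  have hG : ∀ i j, SmoothNear d (fun y => G y i j) b := fun i j =>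
    hh.smooth _ _ b (he.smooth i) (he.smooth j)
  have hdet := hh.det_gram_ne_zero he.linearIndependent
  refine (SmoothNear.sum fun i (_ : i ∈ Finset.univ) =>
    (SmoothNear.matrix_inv hG hdet j i).mul (ht (e i) (he.smooth i))).congr ?_
  filter_upwards [hc, he] with z hz hez
  have hdz := hh.det_gram_ne_zero hez.1.1
  have : ((G z)⁻¹.mulVec ((G z).mulVec fun k => c k z)) j = c j z := by
    rw [Matrix.mulVec_mulVec, Matrix.nonsing_inv_mul _ (isUnit_iff_ne_zero.2 hdz),
      Matrix.one_mulVec]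
  rw [← this]
  simp only [Matrix.mulVec, dotProduct, hz, hh.sum_right]
  simp [G, mul_comm]

end IsHermitianMetric

variable [IsManifold (𝓡 d) ∞ B] {D : Oper d V} {s t : V.Sec} {X : TangentSpace (𝓡 d) b}

theorem adjointConnection_spec (hV : IsVectorBundle d V) (hh : IsHermitianMetric d V h)
    (hD : IsConnection V D) (hs : V.SmoothAt s b) (ht : V.SmoothAt t b) :
    mvfderiv (𝓡 d) (fun y => h y (s y) (t y)) b X =
      h b (D s b X) (t b) + h b (s b) (adjointConnection h D t b X) := by
  suffices H : ∃ z : V.fiber b, ∀ s : V.Sec, V.SmoothAt s b →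
      (mvfderiv (𝓡 d) (fun y => h y (s y) (t y)) b X : ℂ) = h b (D s b X) (t b) + h b (s b) z from
    Classical.epsilon_spec H s hs
  obtain ⟨r, e, he⟩ := hV.exists_frame b
  obtain ⟨z, hz⟩ := hh.exists_dual_of_basis he.linearIndependent fun j =>
    (mvfderiv (𝓡 d) (fun y => h y (e j y) (t y)) b X : ℂ) - h b (D (e j) b X) (t b)
  refine ⟨z, fun s hs => ?_⟩
  obtain ⟨c, hc, hc'⟩ := he.exists_smooth_coeff hs
  have hsum := hV.smoothAt_sum_smul he.smooth hc'
  have h1 : mvfderiv (𝓡 d) (fun y => h y (s y) (t y)) b X =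
      mvfderiv (𝓡 d) (fun y => ∑ j, (starRingEnd ℂ) (c j y) * h y (e j y) (t y)) b X := by
    refine mvfderiv_congr ?_ X
    filter_upwards [hc] with y hy
    rw [hy, hh.sum_left]
  have hp : ∀ j, SmoothNear d (fun y => h y (e j y) (t y)) b := fun j =>
    hh.smooth _ _ b (he.smooth j) ht
  rw [h1, mvfderiv_sum_apply fun j _ => (hc' j).conj.mul (hp j), hD.congr hV hsum hc,
    hD.map_sum_smul hV he.smooth hc', Finset.sum_add_distrib, hh.add_left, hh.sum_left,
    hh.sum_left, hc.self_of_nhds, hh.sum_left, ← Finset.sum_add_distrib, ← Finset.sum_add_distrib]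
  refine Finset.sum_congr rfl fun j _ => ?_
  rw [mvfderiv_mul_apply (hc' j).conj (hp j), mvfderiv_conj (hc' j), hz]
  ring

theorem adjointConnection_eq (hV : IsVectorBundle d V) (hh : IsHermitianMetric d V h)
    (hD : IsConnection V D) (ht : V.SmoothAt t b) {z : V.fiber b}
    (hz : ∀ s : V.Sec, V.SmoothAt s b → mvfderiv (𝓡 d) (fun y => h y (s y) (t y)) b X =
      h b (D s b X) (t b) + h b (s b) z) : adjointConnection h D t b X = z := by
  refine hh.ext_section hV fun s hs => ?_
  have h1 := adjointConnection_spec (X := X) hV hh hD hs ht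
  rw [hz s hs] at h1
  exact (add_left_cancel h1).symm

theorem pairing_adjointConnection (hV : IsVectorBundle d V) (hh : IsHermitianMetric d V h)
    (hD : IsConnection V D) (hs : V.SmoothAt s b) (ht : V.SmoothAt t b) :
    h b (s b) (adjointConnection h D t b X) =
      mvfderiv (𝓡 d) (fun y => h y (s y) (t y)) b X - h b (D s b X) (t b) := by
  rw [adjointConnection_spec hV hh hD hs ht, add_sub_cancel_left]

theorem isConnection_adjointConnection (hV : IsVectorBundle d V) (hh : IsHermitianMetric d V h)
    (hD : IsConnection V D) : IsConnection V (adjointConnection h D) where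
  add t t' b X ht ht' := by
    refine adjointConnection_eq hV hh hD (hV.smoothAt_add ht ht') fun s hs => ?_
    simp only [hh.add_right]
    rw [mvfderiv_add_apply (hh.smooth s t b hs ht) (hh.smooth s t' b hs ht'),
      adjointConnection_spec hV hh hD hs ht, adjointConnection_spec hV hh hD hs ht']
    ring
  leibniz f t b X hf ht := by
    refine adjointConnection_eq hV hh hD (hV.smoothAt_smul hf ht) fun s hs => ?_
    simp only [hh.smul_right, hh.add_right]
    rw [mvfderiv_mul_apply hf (hh.smooth s t b hs ht), adjointConnection_spec hV hh hD hs ht]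
    ring
  add_vector t b X Y ht := by
    refine adjointConnection_eq hV hh hD ht fun s hs => ?_
    rw [map_add, adjointConnection_spec hV hh hD hs ht, adjointConnection_spec hV hh hD hs ht,
      hD.add_vector s b X Y hs, hh.add_left, hh.add_right]
    ring
  smul_vector t b c X ht := by
    refine adjointConnection_eq hV hh hD ht fun s hs => ?_
    rw [map_smul, adjointConnection_spec hV hh hD hs ht, hD.smul_vector s b c X hs, hh.smul_left,
      hh.smul_right, Complex.conj_ofReal, Complex.real_smul]
    ring
  smooth t b X ht := by
    refine hh.smoothAt_of_pairing hV fun s hs => ?_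
    have h1 : SmoothNear d (fun y => mvfderiv (𝓡 d) (fun y => h y (s y) (t y)) y (coordField b X y)
        - h y (D s y (coordField b X y)) (t y)) b :=
      ((hh.smooth s t b hs ht).mvfderiv_coordField (mem_extChartAt_source b) X).sub
        (hh.smooth _ _ b (hD.smooth s b X hs) ht)
    refine h1.congr ?_
    filter_upwards [hV.smoothAt_eventually hs, hV.smoothAt_eventually ht] with y hy hy'
    exact pairing_adjointConnection hV hh hD hy hy'

theorem isFlat_adjointConnection (hV : IsVectorBundle d V) (hh : IsHermitianMetric d V h)
    (hD : IsConnection V D) (hf : IsFlat D) : IsFlat (adjointConnection h D) := by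
  intro t b X Y ht
  have hA := isConnection_adjointConnection hV hh hD
  refine hh.ext_section hV fun s hs => ?_
  have key : ∀ X Y : TangentSpace (𝓡 d) b,
      mvfderiv (𝓡 d) (fun y => mvfderiv (𝓡 d) (fun y => h y (s y) (t y)) y (coordField b Y y)) b X =
        h b (D (fun y => D s y (coordField b Y y)) b X) (t b) +
        h b (D s b Y) (adjointConnection h D t b X) +
        (h b (D s b X) (adjointConnection h D t b Y) +
        h b (s b) (adjointConnection h D (fun y => adjointConnection h D t y (coordField b Y y))
          b X)) := by
    intro X Y
    have s1 := hD.smooth s b Y hs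
    have t1 := hA.smooth t b Y ht
    have h1 : ∀ᶠ y in 𝓝 b, mvfderiv (𝓡 d) (fun y => h y (s y) (t y)) y (coordField b Y y) =
        h y (D s y (coordField b Y y)) (t y) +
          h y (s y) (adjointConnection h D t y (coordField b Y y)) := by
      filter_upwards [hV.smoothAt_eventually hs, hV.smoothAt_eventually ht] with y hy hy'
      exact adjointConnection_spec hV hh hD hy hy'
    rw [mvfderiv_congr h1, mvfderiv_add_apply (hh.smooth _ _ b s1 ht) (hh.smooth _ _ b hs t1),
      adjointConnection_spec hV hh hD s1 ht, adjointConnection_spec hV hh hD hs t1,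
      coordField_self]
  have h1 := mvfderiv_mvfderiv_comm (hh.smooth s t b hs ht) X Y
  rw [key, key, sub_eq_zero.1 (hf s b X Y hs)] at h1
  rw [curvatureOn, hh.sub_right, hh.zero_right]
  linear_combination -h1

omit [IsManifold (𝓡 d) ∞ B] in
theorem unitaryConnection_apply (h : Pairing V) (D : Oper d V) (s : V.Sec) (b : B)
    (X : TangentSpace (𝓡 d) b) : unitaryConnection h D s b X =
      (1 / 2 : ℂ) • D s b X + (1 / 2 : ℂ) • adjointConnection h D s b X := by
  simp only [unitaryConnection, omega]
  module

theorem isConnection_unitaryConnection (hV : IsVectorBundle d V) (hh : IsHermitianMetric d V h)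
    (hD : IsConnection V D) : IsConnection V (unitaryConnection h D) := by
  have := isConnection_affine hV hD (isConnection_adjointConnection hV hh hD)
    (a := 1 / 2) (c := 1 / 2) (by norm_num)
  convert! this using 1
  funext s b X
  exact unitaryConnection_apply h D s b X

theorem isMetricConnection_unitaryConnection (hV : IsVectorBundle d V)
    (hh : IsHermitianMetric d V h) (hD : IsConnection V D) :
    IsMetricConnection V h (unitaryConnection h D) := by
  intro s t b X hs ht
  have h1 := adjointConnection_spec (X := X) hV hh hD hs ht
  have h2 := congrArg (starRingEnd ℂ) (adjointConnection_spec (X := X) hV hh hD ht hs)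
  rw [← mvfderiv_conj (hh.smooth t s b ht hs)] at h2
  simp only [map_add, hh.conj_symm] at h2
  simp only [unitaryConnection_apply, hh.add_left, hh.add_right, hh.smul_left, hh.smul_right]
  have : (starRingEnd ℂ) (1 / 2 : ℂ) = 1 / 2 := by
    rw [map_div₀, map_one, Complex.conj_ofNat]
  rw [this]
  linear_combination (1 / 2 : ℂ) * h1 + (1 / 2 : ℂ) * h2

end Metrics

/-! ### Traces of alternating products -/

section Alternation

variable {R : Type*} [Ring R] [Algebra ℂ R] (τ : R →ₗ[ℂ] ℂ)

theorem sum_sign_mul_swap {n : ℕ} {i j : Fin n} (hij : i ≠ j) (F : Equiv.Perm (Fin n) → ℂ) :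
    ∑ σ : Equiv.Perm (Fin n), ((Equiv.Perm.sign σ : ℤ) : ℂ) * F (σ * Equiv.swap i j) =
      -∑ σ : Equiv.Perm (Fin n), ((Equiv.Perm.sign σ : ℤ) : ℂ) * F σ := by
  rw [← Finset.sum_neg_distrib]
  refine Fintype.sum_equiv (Equiv.mulRight (Equiv.swap i j)) _ _ fun σ => ?_
  simp [Equiv.Perm.sign_swap hij]

/-- A cyclic permutation of `n + 1` indices has the sign `(-1)^n`. -/
theorem sum_sign_mul_finRotate {n : ℕ} (F : Equiv.Perm (Fin (n + 1)) → ℂ) :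
    ∑ σ : Equiv.Perm (Fin (n + 1)), ((Equiv.Perm.sign σ : ℤ) : ℂ) * F (σ * finRotate (n + 1)) =
      (-1) ^ n * ∑ σ : Equiv.Perm (Fin (n + 1)), ((Equiv.Perm.sign σ : ℤ) : ℂ) * F σ := by
  rw [Finset.mul_sum]
  refine Fintype.sum_equiv (Equiv.mulRight (finRotate (n + 1))) _ _ fun σ => ?_
  have : ((-1 : ℂ) ^ n) * (-1) ^ n = 1 := by
    rw [← mul_pow]; simp
  simp only [Equiv.coe_mulRight, Equiv.Perm.sign_mul, sign_finRotate, Units.val_mul, Int.cast_mul,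
    Units.val_pow_eq_pow_val, Units.val_neg, Units.val_one, Int.cast_pow, Int.cast_neg,
    Int.cast_one, Nat.add_sub_cancel]
  linear_combination (-((Equiv.Perm.sign σ : ℤ) : ℂ) * F (σ * finRotate (n + 1))) * this

theorem prod_ofFn_update_sub {k : ℕ} (g : Fin k → R) (j : Fin k) (x y : R) :
    (List.ofFn (Function.update g j (x - y))).prod =
      (List.ofFn (Function.update g j x)).prod - (List.ofFn (Function.update g j y)).prod := by
  simpa only [MultilinearMap.mkPiAlgebraFin_apply] using
    (MultilinearMap.mkPiAlgebraFin ℂ k R).map_update_sub g j x y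

theorem prod_ofFn_smul {k : ℕ} (g : Fin k → R) (c : ℂ) :
    (List.ofFn fun j => c • g j).prod = c ^ k • (List.ofFn g).prod := by
  simpa [MultilinearMap.mkPiAlgebraFin_apply] using
    (MultilinearMap.mkPiAlgebraFin ℂ k R).map_smul_univ (fun _ => c) g

/-- Under alternation, each commutator `[a, b]` in a product may be replaced by `2ab`. -/
theorem sum_sign_prod_commutator {n k : ℕ} (a : Fin n → R) (p q : Fin k → Fin n)
    (hp : Function.Injective p) (hq : Function.Injective q) (hpq : ∀ i j, p i ≠ q j)
    (L : Equiv.Perm (Fin n) → R) (hL : ∀ σ j, L (σ * Equiv.swap (p j) (q j)) = L σ) :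
    ∑ σ : Equiv.Perm (Fin n), ((Equiv.Perm.sign σ : ℤ) : ℂ) * τ (L σ * (List.ofFn fun j : Fin k =>
        a (σ (p j)) * a (σ (q j)) - a (σ (q j)) * a (σ (p j))).prod) =
      2 ^ k * ∑ σ : Equiv.Perm (Fin n), ((Equiv.Perm.sign σ : ℤ) : ℂ) *
        τ (L σ * (List.ofFn fun j : Fin k => a (σ (p j)) * a (σ (q j))).prod) := by
  classical
  let g : Finset (Fin k) → Equiv.Perm (Fin n) → Fin k → R := fun S σ j =>
    if j ∈ S then a (σ (p j)) * a (σ (q j)) - a (σ (q j)) * a (σ (p j))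
    else a (σ (p j)) * a (σ (q j))
  have key : ∀ S : Finset (Fin k), ∑ σ : Equiv.Perm (Fin n), ((Equiv.Perm.sign σ : ℤ) : ℂ) *
      τ (L σ * (List.ofFn (g S σ)).prod) = 2 ^ S.card * ∑ σ : Equiv.Perm (Fin n),
        ((Equiv.Perm.sign σ : ℤ) : ℂ) * τ (L σ * (List.ofFn (g ∅ σ)).prod) := by
    intro S
    induction S using Finset.induction_on with
    | empty => simp
    | insert j S hj ih =>
      rw [Finset.card_insert_of_notMem hj, pow_succ', mul_assoc, ← ih]
      have e1 : ∀ σ, g (insert j S) σ = Function.update (g S σ) j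
          (a (σ (p j)) * a (σ (q j)) - a (σ (q j)) * a (σ (p j))) := by
        intro σ
        funext i
        by_cases hi : i = j
        · subst hi; simp [g]
        · simp [g, hi]
      have e2 : ∀ σ, g S σ = Function.update (g S σ) j (a (σ (p j)) * a (σ (q j))) := by
        intro σ
        funext i
        by_cases hi : i = j
        · subst hi; simp [g, hj]
        · simp [hi]
      have e3 : ∀ σ, Function.update (g S σ) j (a (σ (q j)) * a (σ (p j))) =
          g S (σ * Equiv.swap (p j) (q j)) := by
        intro σ
        funext i
        by_cases hi : i = j
        · subst hi; simp [g, hj]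
        · have h1 : Equiv.swap (p j) (q j) (p i) = p i :=
            Equiv.swap_apply_of_ne_of_ne (fun h => hi (hp h)) (hpq i j)
          have h2 : Equiv.swap (p j) (q j) (q i) = q i :=
            Equiv.swap_apply_of_ne_of_ne (hpq j i).symm (fun h => hi (hq h))
          simp [g, hi, h1, h2]
      have e4 : ∀ σ, τ (L σ * (List.ofFn (g (insert j S) σ)).prod) =
          τ (L σ * (List.ofFn (g S σ)).prod) -
          τ (L (σ * Equiv.swap (p j) (q j)) *
            (List.ofFn (g S (σ * Equiv.swap (p j) (q j)))).prod) := by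
        intro σ
        rw [e1, hL, ← e3]
        conv_rhs => rw [e2]
        rw [prod_ofFn_update_sub, mul_sub, map_sub, Function.update_idem]
      simp only [e4, mul_sub, Finset.sum_sub_distrib]
      rw [sum_sign_mul_swap (hpq j j) fun σ => τ (L σ * (List.ofFn (g S σ)).prod)]
      ring
  have h := key Finset.univ
  simpa [g] using h

omit [Algebra ℂ R] in
theorem prod_ofFn_pairs (f : ℕ → R) (k : ℕ) :
    (List.ofFn fun j : Fin k => f (2 * j.1) * f (2 * j.1 + 1)).prod =
      (List.ofFn fun i : Fin (2 * k) => f i.1).prod := by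
  induction k with
  | zero => simp
  | succ k ih =>
    rw [List.ofFn_succ_last]
    change _ = (List.ofFn fun i : Fin (2 * k + 1 + 1) => f i.1).prod
    rw [List.ofFn_succ_last, List.ofFn_succ_last]
    simp [ih]

variable {τ} (hτ : ∀ x y, τ (x * y) = τ (y * x))

include hτ

theorem trace_prod_finRotate {n : ℕ} (a : Fin (n + 1) → R) (σ : Equiv.Perm (Fin (n + 1))) (e : R) :
    τ (e * (List.ofFn fun i => a ((σ * finRotate (n + 1)) i)).prod) =
      τ (a (σ 0) * e * (List.ofFn fun i : Fin n => a (σ i.succ)).prod) := by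
  have : (List.ofFn fun i => a ((σ * finRotate (n + 1)) i)).prod =
      (List.ofFn fun i : Fin n => a (σ i.succ)).prod * a (σ 0) := by
    rw [List.ofFn_succ_last]
    simp
  rw [this, ← mul_assoc, hτ, mul_assoc]

/-- The alternated trace of a product of `k + 1` commutators vanishes: it is a multiple of the
alternated trace of a product of `2k + 2` factors, whose cyclic permutations are odd. -/
theorem sum_sign_trace_prod_commutator_eq_zero (k : ℕ) (a : Fin (2 * k + 1 + 1) → R) (c : ℂ) :
    ∑ σ : Equiv.Perm (Fin (2 * k + 1 + 1)), ((Equiv.Perm.sign σ : ℤ) : ℂ) *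
      τ (List.ofFn fun j : Fin (k + 1) =>
        c • (a (σ ⟨2 * j.1, by omega⟩) * a (σ ⟨2 * j.1 + 1, by omega⟩) -
          a (σ ⟨2 * j.1 + 1, by omega⟩) * a (σ ⟨2 * j.1, by omega⟩))).prod = 0 := by
  let p : Fin (k + 1) → Fin (2 * k + 1 + 1) := fun j => ⟨2 * j.1, by omega⟩
  let q : Fin (k + 1) → Fin (2 * k + 1 + 1) := fun j => ⟨2 * j.1 + 1, by omega⟩
  have h1 := sum_sign_prod_commutator τ a p q
    (fun i j h => by simp only [p, Fin.mk.injEq] at h; omega)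
    (fun i j h => by simp only [q, Fin.mk.injEq] at h; omega)
    (fun i j h => by simp only [p, q, Fin.mk.injEq] at h; omega)
    (fun _ => 1) (fun _ _ => rfl)
  have h2 : ∀ σ : Equiv.Perm (Fin (2 * k + 1 + 1)),
      (List.ofFn fun j : Fin (k + 1) => a (σ (p j)) * a (σ (q j))).prod =
        (List.ofFn fun i => a (σ i)).prod := by
    intro σ
    let f : ℕ → R := fun i => if h : i < 2 * k + 1 + 1 then a (σ ⟨i, h⟩) else 0
    have hf := prod_ofFn_pairs f (k + 1)
    have e1 : (fun j : Fin (k + 1) => f (2 * j.1) * f (2 * j.1 + 1)) =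
        fun j => a (σ (p j)) * a (σ (q j)) := by
      funext j
      have i1 : 2 * j.1 < 2 * k + 1 + 1 := by omega
      have i2 : 2 * j.1 + 1 < 2 * k + 1 + 1 := by omega
      simp only [f, dif_pos i1, dif_pos i2, p, q]
    have e2 : (fun i : Fin (2 * (k + 1)) => f i.1) = fun i => a (σ i) := by
      funext i
      have i1 : i.1 < 2 * k + 1 + 1 := i.2
      simp only [f, dif_pos i1]
      rfl
    rw [e1, e2] at hf
    exact hf
  have h3 := sum_sign_mul_finRotate (n := 2 * k + 1)
    fun σ => τ (1 * (List.ofFn fun i => a (σ i)).prod)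
  simp only [trace_prod_finRotate hτ] at h3
  have h4 : ∀ σ : Equiv.Perm (Fin (2 * k + 1 + 1)),
      a (σ 0) * 1 * (List.ofFn fun i : Fin (2 * k + 1) => a (σ i.succ)).prod =
        1 * (List.ofFn fun i => a (σ i)).prod := by
    intro σ
    conv_rhs => rw [List.ofFn_succ]
    simp
  simp only [h4] at h3
  have h5 : (-1 : ℂ) ^ (2 * k + 1) = -1 := Odd.neg_one_pow ⟨k, rfl⟩
  rw [h5, neg_one_mul, self_eq_neg] at h3
  simp only [one_mul] at h3
  simp only [h2, h3, mul_zero, one_mul] at h1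
  simp only [p, q] at h1
  simp only [prod_ofFn_smul, map_smul, smul_eq_mul, mul_left_comm _ (c ^ (k + 1))]
  rw [← Finset.mul_sum, h1, mul_zero]

/-- The alternated trace of `[e, a₀] [a₁, a₂] ⋯ [a_{2k-1}, a_{2k}]` vanishes, since cyclic
permutations of `2k + 1` factors are even. -/
theorem sum_sign_trace_commutator_mul_prod_eq_zero (k : ℕ) (a : Fin (2 * k + 1) → R) (e : R)
    (c : ℂ) :
    ∑ σ : Equiv.Perm (Fin (2 * k + 1)), ((Equiv.Perm.sign σ : ℤ) : ℂ) *
      τ ((e * a (σ 0) - a (σ 0) * e) * (List.ofFn fun j : Fin k =>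
        c • (a (σ ⟨2 * j.1 + 1, by omega⟩) * a (σ ⟨2 * j.1 + 2, by omega⟩) -
          a (σ ⟨2 * j.1 + 2, by omega⟩) * a (σ ⟨2 * j.1 + 1, by omega⟩))).prod) = 0 := by
  let p : Fin k → Fin (2 * k + 1) := fun j => ⟨2 * j.1 + 1, by omega⟩
  let q : Fin k → Fin (2 * k + 1) := fun j => ⟨2 * j.1 + 2, by omega⟩
  have h1 := sum_sign_prod_commutator τ a p q
    (fun i j h => by simp only [p, Fin.mk.injEq] at h; omega)
    (fun i j h => by simp only [q, Fin.mk.injEq] at h; omega)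
    (fun i j h => by simp only [p, q, Fin.mk.injEq] at h; omega)
    (fun σ => e * a (σ 0) - a (σ 0) * e) (fun σ j => by
      have : Equiv.swap (p j) (q j) 0 = 0 := by
        apply Equiv.swap_apply_of_ne_of_ne <;> simp [p, q, Fin.ext_iff]
      simp [this])
  have h2 : ∀ σ : Equiv.Perm (Fin (2 * k + 1)),
      (List.ofFn fun j : Fin k => a (σ (p j)) * a (σ (q j))).prod =
        (List.ofFn fun i : Fin (2 * k) => a (σ i.succ)).prod := by
    intro σ
    let f : ℕ → R := fun i => if h : i + 1 < 2 * k + 1 then a (σ ⟨i + 1, h⟩) else 0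
    have hf := prod_ofFn_pairs f k
    have e1 : (fun j : Fin k => f (2 * j.1) * f (2 * j.1 + 1)) =
        fun j => a (σ (p j)) * a (σ (q j)) := by
      funext j
      have i1 : 2 * j.1 + 1 < 2 * k + 1 := by omega
      have i2 : 2 * j.1 + 1 + 1 < 2 * k + 1 := by omega
      simp only [f, dif_pos i1, dif_pos i2, p, q]
    have e2 : (fun i : Fin (2 * k) => f i.1) = fun i => a (σ i.succ) := by
      funext i
      have i1 : i.1 + 1 < 2 * k + 1 := by omega
      simp only [f, dif_pos i1]
      rfl
    rw [e1, e2] at hf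
    exact hf
  have h3 := sum_sign_mul_finRotate (n := 2 * k)
    fun σ => τ (e * (List.ofFn fun i => a (σ i)).prod)
  simp only [trace_prod_finRotate hτ] at h3
  rw [Even.neg_one_pow ⟨k, two_mul k⟩, one_mul] at h3
  have h4 : ∀ σ : Equiv.Perm (Fin (2 * k + 1)), e * (List.ofFn fun i => a (σ i)).prod =
      e * a (σ 0) * (List.ofFn fun i : Fin (2 * k) => a (σ i.succ)).prod := by
    intro σ
    rw [List.ofFn_succ, List.prod_cons, mul_assoc]
  simp only [h4] at h3
  simp only [h2, sub_mul _ _ (List.prod _), map_sub, mul_sub, Finset.sum_sub_distrib] at h1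
  rw [h3, sub_self] at h1
  simp only [p, q] at h1
  simp only [prod_ofFn_smul, mul_smul_comm, map_smul, smul_eq_mul, mul_left_comm _ (c ^ k)]
  rw [← Finset.mul_sum]
  simp only [sub_mul _ _ (List.prod _), map_sub, mul_sub, Finset.sum_sub_distrib]
  rw [← mul_sub, h1, mul_zero]

end Alternation

/-! ### Flat bundles define generators -/

section Generators

variable {d : ℕ} {B : Type u} [TopologicalSpace B] [ChartedSpace (EuclideanSpace ℝ (Fin d)) B]
  [IsManifold (𝓡 d) ∞ B] {V : Family.{u, w} B} {h : Pairing V} {D : Oper d V}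

theorem curvature_unitaryConnection (hV : IsVectorBundle d V) (hh : IsHermitianMetric d V h)
    (hD : IsConnection V D) (hf : IsFlat D) (b : B) (X Y : TangentSpace (𝓡 d) b) :
    curvature (unitaryConnection h D) b X Y = (-1 / 4 : ℂ) •
      (difference D (adjointConnection h D) b X * difference D (adjointConnection h D) b Y -
        difference D (adjointConnection h D) b Y * difference D (adjointConnection h D) b X) :=
  curvature_of_mean hV hD (isConnection_adjointConnection hV hh hD) hf
    (isFlat_adjointConnection hV hh hD hf) (fun s b X _ => unitaryConnection_apply h D s b X) X Y

/-- The Chern character form of `∇^e` is the rank: its curvature is `-ω²/4`, and traces of even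
powers of `ω` vanish. -/
theorem chernForm_unitaryConnection (hV : IsVectorBundle d V) (hh : IsHermitianMetric d V h)
    (hD : IsConnection V D) (hf : IsFlat D) (k : ℕ) (b : B)
    (X : Fin (2 * k + 1 + 1) → TangentSpace (𝓡 d) b) :
    chernForm (unitaryConnection h D) k b X = 0 := by
  simp only [chernForm, curvature_unitaryConnection hV hh hD hf]
  rw [sum_sign_trace_prod_commutator_eq_zero (LinearMap.trace_mul_comm ℂ) k
    fun i => difference D (adjointConnection h D) b (X i)]
  simp

/-- A flat bundle with a Hermitian metric, its Hermitian connection and the form zero is a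
generator. -/
theorem isKGenerator_of_flat (hV : IsVectorBundle d V) (hh : IsHermitianMetric d V h)
    (hD : IsConnection V D) (hf : IsFlat D) : IsKGenerator V h (unitaryConnection h D) 0 where
  bundle := hV
  metric := hh
  connection := isConnection_unitaryConnection hV hh hD
  compatible := isMetricConnection_unitaryConnection hV hh hD
  form := ⟨0, rfl, fun k b X => by
    rw [chernForm_unitaryConnection hV hh hD hf]
    simp⟩

end Generators

/-! ### Flat bundles and orthogonal splittings -/

section FlatBundles

variable (d : ℕ) (B : Type u) [TopologicalSpace B] [ChartedSpace (EuclideanSpace ℝ (Fin d)) B]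
  [IsManifold (𝓡 d) ∞ B]

/-- Flat complex vector bundles over `B`. -/
structure FlatBundle where
  /-- the bundle -/
  V : Family.{u, w} B
  /-- the flat connection -/
  D : Oper d V
  bundle : IsVectorBundle d V
  connection : IsConnection V D
  flat : IsFlat D

variable {d B}

/-- The class `(V, h, ∇^e, 0)` of a flat bundle with a Hermitian metric. -/
noncomputable def FlatBundle.cls (F : FlatBundle.{u, w} d B) (h : Pairing F.V)
    (hh : IsHermitianMetric d F.V h) : MK.{u, w} d B :=
  classOf (isKGenerator_of_flat F.bundle hh F.connection F.flat)

theorem FlatBundle.cls_congr {F : FlatBundle.{u, w} d B} {h h' : Pairing F.V}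
    {hh : IsHermitianMetric d F.V h} {hh' : IsHermitianMetric d F.V h'}
    (e : ∀ b x y, h b x y = h' b x y) : F.cls h hh = F.cls h' hh' := by
  have : h = h' := by
    funext b x y
    exact e b x y
  subst this
  rfl

/-- Short exact sequences of flat bundles. -/
structure IsFlatExact {F₁ F₂ F₃ : FlatBundle.{u, w} d B} (i : FiberHom F₁.V F₂.V)
    (j : FiberHom F₂.V F₃.V) : Prop where
  smooth_i : IsSmoothHom i
  smooth_j : IsSmoothHom j
  parallel_i : IsParallel i F₁.D F₂.D
  parallel_j : IsParallel j F₂.D F₃.D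
  injective : ∀ b, Function.Injective (i b)
  exact : ∀ b, LinearMap.range (i b) = LinearMap.ker (j b)
  surjective : ∀ b, Function.Surjective (j b)

theorem classOf_eq_add {g₁ g₂ g₃ : KGenerator.{u, w} d B} (h : KRelation g₁ g₂ g₃) :
    classOf g₂.isKGenerator = classOf g₁.isKGenerator + classOf g₃.isKGenerator := by
  have hmem : FreeAbelianGroup.of g₂ - FreeAbelianGroup.of g₁ - FreeAbelianGroup.of g₃ ∈
      relations.{u, w} d B := AddSubgroup.subset_closure ⟨g₁, g₂, g₃, h, rfl⟩
  have h0 : QuotientAddGroup.mk' (relations.{u, w} d B) (FreeAbelianGroup.of g₂ -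
      FreeAbelianGroup.of g₁ - FreeAbelianGroup.of g₃) = 0 :=
    (QuotientAddGroup.eq_zero_iff _).2 hmem
  rw [map_sub, map_sub, sub_sub, sub_eq_zero] at h0
  exact h0

/-- A `K`-relation between generators without forms, whose Chern-Simons form vanishes. -/
theorem kRelation_of_chernSimonsForm_eq_zero {V₁ V₂ V₃ : Family.{u, w} B} {h₁ : Pairing V₁}
    {h₂ : Pairing V₂} {h₃ : Pairing V₃} {D₁ : Oper d V₁} {D₂ : Oper d V₂} {D₃ : Oper d V₃}
    (g₁ : IsKGenerator V₁ h₁ D₁ 0) (g₂ : IsKGenerator V₂ h₂ D₂ 0) (g₃ : IsKGenerator V₃ h₃ D₃ 0)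
    {i : FiberHom V₁ V₂} {j : FiberHom V₂ V₃} {σ : FiberHom V₃ V₂} {p : FiberHom V₂ V₁}
    (hs : IsSplitShortExact i j σ p)
    (h : ∀ k b X, chernSimonsForm (sumConnection i j σ p D₁ D₃) D₂ k b X = 0) :
    KRelation ⟨V₁, h₁, D₁, 0, g₁⟩ ⟨V₂, h₂, D₂, 0, g₂⟩ ⟨V₃, h₃, D₃, 0, g₃⟩ := by
  refine ⟨i, j, σ, p, hs, 0, 0, 0, rfl, rfl, rfl, 0, fun k b X => ?_⟩
  rw [h]
  simp

end FlatBundles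

section SplitExact

variable {B : Type u} {V₁ V₂ V₃ : Family.{u, w} B} {i : FiberHom V₁ V₂} {j : FiberHom V₂ V₃}

namespace IsSplitShortExact

variable {σ : FiberHom V₃ V₂} {p : FiberHom V₂ V₁} (hs : IsSplitShortExact i j σ p)

include hs

theorem j_i (b : B) (u : V₁.fiber b) : j b (i b u) = 0 := by
  rw [← LinearMap.mem_ker, ← hs.exact]
  exact ⟨u, rfl⟩

theorem p_i (b : B) (u : V₁.fiber b) : p b (i b u) = u :=
  hs.injective b (by rw [hs.projection, hs.j_i, map_zero, sub_zero])

theorem p_σ (b : B) (z : V₃.fiber b) : p b (σ b z) = 0 :=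
  hs.injective b (by rw [hs.projection, hs.splitting, sub_self, map_zero])

theorem decomp (b : B) (x : V₂.fiber b) : i b (p b x) + σ b (j b x) = x := by
  rw [hs.projection, sub_add_cancel]

end IsSplitShortExact

end SplitExact

section Splittings

variable {d : ℕ} {B : Type u} [TopologicalSpace B] [ChartedSpace (EuclideanSpace ℝ (Fin d)) B]
  {V₁ V₂ V₃ : Family.{u, w} B} {i : FiberHom V₁ V₂} {j : FiberHom V₂ V₃}

theorem IsHermitianMetric.comap {h : Pairing V₂} (hh : IsHermitianMetric d V₂ h)
    (hi : IsSmoothHom i) (hinj : ∀ b, Function.Injective (i b)) :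
    IsHermitianMetric d V₁ (fun b x y => h b (i b x) (i b y)) where
  add_right b x y z := by rw [map_add, hh.add_right]
  smul_right b x c y := by rw [map_smul, hh.smul_right]
  conj_symm b x y := hh.conj_symm b _ _
  pos b x hx := hh.pos b _ fun h0 => hx (hinj b (by rw [h0, map_zero]))
  smooth s t x hs ht := hh.smooth _ _ x (hi s x hs) (hi t x ht)

/-- Smooth sections lift locally along surjective bundle maps. -/
theorem exists_lift (hV₂ : IsVectorBundle d V₂) (hV₃ : IsVectorBundle d V₃) (hj : IsSmoothHom j)
    (hsurj : ∀ b, Function.Surjective (j b)) {s : V₃.Sec} {x : B} (hs : V₃.SmoothAt s x) :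
    ∃ t : V₂.Sec, V₂.SmoothAt t x ∧ ∀ᶠ y in 𝓝 x, j y (t y) = s y := by
  obtain ⟨r, f, hf⟩ := hV₃.exists_frame x
  choose a ha using fun k => hsurj x (f k x)
  choose e he he' using fun k => hV₂.exists_section x (a k)
  have hx : (fun k => j x (e k x)) = fun k => f k x := by
    funext k
    rw [he', ha]
  have hfr : IsFrame d V₃ (fun k y => j y (e k y)) x :=
    hV₃.isFrame_of_basis (fun k => hj _ _ (he k)) (by rw [hx]; exact hf.linearIndependent)
      (by rw [hx]; exact hf.span_eq_top)
  obtain ⟨c, hc, hc'⟩ := hfr.exists_smooth_coeff hs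
  refine ⟨_, hV₂.smoothAt_sum_smul he hc', ?_⟩
  filter_upwards [hc] with y hy
  simp [hy]

/-- A short exact sequence of bundles, the middle one with a metric, has an orthogonal splitting. -/
theorem exists_orthogonal_splitting (hV₁ : IsVectorBundle d V₁) (hV₂ : IsVectorBundle d V₂)
    (hV₃ : IsVectorBundle d V₃) {h : Pairing V₂} (hh : IsHermitianMetric d V₂ h)
    (hi : IsSmoothHom i) (hj : IsSmoothHom j) (hinj : ∀ b, Function.Injective (i b))
    (hex : ∀ b, LinearMap.range (i b) = LinearMap.ker (j b))
    (hsurj : ∀ b, Function.Surjective (j b)) :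
    ∃ (σ : FiberHom V₃ V₂) (p : FiberHom V₂ V₁), IsSplitShortExact i j σ p ∧
      ∀ b u z, h b (i b u) (σ b z) = 0 := by
  have h1 := hh.comap hi hinj
  have hex' : ∀ b x, ∃ z, ∀ u, h b (i b u) (i b z) = h b (i b u) x := fun b x =>
    h1.exists_dual hV₁ b (fun u => h b (i b u) x)
      (fun u v => by rw [map_add, hh.add_left]) (fun c u => by rw [map_smul, hh.smul_left])
  choose q hq using hex'
  -- `p` is the orthogonal projection to the sub-bundle, and `m` the one to its complement
  let p : FiberHom V₂ V₁ := fun b =>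
    { toFun := q b
      map_add' := fun x y => h1.ext fun u => by
        simp only [hq, hh.add_right, map_add]
      map_smul' := fun c x => h1.ext fun u => by
        simp only [hq, hh.smul_right, map_smul, RingHom.id_apply] }
  have hp : ∀ b x u, h b (i b u) (i b (p b x)) = h b (i b u) x := fun b x u => hq b x u
  have hpi : ∀ b u, p b (i b u) = u := fun b u => h1.ext fun v => hp b _ v
  let m : FiberHom V₂ V₂ := fun b => LinearMap.id - (i b).comp (p b)
  have hm : ∀ b x, m b x = x - i b (p b x) := fun b x => rfl
  have hmker : ∀ b x y, j b x = j b y → m b x = m b y := by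
    intro b x y hxy
    have : x - y ∈ LinearMap.range (i b) := by
      rw [hex, LinearMap.mem_ker, map_sub, hxy, sub_self]
    obtain ⟨u, hu⟩ := this
    rw [← sub_eq_zero, ← map_sub, ← hu, hm, hpi, sub_self]
  have hji : ∀ b u, j b (i b u) = 0 := fun b u => by
    rw [← LinearMap.mem_ker, ← hex]
    exact ⟨u, rfl⟩
  have hs := fun b z => Function.surjInv_eq (hsurj b) z
  let σ : FiberHom V₃ V₂ := fun b =>
    { toFun := fun z => m b (Function.surjInv (hsurj b) z)
      map_add' := fun x y => by
        rw [← map_add]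
        exact hmker b _ _ (by rw [map_add, hs, hs, hs])
      map_smul' := fun c x => by
        rw [RingHom.id_apply, ← map_smul]
        exact hmker b _ _ (by rw [map_smul, hs, hs]) }
  have hσ : ∀ b x, σ b (j b x) = m b x := fun b x => hmker b _ _ (hs b _)
  have hsp : IsSmoothHom p := by
    intro s x hx
    refine h1.smoothAt_of_pairing hV₁ fun t ht => ?_
    simp only [hp]
    exact hh.smooth _ _ _ (hi _ _ ht) hx
  refine ⟨σ, p, ⟨hi, hj, ?_, hsp, hinj, hex, hsurj, ?_, ?_⟩, ?_⟩
  · intro s x hx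
    obtain ⟨t, ht, ht'⟩ := exists_lift hV₂ hV₃ hj hsurj hx
    refine hV₂.smoothAt_congr (hV₂.smoothAt_sub ht (hi _ _ (hsp _ _ ht))) ?_
    filter_upwards [ht'] with y hy
    rw [← hy, hσ, hm]
  · intro b z
    obtain ⟨x, rfl⟩ := hsurj b z
    rw [hσ, hm, map_sub, hji, sub_zero]
  · intro b x
    rw [hσ, hm, sub_sub_cancel]
  · intro b u z
    obtain ⟨x, rfl⟩ := hsurj b z
    rw [hσ, hm, hh.sub_right, hp, sub_self]

variable [IsManifold (𝓡 d) ∞ B]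

/-- The conjugate of a connection by an automorphism `g` with inverse `g'`. -/
def gaugeConnection {V : Family.{u, w} B} (g g' : FiberHom V V) (D : Oper d V) : Oper d V :=
  fun s b X => g b (D (fun y => g' y (s y)) b X)

theorem isConnection_gaugeConnection {V : Family.{u, w} B} {g g' : FiberHom V V}
    (hg : IsSmoothHom g) (hg' : IsSmoothHom g') (hgg' : ∀ b x, g b (g' b x) = x) {D : Oper d V}
    (hD : IsConnection V D) : IsConnection V (gaugeConnection g g' D) where
  add s t b X hs ht := by
    simp only [gaugeConnection, map_add, Pi.add_apply]
    rw [hD.map_add (hg' _ _ hs) (hg' _ _ ht), map_add]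
  leibniz f s b X hf hs := by
    simp only [gaugeConnection, map_smul]
    rw [hD.leibniz f _ b X hf (hg' _ _ hs), map_add, map_smul, map_smul, hgg']
  add_vector s b X Y hs := by
    simp only [gaugeConnection]
    rw [hD.add_vector _ b X Y (hg' _ _ hs), map_add]
  smul_vector s b c X hs := by
    simp only [gaugeConnection]
    rw [hD.smul_vector _ b c X (hg' _ _ hs), map_smul]
  smooth s b X hs := hg _ _ (hD.smooth _ b X (hg' _ _ hs))

/-- Conjugation preserves flatness, since `g` is parallel from `D` to its conjugate. -/
theorem isFlat_gaugeConnection {V : Family.{u, w} B} (hV : IsVectorBundle d V)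
    {g g' : FiberHom V V} (hg : IsSmoothHom g) (hg' : IsSmoothHom g')
    (hgg' : ∀ b x, g b (g' b x) = x) (hg'g : ∀ b x, g' b (g b x) = x) {D : Oper d V}
    (hD : IsConnection V D) (hf : IsFlat D) : IsFlat (gaugeConnection g g' D) := by
  intro s b X Y hs
  have hpar : IsParallel g D (gaugeConnection g g' D) := by
    intro s b X hs
    simp only [gaugeConnection, hg'g]
  have h := curvatureOn_map hV hV hD (isConnection_gaugeConnection hg hg' hgg' hD) hg hpar
    (hg' _ _ hs) X Y
  simp only [hgg'] at h
  rw [h, hf _ b X Y (hg' _ _ hs), map_zero]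

end Splittings

/-! ### Additivity for orthogonal flat extensions -/

section Orthogonal

variable {d : ℕ} {B : Type u} [TopologicalSpace B] [ChartedSpace (EuclideanSpace ℝ (Fin d)) B]
  [IsManifold (𝓡 d) ∞ B]

/-- A flat extension `0 → F₁ → F₂ → F₃ → 0` with a splitting `σ` that is orthogonal for the metric
`h₂`, and the induced metrics `h₁`, `h₃` on the sub-bundle and on the quotient. -/
structure IsOrthogonalExtension {F₁ F₂ F₃ : FlatBundle.{u, w} d B} (i : FiberHom F₁.V F₂.V)
    (j : FiberHom F₂.V F₃.V) (σ : FiberHom F₃.V F₂.V) (p : FiberHom F₂.V F₁.V)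
    (h₁ : Pairing F₁.V) (h₂ : Pairing F₂.V) (h₃ : Pairing F₃.V) : Prop where
  flat : IsFlatExact i j
  split : IsSplitShortExact i j σ p
  metric₁ : IsHermitianMetric d F₁.V h₁
  metric₂ : IsHermitianMetric d F₂.V h₂
  metric₃ : IsHermitianMetric d F₃.V h₃
  sub : ∀ b x y, h₁ b x y = h₂ b (i b x) (i b y)
  quot : ∀ b x y, h₃ b x y = h₂ b (σ b x) (σ b y)
  orth : ∀ b u z, h₂ b (i b u) (σ b z) = 0

namespace IsOrthogonalExtension

variable {F₁ F₂ F₃ : FlatBundle.{u, w} d B} {i : FiberHom F₁.V F₂.V}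
  {j : FiberHom F₂.V F₃.V} {σ : FiberHom F₃.V F₂.V} {p : FiberHom F₂.V F₁.V}
  {h₁ : Pairing F₁.V} {h₂ : Pairing F₂.V} {h₃ : Pairing F₃.V}
  (H : IsOrthogonalExtension i j σ p h₁ h₂ h₃) {b : B} {X : TangentSpace (𝓡 d) b}

include H

theorem orth' (b : B) (u : F₁.V.fiber b) (z : F₃.V.fiber b) : h₂ b (σ b z) (i b u) = 0 := by
  rw [← H.metric₂.conj_symm, H.orth, map_zero]

theorem pairing_i (b : B) (u : F₁.V.fiber b) (x : F₂.V.fiber b) :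
    h₂ b (i b u) (i b (p b x)) = h₂ b (i b u) x := by
  conv_rhs => rw [← H.split.decomp b x, H.metric₂.add_right, H.orth, add_zero]

theorem pairing_σ (b : B) (u : F₃.V.fiber b) (x : F₂.V.fiber b) :
    h₂ b (σ b u) (σ b (j b x)) = h₂ b (σ b u) x := by
  conv_rhs => rw [← H.split.decomp b x, H.metric₂.add_right, H.orth', zero_add]

/-- The adjoint connection induces the adjoint connection on the sub-bundle. -/
theorem adjoint_sub {s : F₁.V.Sec} (hs : F₁.V.SmoothAt s b) :
    p b (adjointConnection h₂ F₂.D (fun y => i y (s y)) b X) =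
      adjointConnection h₁ F₁.D s b X := by
  refine (adjointConnection_eq F₁.bundle H.metric₁ F₁.connection hs fun s' hs' => ?_).symm
  simp only [H.sub, H.pairing_i]
  rw [adjointConnection_spec F₂.bundle H.metric₂ F₂.connection (H.split.smooth_i _ _ hs')
    (H.split.smooth_i _ _ hs), H.flat.parallel_i _ _ _ hs']

/-- The adjoint connection preserves the orthogonal complement of the sub-bundle. -/
theorem adjoint_quot {s : F₃.V.Sec} (hs : F₃.V.SmoothAt s b) :
    adjointConnection h₂ F₂.D (fun y => σ y (s y)) b X =
      σ b (adjointConnection h₃ F₃.D s b X) := by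
  have hσ := H.split.smooth_splitting _ _ hs
  have h0 : p b (adjointConnection h₂ F₂.D (fun y => σ y (s y)) b X) = 0 := by
    refine H.metric₁.ext_section F₁.bundle fun s' hs' => ?_
    rw [H.sub, H.pairing_i, pairing_adjointConnection F₂.bundle H.metric₂ F₂.connection
      (H.split.smooth_i _ _ hs') hσ, H.flat.parallel_i _ _ _ hs', H.orth, H.metric₁.zero_right]
    simp only [H.orth]
    rw [mvfderiv_const_apply, sub_zero]
  have h1 : adjointConnection h₃ F₃.D s b X =
      j b (adjointConnection h₂ F₂.D (fun y => σ y (s y)) b X) := by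
    refine adjointConnection_eq F₃.bundle H.metric₃ F₃.connection hs fun s' hs' => ?_
    have hσ' := H.split.smooth_splitting _ _ hs'
    simp only [H.quot, H.pairing_σ]
    rw [adjointConnection_spec F₂.bundle H.metric₂ F₂.connection hσ' hσ]
    congr 1
    have h2 := H.flat.parallel_j _ _ X hσ'
    simp only [H.split.splitting] at h2
    rw [h2, ← H.metric₂.conj_symm, ← H.pairing_σ, H.metric₂.conj_symm]
  rw [h1]
  conv_lhs => rw [← H.split.decomp b (adjointConnection h₂ F₂.D (fun y => σ y (s y)) b X), h0]
  rw [map_zero, zero_add]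

/-- The automorphism which is multiplication by `r` on the sub-bundle, and the identity on its
orthogonal complement. -/
def scale (_ : IsOrthogonalExtension i j σ p h₁ h₂ h₃) (r : ℂ) : FiberHom F₂.V F₂.V :=
  fun b => r • (i b).comp (p b) + (σ b).comp (j b)

theorem scale_apply (r : ℂ) (b : B) (x : F₂.V.fiber b) :
    H.scale r b x = r • i b (p b x) + σ b (j b x) := rfl

theorem p_scale (r : ℂ) (b : B) (x : F₂.V.fiber b) : p b (H.scale r b x) = r • p b x := by
  rw [scale_apply, map_add, map_smul, H.split.p_i, H.split.p_σ, add_zero]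

theorem j_scale (r : ℂ) (b : B) (x : F₂.V.fiber b) : j b (H.scale r b x) = j b x := by
  rw [scale_apply, map_add, map_smul, H.split.j_i, H.split.splitting, smul_zero, zero_add]

theorem scale_scale {r r' : ℂ} (hr : r * r' = 1) (b : B) (x : F₂.V.fiber b) :
    H.scale r b (H.scale r' b x) = x := by
  rw [scale_apply, p_scale, j_scale, map_smul, smul_smul, hr, one_smul, H.split.decomp]

theorem smooth_scale (r : ℂ) : IsSmoothHom (H.scale r) := fun _ _ hs =>
  F₂.bundle.smoothAt_add
    (F₂.bundle.smoothAt_const_smul r (H.split.smooth_i _ _ (H.split.smooth_projection _ _ hs)))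
    (H.split.smooth_splitting _ _ (H.split.smooth_j _ _ hs))

/-- In the splitting, the flat connection is upper triangular; conjugation by `scale r` multiplies
its off-diagonal entry by `r`. -/
theorem gauge_connection {r r' : ℂ} (hr : r * r' = 1) {s : F₂.V.Sec} (hs : F₂.V.SmoothAt s b) :
    gaugeConnection (H.scale r) (H.scale r') F₂.D s b X =
      i b (F₁.D (fun y => p y (s y)) b X) + σ b (F₃.D (fun y => j y (s y)) b X) +
        r • i b (p b (F₂.D (fun y => σ y (j y (s y))) b X)) := by
  have hp := H.split.smooth_projection _ _ hs
  have hj := H.split.smooth_j _ _ hs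
  have hσ := H.split.smooth_splitting _ _ hj
  have h1 := H.flat.parallel_j _ _ X hσ
  simp only [H.split.splitting] at h1
  simp only [gaugeConnection, scale_apply H r']
  rw [F₂.connection.map_add (F₂.bundle.smoothAt_const_smul r' (H.split.smooth_i _ _ hp)) hσ,
    F₂.connection.map_const_smul r' (H.split.smooth_i _ _ hp), H.flat.parallel_i _ _ _ hp,
    scale_apply, h1]
  simp only [map_add, map_smul, H.split.p_i, H.split.j_i, smul_zero, zero_add, smul_add,
    smul_smul, hr, one_smul]
  rw [← h1]
  abel

/-- In the splitting, the adjoint connection is lower triangular; conjugation by `scale r'`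
multiplies its off-diagonal entry by the inverse of `r'`. -/
theorem gauge_adjointConnection {r r' : ℂ} (hr : r * r' = 1) {s : F₂.V.Sec}
    (hs : F₂.V.SmoothAt s b) :
    gaugeConnection (H.scale r') (H.scale r) (adjointConnection h₂ F₂.D) s b X =
      i b (adjointConnection h₁ F₁.D (fun y => p y (s y)) b X) +
        σ b (adjointConnection h₃ F₃.D (fun y => j y (s y)) b X) +
        r • σ b (j b (adjointConnection h₂ F₂.D (fun y => i y (p y (s y))) b X)) := by
  have hp := H.split.smooth_projection _ _ hs
  have hj := H.split.smooth_j _ _ hs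
  have hi := H.split.smooth_i _ _ hp
  have hσ := H.split.smooth_splitting _ _ hj
  have hA := isConnection_adjointConnection F₂.bundle H.metric₂ F₂.connection
  simp only [gaugeConnection, scale_apply H r]
  rw [hA.map_add (F₂.bundle.smoothAt_const_smul r hi) hσ, hA.map_const_smul r hi,
    H.adjoint_quot hj, scale_apply]
  simp only [map_add, map_smul, H.split.p_σ, H.split.splitting, H.adjoint_sub hp,
    smul_smul, add_zero, mul_comm r' r, hr, one_smul]
  abel

/-- The path of connections from `∇₁^e ⊕ ∇₃^e` to `∇₂^e` consists of means of two flat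
connections, the conjugates of `∇₂` by `scale r` and of `∇₂*` by the inverse of `scale r`. -/
theorem connectionPath_eq_mean {r : ℝ} (hr : r ≠ 0) {s : F₂.V.Sec} (hs : F₂.V.SmoothAt s b) :
    connectionPath (sumConnection i j σ p (unitaryConnection h₁ F₁.D) (unitaryConnection h₃ F₃.D))
      (unitaryConnection h₂ F₂.D) r s b X =
    (1 / 2 : ℂ) • gaugeConnection (H.scale r) (H.scale (r : ℂ)⁻¹) F₂.D s b X +
      (1 / 2 : ℂ) •
        gaugeConnection (H.scale (r : ℂ)⁻¹) (H.scale r) (adjointConnection h₂ F₂.D) s b X := by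
  have hr' : (r : ℂ) * (r : ℂ)⁻¹ = 1 := mul_inv_cancel₀ (by exact_mod_cast hr)
  have e1 : ∀ b x, H.scale 1 b x = x := fun b x => by
    rw [scale_apply, one_smul, H.split.decomp]
  have h2 := H.gauge_connection (X := X) (mul_one 1) hs
  have h2' := H.gauge_adjointConnection (X := X) (mul_one 1) hs
  simp only [gaugeConnection, e1] at h2 h2'
  rw [H.gauge_connection hr' hs, H.gauge_adjointConnection hr' hs]
  simp only [connectionPath, sumConnection, unitaryConnection_apply, map_add, map_smul, h2, h2']
  push_cast
  module

/-- The off-diagonal difference `∇₂^e - ∇₁^e ⊕ ∇₃^e` is a multiple of the commutator of the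
difference of the two flat connections with the involution that is `1` on the sub-bundle and `-1` on
its complement. -/
theorem difference_eq_commutator {r : ℝ} (hr : r ≠ 0) (b : B) (X : TangentSpace (𝓡 d) b) :
    difference (sumConnection i j σ p (unitaryConnection h₁ F₁.D) (unitaryConnection h₃ F₃.D))
      (unitaryConnection h₂ F₂.D) b X = (-1 / (4 * r) : ℂ) •
    (((i b).comp (p b) - (σ b).comp (j b) : Module.End ℂ (F₂.V.fiber b)) *
      difference (gaugeConnection (H.scale r) (H.scale (r : ℂ)⁻¹) F₂.D)
        (gaugeConnection (H.scale (r : ℂ)⁻¹) (H.scale r) (adjointConnection h₂ F₂.D)) b X -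
      difference (gaugeConnection (H.scale r) (H.scale (r : ℂ)⁻¹) F₂.D)
        (gaugeConnection (H.scale (r : ℂ)⁻¹) (H.scale r) (adjointConnection h₂ F₂.D)) b X *
      ((i b).comp (p b) - (σ b).comp (j b) : Module.End ℂ (F₂.V.fiber b))) := by
  have hr0 : (r : ℂ) ≠ 0 := by exact_mod_cast hr
  have hr' : (r : ℂ) * (r : ℂ)⁻¹ = 1 := mul_inv_cancel₀ hr0
  have hr'' : (r : ℂ)⁻¹ * (r : ℂ) = 1 := inv_mul_cancel₀ hr0
  have hA := isConnection_adjointConnection F₂.bundle H.metric₂ F₂.connection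
  have c0 := isConnection_gaugeConnection (H.smooth_scale r) (H.smooth_scale (r : ℂ)⁻¹)
    (H.scale_scale hr') F₂.connection
  have c1 := isConnection_gaugeConnection (H.smooth_scale (r : ℂ)⁻¹) (H.smooth_scale r)
    (H.scale_scale hr'') hA
  refine endoAt_eq F₂.bundle fun s hs => ?_
  have hp := H.split.smooth_projection _ _ hs
  have hj := H.split.smooth_j _ _ hs
  have hi := H.split.smooth_i _ _ hp
  have hσ := H.split.smooth_splitting _ _ hj
  have e1 : ∀ b x, H.scale 1 b x = x := fun b x => by
    rw [scale_apply, one_smul, H.split.decomp]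
  have h2 := H.gauge_connection (X := X) (mul_one 1) hs
  have h2' := H.gauge_adjointConnection (X := X) (mul_one 1) hs
  simp only [gaugeConnection, e1] at h2 h2'
  have hε : F₂.V.SmoothAt (fun y => i y (p y (s y)) - σ y (j y (s y))) b :=
    F₂.bundle.smoothAt_sub hi hσ
  have hd := difference_apply (X := X) F₂.bundle c0 c1 hs
  have hdε := difference_apply (X := X) F₂.bundle c0 c1 hε
  rw [H.gauge_connection hr' hs, H.gauge_adjointConnection hr' hs] at hd
  rw [H.gauge_connection hr' hε, H.gauge_adjointConnection hr' hε] at hdε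
  have n1 : ∀ y x, p y (i y (p y x) - σ y (j y x)) = p y x := fun y x => by
    rw [map_sub, H.split.p_i, H.split.p_σ, sub_zero]
  have n2 : ∀ y x, j y (i y (p y x) - σ y (j y x)) = (-1 : ℂ) • j y x := fun y x => by
    rw [map_sub, H.split.j_i, H.split.splitting, zero_sub, neg_one_smul]
  simp only [n1, n2, map_smul] at hdε
  rw [F₃.connection.map_const_smul _ hj, F₂.connection.map_const_smul _ hσ,
    (isConnection_adjointConnection F₃.bundle H.metric₃ F₃.connection).map_const_smul _ hj] at hdε
  simp only [LinearMap.smul_apply, LinearMap.sub_apply, Module.End.mul_apply,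
    LinearMap.comp_apply, hd, hdε, sumConnection, unitaryConnection_apply, map_add, map_sub,
    map_smul, h2, h2', H.split.p_i, H.split.p_σ, H.split.j_i, H.split.splitting, map_zero]
  match_scalars <;> field_simp <;> ring

/-- The Chern-Simons form of an orthogonal flat extension vanishes. With `ω` the difference of the
two flat connections of which `∇_t` is the mean, its integrand is a multiple of the trace of
`[ε, ω] ω^{2k}`. -/
theorem chernSimonsForm_eq_zero (k : ℕ) (b : B) (X : Fin (2 * k + 1) → TangentSpace (𝓡 d) b) :
    chernSimonsForm (sumConnection i j σ p (unitaryConnection h₁ F₁.D)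
      (unitaryConnection h₃ F₃.D)) (unitaryConnection h₂ F₂.D) k b X = 0 := by
  rw [chernSimonsForm, intervalIntegral.integral_zero_ae, mul_zero]
  refine Eventually.of_forall fun r hr => ?_
  rw [Set.uIoc_of_le zero_le_one] at hr
  have hr0 : r ≠ 0 := hr.1.ne'
  have hrc : (r : ℂ) ≠ 0 := by exact_mod_cast hr0
  have hr' : (r : ℂ) * (r : ℂ)⁻¹ = 1 := mul_inv_cancel₀ hrc
  have hr'' : (r : ℂ)⁻¹ * (r : ℂ) = 1 := inv_mul_cancel₀ hrc
  have hA := isConnection_adjointConnection F₂.bundle H.metric₂ F₂.connection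
  have hAf := isFlat_adjointConnection F₂.bundle H.metric₂ F₂.connection F₂.flat
  have c0 := isConnection_gaugeConnection (H.smooth_scale r) (H.smooth_scale (r : ℂ)⁻¹)
    (H.scale_scale hr') F₂.connection
  have c1 := isConnection_gaugeConnection (H.smooth_scale (r : ℂ)⁻¹) (H.smooth_scale r)
    (H.scale_scale hr'') hA
  have f0 := isFlat_gaugeConnection F₂.bundle (H.smooth_scale r) (H.smooth_scale (r : ℂ)⁻¹)
    (H.scale_scale hr') (H.scale_scale hr'') F₂.connection F₂.flat
  have f1 := isFlat_gaugeConnection F₂.bundle (H.smooth_scale (r : ℂ)⁻¹) (H.smooth_scale r)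
    (H.scale_scale hr'') (H.scale_scale hr') hA hAf
  have hcurv := fun X Y => curvature_of_mean F₂.bundle c0 c1 f0 f1
    (fun _ b X hs => H.connectionPath_eq_mean (b := b) (X := X) hr0 hs) (b := b) X Y
  have key := sum_sign_trace_commutator_mul_prod_eq_zero
    (LinearMap.trace_mul_comm ℂ (M := F₂.V.fiber b)) k
    (fun m => difference (gaugeConnection (H.scale r) (H.scale (r : ℂ)⁻¹) F₂.D)
        (gaugeConnection (H.scale (r : ℂ)⁻¹) (H.scale r) (adjointConnection h₂ F₂.D)) b (X m))
    ((i b).comp (p b) - (σ b).comp (j b) : Module.End ℂ (F₂.V.fiber b)) (-1 / 4)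
  simp only [hcurv, H.difference_eq_commutator hr0, smul_mul_assoc, map_smul, smul_eq_mul,
    mul_left_comm _ (-1 / (4 * (r : ℂ)))]
  rw [← Finset.mul_sum, key, mul_zero, mul_zero]

/-- Additivity of classes in an orthogonal extension. -/
theorem cls_eq : F₂.cls h₂ H.metric₂ = F₁.cls h₁ H.metric₁ + F₃.cls h₃ H.metric₃ :=
  classOf_eq_add (kRelation_of_chernSimonsForm_eq_zero
    (isKGenerator_of_flat F₁.bundle H.metric₁ F₁.connection F₁.flat)
    (isKGenerator_of_flat F₂.bundle H.metric₂ F₂.connection F₂.flat)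
    (isKGenerator_of_flat F₃.bundle H.metric₃ F₃.connection F₃.flat) H.split
    fun k b X => H.chernSimonsForm_eq_zero k b X)

end IsOrthogonalExtension

/-- In a flat extension with a metric on the middle term, the quotient carries an induced metric
for which the classes are additive. -/
theorem exists_quotient_metric {F₁ F₂ F₃ : FlatBundle.{u, w} d B} {i : FiberHom F₁.V F₂.V}
    {j : FiberHom F₂.V F₃.V} (hE : IsFlatExact i j) {h₂ : Pairing F₂.V}
    (hh₂ : IsHermitianMetric d F₂.V h₂) :
    ∃ (h₃ : Pairing F₃.V) (hh₃ : IsHermitianMetric d F₃.V h₃),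
      (∀ b x y, (∀ u, h₂ b (i b u) x = 0) → (∀ u, h₂ b (i b u) y = 0) →
        h₃ b (j b x) (j b y) = h₂ b x y) ∧
      F₂.cls h₂ hh₂ = F₁.cls _ (hh₂.comap hE.smooth_i hE.injective) + F₃.cls h₃ hh₃ := by
  obtain ⟨σ, p, hs, ho⟩ := exists_orthogonal_splitting F₁.bundle F₂.bundle F₃.bundle hh₂
    hE.smooth_i hE.smooth_j hE.injective hE.exact hE.surjective
  have hh₃ := hh₂.comap hs.smooth_splitting fun b =>
    Function.LeftInverse.injective (hs.splitting b)
  have H : IsOrthogonalExtension i j σ p _ h₂ _ :=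
    ⟨hE, hs, hh₂.comap hE.smooth_i hE.injective, hh₂, hh₃, fun _ _ _ => rfl, fun _ _ _ => rfl, ho⟩
  refine ⟨_, hh₃, fun b x y hx hy => ?_, H.cls_eq⟩
  have key : ∀ x, (∀ u, h₂ b (i b u) x = 0) → σ b (j b x) = x := by
    intro x hx
    have h0 : i b (p b x) = 0 := hh₂.eq_zero_of_self (by rw [H.pairing_i, hx])
    conv_rhs => rw [← hs.decomp b x, h0, zero_add]
  rw [key x hx, key y hy]

/-- Additivity of classes in a flat extension with induced metrics. -/
theorem cls_eq_add_of_induced {F₁ F₂ F₃ : FlatBundle.{u, w} d B} {i : FiberHom F₁.V F₂.V}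
    {j : FiberHom F₂.V F₃.V} (hE : IsFlatExact i j) {h₁ : Pairing F₁.V} {h₂ : Pairing F₂.V}
    {h₃ : Pairing F₃.V} (hh₁ : IsHermitianMetric d F₁.V h₁) (hh₂ : IsHermitianMetric d F₂.V h₂)
    (hh₃ : IsHermitianMetric d F₃.V h₃) (e₁ : ∀ b x y, h₁ b x y = h₂ b (i b x) (i b y))
    (e₃ : ∀ b x y, (∀ u, h₂ b (i b u) x = 0) → (∀ u, h₂ b (i b u) y = 0) →
      h₃ b (j b x) (j b y) = h₂ b x y) :
    F₂.cls h₂ hh₂ = F₁.cls h₁ hh₁ + F₃.cls h₃ hh₃ := by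
  obtain ⟨σ, p, hs, ho⟩ := exists_orthogonal_splitting F₁.bundle F₂.bundle F₃.bundle hh₂
    hE.smooth_i hE.smooth_j hE.injective hE.exact hE.surjective
  have H : IsOrthogonalExtension i j σ p h₁ h₂ h₃ := by
    refine ⟨hE, hs, hh₁, hh₂, hh₃, e₁, fun b x y => ?_, ho⟩
    rw [← e₃ b _ _ (fun u => ho b u x) (fun u => ho b u y), hs.splitting, hs.splitting]
  exact H.cls_eq

end Orthogonal

/-! ### The zero bundle and metrics on the trivial line bundle -/

section Line

variable {d : ℕ} {B : Type u} [TopologicalSpace B] [ChartedSpace (EuclideanSpace ℝ (Fin d)) B]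

/-- The chain rule for a function followed by a holomorphic function. -/
theorem mvfderiv_comp_hasDerivAt {φ : ℂ → ℂ} {φ' : ℂ} {f : B → ℂ} {x : B}
    (hf : SmoothNear d f x) (hφf : SmoothNear d (fun y => φ (f y)) x)
    (hφ : HasDerivAt φ φ' (f x)) (X : TangentSpace (𝓡 d) x) :
    mvfderiv (𝓡 d) (fun y => φ (f y)) x X = φ' * mvfderiv (𝓡 d) f x X := by
  have h1 : HasFDerivAt φ
      ((ContinuousLinearMap.toSpanSingleton ℂ φ').restrictScalars ℝ)
      ((f ∘ (extChartAt (𝓡 d) x).symm) (extChartAt (𝓡 d) x x)) := by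
    rw [Function.comp_apply, extChartAt_to_inv]
    exact hφ.hasFDerivAt.restrictScalars ℝ
  have h := h1.comp _ (differentiableAt_chart_self hf).hasFDerivAt
  rw [mvfderiv_eq_fderiv hf, mvfderiv_eq_fderiv hφf]
  refine (DFunLike.congr_fun h.fderiv _).trans ?_
  simp [mul_comm]

variable (d B) in
theorem isVectorBundle_trivialLine : IsVectorBundle d (trivialLine.{u, w} d B) := by
  refine isVectorBundle_of_frames fun x => ⟨1, fun _ _ => ULift.up 1, ?_⟩
  refine Eventually.of_forall fun y => ⟨⟨?_, ?_⟩, fun s c hs => ?_⟩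
  · rw [Fintype.linearIndependent_iff]
    intro g hg j
    have := congrArg ULift.down hg
    rw [Subsingleton.elim j 0]
    simpa using this
  · rw [eq_top_iff]
    rintro ⟨z⟩ -
    rw [Submodule.mem_span_range_iff_exists_fun]
    refine ⟨fun _ => z, ?_⟩
    ext
    simp
  · have hc : ∀ᶠ z in 𝓝 y, (s z).down = c 0 z := by
      filter_upwards [hs] with z hz
      rw [hz]
      simp
    constructor
    · intro h j
      rw [Subsingleton.elim j 0]
      refine SmoothNear.congr (f := fun b => (s b).down) h ?_
      filter_upwards [hc] with z hz using hz.symm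
    · intro h
      exact (h 0).congr hc

variable [IsManifold (𝓡 d) ∞ B]

variable (d B) in
theorem isConnection_trivialConnection :
    IsConnection (trivialLine.{u, w} d B) (trivialConnection d B) where
  add s t b X hs ht := by
    ext
    exact mvfderiv_add_apply hs ht X
  leibniz f s b X hf hs := by
    ext
    exact mvfderiv_mul_apply hf hs X
  add_vector s b X Y hs := by
    ext
    exact map_add (mvfderiv (𝓡 d) (fun y => (s y).down) b) X Y
  smul_vector s b c X hs := by
    ext
    exact (map_smul (mvfderiv (𝓡 d) (fun y => (s y).down) b) c X).trans Complex.real_smul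
  smooth s b X hs := SmoothNear.mvfderiv_coordField hs (mem_extChartAt_source b) X

variable (d B) in
theorem isFlat_trivialConnection : IsFlat (trivialConnection.{u, w} d B) := by
  intro s b X Y hs
  ext
  exact sub_eq_zero.2 (mvfderiv_mvfderiv_comm (f := fun y => (s y).down) hs Y X)

omit [IsManifold (𝓡 d) ∞ B] in
variable (d B) in
theorem isHermitianMetric_trivialMetric :
    IsHermitianMetric d (trivialLine.{u, w} d B) (trivialMetric d B) where
  add_right b x y z := by simp [trivialMetric, mul_add]
  smul_right b x c y := by simp [trivialMetric, mul_left_comm]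
  conj_symm b x y := by simp [trivialMetric, mul_comm]
  pos b x hx := by
    have : x.down ≠ 0 := fun h => hx (by ext; exact h)
    simp only [trivialMetric, mul_comm, Complex.mul_conj, Complex.ofReal_re]
    exact Complex.normSq_pos.2 this
  smooth s t x hs ht := SmoothNear.mul (SmoothNear.conj hs) ht

variable (d B) in
theorem isKGenerator_trivialLine : IsKGenerator (trivialLine.{u, w} d B) (trivialMetric d B)
    (trivialConnection d B) 0 where
  bundle := isVectorBundle_trivialLine d B
  metric := isHermitianMetric_trivialMetric d B
  connection := isConnection_trivialConnection d B
  compatible s t b X hs ht := by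
    have h1 := mvfderiv_mul_apply (SmoothNear.conj hs) ht X
    rw [mvfderiv_conj hs] at h1
    exact h1
  form := ⟨0, rfl, fun k b X => by
    have : ∀ b (X Y : TangentSpace (𝓡 d) b),
        curvature (trivialConnection.{u, w} d B) b X Y = 0 := fun b X Y =>
      endoAt_eq (isVectorBundle_trivialLine d B) fun s hs =>
        (isFlat_trivialConnection d B s b X Y hs).symm
    simp [chernForm, this, List.ofFn_succ]⟩

variable (d B) in
/-- The trivial line bundle as a flat bundle. -/
noncomputable def lineBundle : FlatBundle.{u, w} d B where
  V := trivialLine d B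
  D := trivialConnection d B
  bundle := isVectorBundle_trivialLine d B
  connection := isConnection_trivialConnection d B
  flat := isFlat_trivialConnection d B

variable (d B) in
/-- The zero bundle as a flat bundle. -/
def zeroBundle : FlatBundle.{u, w} d B where
  V := { fiber := fun _ => PUnit.{w + 1}, SmoothAt := fun _ _ => True }
  D := fun _ _ _ => 0
  bundle := isVectorBundle_of_frames fun x => ⟨0, Fin.elim0, Eventually.of_forall fun y =>
    ⟨⟨linearIndependent_empty_type, Subsingleton.elim _ _⟩, fun s c _ => by simp⟩⟩
  connection := by constructor <;> intros <;> trivial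
  flat := fun _ _ _ _ _ => Subsingleton.elim _ _

variable (d B) in
theorem isHermitianMetric_zero :
    IsHermitianMetric d (zeroBundle.{u, w} d B).V (fun _ _ _ => 0) where
  add_right _ _ _ _ := (add_zero 0).symm
  smul_right _ _ _ _ := (mul_zero _).symm
  conj_symm _ _ _ := map_zero _
  pos _ _ hx := absurd rfl hx
  smooth _ _ x _ _ := SmoothNear.const 0 x

/-- The class of a bundle of rank zero vanishes: the sequence `0 → F → F → F → 0` is exact. -/
theorem FlatBundle.cls_eq_zero (F : FlatBundle.{u, w} d B) (hF : ∀ b, Subsingleton (F.V.fiber b))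
    {h : Pairing F.V} (hh : IsHermitianMetric d F.V h) : F.cls h hh = 0 := by
  have hE : IsFlatExact (F₁ := F) (F₂ := F) (F₃ := F) (fun _ => LinearMap.id)
      (fun _ => LinearMap.id) :=
    { smooth_i := fun _ _ hs => hs
      smooth_j := fun _ _ hs => hs
      parallel_i := fun _ _ _ _ => rfl
      parallel_j := fun _ _ _ _ => rfl
      injective := fun _ => Function.injective_id
      exact := fun b => by
        have := hF b
        exact Subsingleton.elim _ _
      surjective := fun _ => Function.surjective_id }
  have := cls_eq_add_of_induced hE hh hh hh (fun _ _ _ => rfl) (fun _ _ _ _ _ => rfl)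
  simpa using this

/-- The adjoint of the trivial connection for the metric with `⟨1, 1⟩ = e^ψ` is `d + dψ`. -/
theorem adjointConnection_trivialConnection {q : Pairing (trivialLine.{u, w} d B)}
    (hq : IsHermitianMetric d (trivialLine.{u, w} d B) q) {ψ : B → ℂ}
    (hψ : ∀ x, SmoothNear d ψ x)
    (hqψ : ∀ b x y, q b x y = Complex.exp (ψ b) * ((starRingEnd ℂ) x.down * y.down))
    {s : (trivialLine.{u, w} d B).Sec} {b : B} (hs : (trivialLine.{u, w} d B).SmoothAt s b)
    (X : TangentSpace (𝓡 d) b) :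
    adjointConnection q (trivialConnection d B) s b X =
      trivialConnection d B s b X + mvfderiv (𝓡 d) ψ b X • s b := by
  refine adjointConnection_eq (isVectorBundle_trivialLine d B) hq
    (isConnection_trivialConnection d B) hs fun s' hs' => ?_
  have hs1 : SmoothNear d (fun y => (s y).down) b := hs
  have hs2 : SmoothNear d (fun y => (s' y).down) b := hs'
  have hexp : SmoothNear d (fun y => Complex.exp (ψ y)) b :=
    (hψ b).comp_contDiff Complex.contDiff_exp
  simp only [hqψ]
  rw [mvfderiv_mul_apply hexp (hs2.conj.mul hs1), mvfderiv_mul_apply hs2.conj hs1,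
    mvfderiv_conj hs2, mvfderiv_comp_hasDerivAt (hψ b) hexp (Complex.hasDerivAt_exp _)]
  simp only [trivialConnection, ULift.add_down, ULift.smul_down, smul_eq_mul]
  ring

/-- The `0`-form defined by a smooth function. -/
noncomputable def functionForm (f : B → ℂ) (hf : ∀ x, SmoothNear d f x) : smoothForms d B ℂ 0 :=
  ⟨fun b => (ContinuousAlternatingMap.constOfIsEmpty ℝ (EuclideanSpace ℝ (Fin d)) (Fin 0) (f b) :
      EuclideanSpace ℝ (Fin d) [⋀^Fin 0]→L[ℝ] ℂ), by
    intro x y hy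
    have h1 : ContDiffAt ℝ ∞ (f ∘ (extChartAt (𝓡 d) x).symm) y := by
      have := (hf ((extChartAt (𝓡 d) x).symm y)).contDiffAt_chart
        ((extChartAt (𝓡 d) x).map_target hy)
      rwa [(extChartAt (𝓡 d) x).right_inv hy] at this
    have h2 := (ContinuousAlternatingMap.constOfIsEmptyLIE ℝ (EuclideanSpace ℝ (Fin d)) ℂ
      (Fin 0)).contDiff.contDiffAt.comp y h1 (n := ∞)
    refine h2.contDiffWithinAt.congr (fun z _ => ?_) ?_ <;> ext v <;> rfl⟩

theorem extDer_functionForm (f : B → ℂ) (hf : ∀ x, SmoothNear d f x) (b : B)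
    (X : Fin 1 → TangentSpace (𝓡 d) b) :
    extDer (functionForm f hf) b X = mvfderiv (𝓡 d) f b (X 0) := by
  have h1 : formInChart (functionForm f hf).1 b = fun y =>
      ContinuousAlternatingMap.constOfIsEmpty ℝ (EuclideanSpace ℝ (Fin d)) (Fin 0)
        ((f ∘ (extChartAt (𝓡 d) b).symm) y) := by
    funext y
    ext v
    rfl
  have h2 : extDer (functionForm f hf) b =
      extDeriv (formInChart (functionForm f hf).1 b) (extChartAt (𝓡 d) b b) := rfl
  rw [h2, h1, extDeriv_constOfIsEmpty, mvfderiv_eq_fderiv (hf b)]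
  rfl

/-- The class of the trivial flat line bundle does not depend on the metric. For the metric with
`⟨1, 1⟩ = e^ψ` the Hermitian connection is `d + dψ/2`; the Chern-Simons form is a multiple of `dψ`,
and the components of higher degree vanish with the curvature. -/
theorem cls_lineBundle {q : Pairing (trivialLine.{u, w} d B)}
    (hq : IsHermitianMetric d (trivialLine.{u, w} d B) q) :
    (lineBundle d B).cls q hq =
      (lineBundle d B).cls (trivialMetric d B) (isHermitianMetric_trivialMetric d B) := by
  have hV : IsVectorBundle d (trivialLine.{u, w} d B) := isVectorBundle_trivialLine d B
  have hD := isConnection_trivialConnection.{u, w} d B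
  -- Every metric has the form `e^ψ` times the trivial one.
  let one : (b : B) → (trivialLine.{u, w} d B).fiber b := fun _ => ULift.up 1
  let ρ : B → ℂ := fun b => q b (one b) (one b)
  have hone : ∀ x, (trivialLine.{u, w} d B).SmoothAt one x := fun x => SmoothNear.const 1 x
  have hρ : ∀ x, SmoothNear d ρ x := fun x => hq.smooth one one x (hone x) (hone x)
  have hpos : ∀ b, 0 < (ρ b).re := fun b => hq.pos b (one b) fun h => one_ne_zero
    (congrArg ULift.down h)
  have hreal : ∀ b, ((ρ b).re : ℂ) = ρ b := fun b =>
    Complex.conj_eq_iff_re.1 (hq.conj_symm b (one b) (one b))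
  let ψ : B → ℂ := fun b => (Real.log (ρ b).re : ℂ)
  have hexp : ∀ b, Complex.exp (ψ b) = ρ b := fun b => by
    rw [← Complex.ofReal_exp, Real.exp_log (hpos b), hreal]
  have hψ : ∀ x, SmoothNear d ψ x := fun x => by
    refine (hρ x).comp_contDiffAt (φ := fun z => ((Real.log z.re : ℝ) : ℂ)) ?_
    refine Eventually.of_forall fun y => ?_
    exact Complex.ofRealCLM.contDiff.contDiffAt.comp _
      ((Real.contDiffAt_log.2 (hpos y).ne').comp (ρ y) Complex.reCLM.contDiff.contDiffAt)
  have hqψ : ∀ b x y, q b x y = Complex.exp (ψ b) * ((starRingEnd ℂ) x.down * y.down) := by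
    intro b x y
    have ex : ∀ z : (trivialLine.{u, w} d B).fiber b, z = z.down • one b := fun z => by ext; simp [one]
    conv_lhs => rw [ex x, ex y]
    rw [hq.smul_left, hq.smul_right, hexp]
    ring
  have ht := isHermitianMetric_trivialMetric.{u, w} d B
  have htψ : ∀ b (x y : (trivialLine.{u, w} d B).fiber b), trivialMetric d B b x y =
      Complex.exp 0 * ((starRingEnd ℂ) x.down * y.down) := fun b x y => by
    simp [trivialMetric]
  -- The two Hermitian connections.
  have hu : ∀ (s : (trivialLine.{u, w} d B).Sec) (b : B) (X : TangentSpace (𝓡 d) b), (trivialLine.{u, w} d B).SmoothAt s b →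
      unitaryConnection q (trivialConnection d B) s b X =
        trivialConnection d B s b X + (1 / 2 * mvfderiv (𝓡 d) ψ b X) • s b := by
    intro s b X hs
    rw [unitaryConnection_apply, adjointConnection_trivialConnection hq hψ hqψ hs]
    module
  have hut : ∀ (s : (trivialLine.{u, w} d B).Sec) (b : B) (X : TangentSpace (𝓡 d) b), (trivialLine.{u, w} d B).SmoothAt s b →
      unitaryConnection (trivialMetric d B) (trivialConnection d B) s b X =
        trivialConnection d B s b X := by
    intro s b X hs
    rw [unitaryConnection_apply,
      adjointConnection_trivialConnection ht (fun x => SmoothNear.const 0 x) htψ hs,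
      mvfderiv_const_apply]
    module
  -- The relation comes from the sequence `0 → ℂ → ℂ → 0 → 0`.
  have hsplit : IsSplitShortExact (V₁ := trivialLine.{u, w} d B) (V₂ := trivialLine.{u, w} d B) (V₃ := (zeroBundle.{u, w} d B).V)
      (fun _ => LinearMap.id) (fun _ => 0) (fun _ => 0) (fun _ => LinearMap.id) :=
    { smooth_i := fun _ _ hs => hs
      smooth_j := fun _ _ _ => trivial
      smooth_splitting := fun _ x _ => SmoothNear.const 0 x
      smooth_projection := fun _ _ hs => hs
      injective := fun _ => Function.injective_id
      exact := fun b => by simp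
      surjective := fun b x => ⟨0, rfl⟩
      splitting := fun _ _ => rfl
      projection := fun _ _ => by simp }
  have hz := isHermitianMetric_zero.{u, w} d B
  let D₀ : Oper d (trivialLine.{u, w} d B) := sumConnection (V₁ := trivialLine.{u, w} d B) (V₂ := trivialLine.{u, w} d B) (V₃ := (zeroBundle.{u, w} d B).V)
    (fun _ => LinearMap.id) (fun _ => 0) (fun _ => 0) (fun _ => LinearMap.id)
    (unitaryConnection (trivialMetric d B) (trivialConnection d B))
    (unitaryConnection (fun _ _ _ => 0) (zeroBundle.{u, w} d B).D)
  have hD₀ : ∀ (s : (trivialLine.{u, w} d B).Sec) (b : B) (X : TangentSpace (𝓡 d) b), (trivialLine.{u, w} d B).SmoothAt s b →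
      D₀ s b X = trivialConnection d B s b X := by
    intro s b X hs
    simp only [D₀, sumConnection, LinearMap.id_apply, LinearMap.zero_apply, add_zero]
    exact hut s b X hs
  have hdiff : ∀ b (X : TangentSpace (𝓡 d) b),
      difference D₀ (unitaryConnection q (trivialConnection d B)) b X =
        (1 / 2 * mvfderiv (𝓡 d) ψ b X) • (1 : Module.End ℂ ((trivialLine.{u, w} d B).fiber b)) := by
    intro b X
    refine endoAt_eq hV fun s hs => ?_
    rw [hu s b X hs, hD₀ s b X hs, add_sub_cancel_left]
    rfl
  -- The connections of the path are gauge equivalent to the trivial connection.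
  have hcurv : ∀ (r : ℝ) (b : B) (X Y : TangentSpace (𝓡 d) b),
      curvature (connectionPath D₀ (unitaryConnection q (trivialConnection d B)) r) b X Y = 0 := by
    intro r b X Y
    let f : B → ℂ := fun y => Complex.exp (r / 2 * ψ y)
    let f' : B → ℂ := fun y => Complex.exp (-(r / 2 * ψ y))
    have hrψ : ∀ x, SmoothNear d (fun y => (r / 2 : ℂ) * ψ y) x := fun x =>
      (SmoothNear.const _ x).mul (hψ x)
    have hf : ∀ x, SmoothNear d f x := fun x => (hrψ x).comp_contDiff Complex.contDiff_exp
    have hf' : ∀ x, SmoothNear d f' x := fun x => (hrψ x).neg.comp_contDiff Complex.contDiff_exp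
    have hff' : ∀ b, f b * f' b = 1 := fun b => by
      simp only [f, f']
      rw [← Complex.exp_add, add_neg_cancel, Complex.exp_zero]
    let g : FiberHom (trivialLine.{u, w} d B) (trivialLine.{u, w} d B) := fun b => f b • LinearMap.id
    let g' : FiberHom (trivialLine.{u, w} d B) (trivialLine.{u, w} d B) := fun b => f' b • LinearMap.id
    have hg : IsSmoothHom g := fun s x hs => hV.smoothAt_smul (hf x) hs
    have hg' : IsSmoothHom g' := fun s x hs => hV.smoothAt_smul (hf' x) hs
    have hgg' : ∀ b x, g b (g' b x) = x := fun b x => by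
      simp only [g, g', LinearMap.smul_apply, LinearMap.id_apply, smul_smul, hff', one_smul]
    have hg'g : ∀ b x, g' b (g b x) = x := fun b x => by
      simp only [g, g', LinearMap.smul_apply, LinearMap.id_apply, smul_smul, mul_comm (f' b), hff',
        one_smul]
    have hc := isConnection_gaugeConnection hg' hg hg'g hD
    have hfl := isFlat_gaugeConnection hV hg' hg hg'g hgg' hD (isFlat_trivialConnection d B)
    have hagree : ∀ (s : (trivialLine.{u, w} d B).Sec) (b : B) (X : TangentSpace (𝓡 d) b), (trivialLine.{u, w} d B).SmoothAt s b →
        connectionPath D₀ (unitaryConnection q (trivialConnection d B)) r s b X =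
          gaugeConnection g' g (trivialConnection d B) s b X := by
      intro s b X hs
      have h1 : mvfderiv (𝓡 d) f b X = f b * (r / 2 * mvfderiv (𝓡 d) ψ b X) := by
        rw [← mvfderiv_const_mul _ (hψ b)]
        exact mvfderiv_comp_hasDerivAt (hrψ b) (hf b) (Complex.hasDerivAt_exp _) X
      simp only [connectionPath, hD₀ s b X hs, hu s b X hs, gaugeConnection, g, g',
        LinearMap.smul_apply, LinearMap.id_apply]
      rw [hD.leibniz f s b X (hf b) hs, h1]
      ext
      simp only [ULift.add_down, ULift.smul_down, smul_eq_mul]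
      push_cast
      linear_combination (-(r / 2 * mvfderiv (𝓡 d) ψ b X * (s b).down +
        (trivialConnection d B s b X).down)) * hff' b
    refine endoAt_eq hV fun s hs => ?_
    rw [curvatureOn_congr hV hc hagree hs, hfl s b X Y hs]
    rfl
  -- In degree one the Chern-Simons form is `-(1/2πi) dψ/2`, which `β = (1/2πi) ψ/2` compensates.
  have hK : KRelation
      ⟨trivialLine.{u, w} d B, trivialMetric d B, unitaryConnection (trivialMetric d B) (trivialConnection d B), 0,
        isKGenerator_of_flat hV ht hD (isFlat_trivialConnection d B)⟩
      ⟨trivialLine.{u, w} d B, q, unitaryConnection q (trivialConnection d B), 0,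
        isKGenerator_of_flat hV hq hD (isFlat_trivialConnection d B)⟩
      ⟨_, _, _, 0, isKGenerator_of_flat (zeroBundle.{u, w} d B).bundle hz
        (zeroBundle.{u, w} d B).connection (zeroBundle.{u, w} d B).flat⟩ := by
    refine ⟨_, _, _, _, hsplit, 0, 0, 0, rfl, rfl, rfl,
      fun k => match k with
        | 0 => functionForm (fun b => 1 / (2 * Real.pi * Complex.I) * (1 / 2) * ψ b)
            fun x => (SmoothNear.const _ x).mul (hψ x)
        | k + 1 => 0, fun k b X => ?_⟩
    have hcs : chernSimonsForm D₀ (unitaryConnection q (trivialConnection d B)) k b X =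
        if k = 0 then -(1 / (2 * Real.pi * Complex.I) * (1 / 2) * mvfderiv (𝓡 d) ψ b (X 0))
        else 0 := by
      rcases k with _ | k
      · simp only [chernSimonsForm, hdiff]
        have : LinearMap.trace ℂ ((trivialLine.{u, w} d B).fiber b) 1 = 1 := by
          rw [LinearMap.trace_one]
          have : Module.finrank ℂ (ULift.{w} ℂ) = 1 := by
            rw [ULift.moduleEquiv.finrank_eq, Module.finrank_self]
          exact_mod_cast this
        simp [this]
        ring
      · simp only [chernSimonsForm, hcurv]
        simp [List.ofFn_succ]
    change _ = _ + _ + chernSimonsForm D₀ (unitaryConnection q (trivialConnection d B)) k b X + _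
    rw [hcs]
    rcases k with _ | k
    · have hext := extDer_functionForm (fun b => 1 / (2 * Real.pi * Complex.I) * (1 / 2) * ψ b)
        (fun x => (SmoothNear.const _ x).mul (hψ x)) b X
      rw [mvfderiv_const_mul _ (hψ b)] at hext
      simp only [if_true]
      rw [hext]
      simp
    · simp
  have h := classOf_eq_add hK
  have h0 := (zeroBundle.{u, w} d B).cls_eq_zero
    (fun b => inferInstanceAs (Subsingleton PUnit)) hz
  have h1 : (lineBundle d B).cls q hq = (lineBundle d B).cls (trivialMetric d B) ht +
      (zeroBundle.{u, w} d B).cls _ hz := h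
  rw [h1, h0, add_zero]

end Line

/-! ### Independence of the metric -/

section Product

variable {d : ℕ} {B : Type u} [TopologicalSpace B] [ChartedSpace (EuclideanSpace ℝ (Fin d)) B]

/-- The direct sum of two families. -/
abbrev prodFamily (V W : Family.{u, w} B) : Family.{u, w} B where
  fiber b := V.fiber b × W.fiber b
  SmoothAt s x := V.SmoothAt (fun b => (s b).1) x ∧ W.SmoothAt (fun b => (s b).2) x

theorem isVectorBundle_prodFamily {V W : Family.{u, w} B} (hV : IsVectorBundle d V)
    (hW : IsVectorBundle d W) : IsVectorBundle d (prodFamily V W) := by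
  choose m e he using hV.exists_frame
  choose n f hf using hW.exists_frame
  refine isVectorBundle_of_frames' (ι := fun x => Fin (m x) ⊕ Fin (n x)) fun x =>
    ⟨Sum.elim (fun j y => (e x j y, 0)) (fun j y => (0, f x j y)), ?_⟩
  filter_upwards [(he x).eventually, (hf x).eventually] with y hey hfy
  have hsum : ∀ (c : Fin (m x) ⊕ Fin (n x) → ℂ) (z : B),
      ∑ j, c j • Sum.elim (fun j y => ((e x j y, 0) : V.fiber y × W.fiber y))
        (fun j y => (0, f x j y)) j z =
      (∑ j, c (Sum.inl j) • e x j z, ∑ j, c (Sum.inr j) • f x j z) := fun c z => by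
    rw [Fintype.sum_sum_type]
    ext <;> simp [Prod.fst_sum, Prod.snd_sum]
  refine ⟨⟨?_, ?_⟩, fun s c hs => ?_⟩
  · rw [Fintype.linearIndependent_iff]
    intro c hc
    rw [hsum, Prod.mk_eq_zero] at hc
    have h1 := Fintype.linearIndependent_iff.1 hey.linearIndependent _ hc.1
    have h2 := Fintype.linearIndependent_iff.1 hfy.linearIndependent _ hc.2
    rintro (j | j)
    · exact h1 j
    · exact h2 j
  · rw [eq_top_iff]
    rintro ⟨a, b⟩ -
    obtain ⟨c, hc⟩ := exists_coeff_of_span_eq_top hey.span_eq_top a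
    obtain ⟨c', hc'⟩ := exists_coeff_of_span_eq_top hfy.span_eq_top b
    rw [Submodule.mem_span_range_iff_exists_fun]
    refine ⟨Sum.elim c c', ?_⟩
    rw [hsum]
    simp [hc, hc']
  · have h1 := hey.smoothAt_iff (s := fun b => (s b).1) (c := fun j => c (Sum.inl j)) (by
      filter_upwards [hs] with z hz
      rw [hz, hsum fun j => c j z])
    have h2 := hfy.smoothAt_iff (s := fun b => (s b).2) (c := fun j => c (Sum.inr j)) (by
      filter_upwards [hs] with z hz
      rw [hz, hsum fun j => c j z])
    exact (and_congr h1 h2).trans (Sum.forall (p := fun j => SmoothNear d (c j) y)).symm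

variable [IsManifold (𝓡 d) ∞ B]

/-- The direct sum of two flat bundles. -/
def FlatBundle.prod (F G : FlatBundle.{u, w} d B) : FlatBundle.{u, w} d B where
  V := prodFamily F.V G.V
  D s b X := (F.D (fun y => (s y).1) b X, G.D (fun y => (s y).2) b X)
  bundle := isVectorBundle_prodFamily F.bundle G.bundle
  connection :=
    { add := fun _ _ b X hs ht =>
        Prod.ext (F.connection.add _ _ b X hs.1 ht.1) (G.connection.add _ _ b X hs.2 ht.2)
      leibniz := fun f _ b X hf hs =>
        Prod.ext (F.connection.leibniz f _ b X hf hs.1) (G.connection.leibniz f _ b X hf hs.2)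
      add_vector := fun _ b X Y hs =>
        Prod.ext (F.connection.add_vector _ b X Y hs.1) (G.connection.add_vector _ b X Y hs.2)
      smul_vector := fun _ b c X hs =>
        Prod.ext (F.connection.smul_vector _ b c X hs.1) (G.connection.smul_vector _ b c X hs.2)
      smooth := fun _ b X hs =>
        ⟨F.connection.smooth _ b X hs.1, G.connection.smooth _ b X hs.2⟩ }
  flat _ b X Y hs := Prod.ext (F.flat _ b X Y hs.1) (G.flat _ b X Y hs.2)

variable {F : FlatBundle.{u, w} d B}

omit [IsManifold (𝓡 d) ∞ B] in
/-- The metric of the graph of `τ`: `|x|² + |τ x + c|²`, as a metric on `F ⊕ ℂ`. -/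
theorem isHermitianMetric_graph {V : Family.{u, w} B} {h : Pairing V} (hh : IsHermitianMetric d V h)
    {τ : FiberHom V (trivialLine d B)} (hτ : IsSmoothHom τ) :
    IsHermitianMetric d (prodFamily V (trivialLine d B)) (fun b x y => h b x.1 y.1 +
      (starRingEnd ℂ) ((τ b x.1).down + x.2.down) * ((τ b y.1).down + y.2.down)) where
  add_right b x y z := by
    change h b x.1 (y.1 + z.1) + _ * ((τ b (y.1 + z.1)).down + (y.2 + z.2).down) = _
    rw [hh.add_right, (τ b).map_add, ULift.add_down, ULift.add_down]
    ring
  smul_right b x c y := by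
    change h b x.1 (c • y.1) + _ * ((τ b (c • y.1)).down + (c • y.2).down) = _
    rw [hh.smul_right, map_smul, ULift.smul_down, ULift.smul_down, smul_eq_mul, smul_eq_mul]
    ring
  conj_symm b x y := by
    rw [map_add, hh.conj_symm, map_mul, Complex.conj_conj, mul_comm]
  pos b x hx := by
    have h1 : 0 ≤ (h b x.1 x.1).re := by
      by_cases h0 : x.1 = 0
      · rw [h0, hh.zero_right]
        simp
      · exact (hh.pos b _ h0).le
    have h2 : ∀ z : ℂ, ((starRingEnd ℂ) z * z).re = Complex.normSq z := fun z => by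
      rw [mul_comm, Complex.mul_conj, Complex.ofReal_re]
    rw [Complex.add_re, h2]
    by_cases h0 : x.1 = 0
    · have h3 : x.2.down ≠ 0 := fun h3 => hx (Prod.ext h0 (ULift.ext _ _ h3))
      rw [h0, map_zero, ULift.zero_down, zero_add, hh.zero_right]
      simpa using h3
    · exact add_pos_of_pos_of_nonneg (hh.pos b _ h0) (Complex.normSq_nonneg _)
  smooth s t x hs ht := by
    have h1 : SmoothNear d (fun b => (τ b (s b).1).down + (s b).2.down) x :=
      SmoothNear.add (hτ _ x hs.1) hs.2
    have h2 : SmoothNear d (fun b => (τ b (t b).1).down + (t b).2.down) x :=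
      SmoothNear.add (hτ _ x ht.1) ht.2
    exact (hh.smooth _ _ x hs.1 ht.1).add (h1.conj.mul h2)

/-- The square `|τ|²` of a fibrewise linear functional. -/
def squareOf {V : Family.{u, w} B} (τ : FiberHom V (trivialLine d B)) : Pairing V :=
  fun b x y => (starRingEnd ℂ) (τ b x).down * (τ b y).down

/-- Adding the square of a functional `τ` to the metric does not change the class. The bundle
`F ⊕ ℂ` with the metric `|x|² + |τ x + c|²` is an extension of `ℂ` by `F` with the metric
`h + |τ|²`, and an extension of `F` by `ℂ` with quotient metric `h`. -/
theorem cls_add_squareOf {h : Pairing F.V} (hh : IsHermitianMetric d F.V h)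
    {τ : FiberHom F.V (trivialLine d B)} (hτ : IsSmoothHom τ) :
    ∃ hh' : IsHermitianMetric d F.V (h + squareOf τ), F.cls _ hh' = F.cls h hh := by
  have hW : IsHermitianMetric d (F.prod (lineBundle d B)).V _ := isHermitianMetric_graph hh hτ
  have hL := isVectorBundle_trivialLine.{u, w} d B
  have hE : IsFlatExact (F₁ := F) (F₂ := F.prod (lineBundle d B)) (F₃ := lineBundle d B)
      (fun _ => LinearMap.inl ℂ _ _) (fun _ => LinearMap.snd ℂ _ _) :=
    { smooth_i := fun s x hs => ⟨hs, hL.smoothAt_zero x⟩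
      smooth_j := fun s x hs => hs.2
      parallel_i := fun s b X hs =>
        Prod.ext rfl ((isConnection_trivialConnection d B).map_zero hL)
      parallel_j := fun s b X hs => rfl
      injective := fun b => LinearMap.inl_injective
      exact := fun b => LinearMap.range_inl ℂ _ _
      surjective := fun b => LinearMap.snd_surjective }
  have hE' : IsFlatExact (F₁ := lineBundle d B) (F₂ := F.prod (lineBundle d B)) (F₃ := F)
      (fun _ => LinearMap.inr ℂ _ _) (fun _ => LinearMap.fst ℂ _ _) :=
    { smooth_i := fun s x hs => ⟨F.bundle.smoothAt_zero x, hs⟩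
      smooth_j := fun s x hs => hs.1
      parallel_i := fun s b X hs =>
        Prod.ext (F.connection.map_zero F.bundle) rfl
      parallel_j := fun s b X hs => rfl
      injective := fun b => LinearMap.inr_injective
      exact := fun b => LinearMap.range_inr ℂ _ _
      surjective := fun b => LinearMap.fst_surjective }
  have e : ∀ b x y, h b x y + (starRingEnd ℂ) ((τ b x).down + 0) * ((τ b y).down + 0) =
      (h + squareOf τ) b x y := fun b x y => by
    rw [add_zero, add_zero]
    rfl
  obtain ⟨q, hq, -, h1⟩ := exists_quotient_metric hE hW
  have hh' := hW.comap hE.smooth_i hE.injective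
  have hh'' : IsHermitianMetric d F.V (h + squareOf τ) := by
    have : h + squareOf τ = fun b x y => h b x y +
        (starRingEnd ℂ) ((τ b x).down + 0) * ((τ b y).down + 0) := by
      funext b x y
      exact (e b x y).symm
    rw [this]
    exact hh'
  refine ⟨hh'', ?_⟩
  have h2 := cls_eq_add_of_induced hE' (isHermitianMetric_trivialMetric d B) hW hh
    (fun b x y => by
      change _ = h b 0 0 + (starRingEnd ℂ) ((τ b 0).down + x.down) * ((τ b 0).down + y.down)
      rw [hh.zero_right, map_zero, ULift.zero_down, zero_add, zero_add, zero_add]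
      rfl)
    (fun b x y hx _ => by
      have h0 := hx (ULift.up 1)
      change h b 0 x.1 + (starRingEnd ℂ) ((τ b 0).down + 1) * ((τ b x.1).down + x.2.down) = 0
        at h0
      rw [hh.zero_left, map_zero, ULift.zero_down, zero_add, zero_add, map_one, one_mul] at h0
      rw [h0, map_zero, zero_mul, add_zero]
      rfl)
  have h3 : F.cls _ hh'' = F.cls _ hh' := FlatBundle.cls_congr fun b x y => (e b x y).symm
  have h4 := h1.symm.trans h2
  rw [cls_lineBundle hq, add_comm] at h4
  rw [h3]
  exact add_left_cancel h4

/-- The pairings that are finite sums of squares of smooth functionals. -/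
def sumsOfSquares (V : Family.{u, w} B) : AddSubmonoid (Pairing V) :=
  AddSubmonoid.closure {p | ∃ τ : FiberHom V (trivialLine d B), IsSmoothHom τ ∧ p = squareOf τ}

theorem cls_add_sumsOfSquares {p : Pairing F.V} (hp : p ∈ sumsOfSquares (d := d) F.V) :
    ∀ {h : Pairing F.V} (hh : IsHermitianMetric d F.V h),
      ∃ hh' : IsHermitianMetric d F.V (h + p), F.cls _ hh' = F.cls h hh := by
  induction hp using AddSubmonoid.closure_induction with
  | mem p hp =>
    obtain ⟨τ, hτ, rfl⟩ := hp
    exact fun hh => cls_add_squareOf hh hτ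
  | zero => exact fun {h} hh => ⟨by rwa [add_zero], FlatBundle.cls_congr fun b x y => add_zero _⟩
  | add p q _ _ hp hq =>
    intro h hh
    obtain ⟨h1, e1⟩ := hp hh
    obtain ⟨h2, e2⟩ := hq h1
    refine ⟨by rwa [← add_assoc], ?_⟩
    rw [← e1, ← e2]
    exact FlatBundle.cls_congr fun b x y => by rw [← add_assoc]

end Product

section MetricIndependence

variable {d : ℕ} {B : Type u} [TopologicalSpace B] [ChartedSpace (EuclideanSpace ℝ (Fin d)) B]
  [IsManifold (𝓡 d) ∞ B]

theorem exists_bump [T2Space B] {x : B} {U : Set B} (hU : U ∈ 𝓝 x) :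
    ∃ f : B → ℝ, (∀ y, SmoothNear d (fun y => (f y : ℂ)) y) ∧ f x = 1 ∧ tsupport f ⊆ U := by
  obtain ⟨f, -, hf⟩ := (SmoothBumpFunction.nhds_basis_tsupport (I := 𝓡 d) x).mem_iff.1 hU
  refine ⟨f, fun y => Eventually.of_forall fun z => ?_, f.eq_one, hf⟩
  exact (Complex.ofRealCLM.contDiff.contMDiff.comp f.contMDiff).contMDiffAt

/-- Cut off by a bump function, twice any Hermitian form is a difference of sums of squares: in
frame coordinates `x_i`, `∑ |x_i + κ_ij x_j|² = 2 κ(x, x) + ∑ |x_i|² + ∑ |κ_ij x_j|²`. -/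
theorem exists_local_polarization [T2Space B] {V : Family.{u, w} B} (hV : IsVectorBundle d V)
    (x : B) : ∃ ρ : B → ℝ, (∀ y, SmoothNear d (fun y => (ρ y : ℂ)) y) ∧ (∀ y, 0 ≤ ρ y) ∧ 0 < ρ x ∧
      ∀ κ : Pairing V, IsHermitianMetric d V κ →
        ∃ p ∈ sumsOfSquares (d := d) V, ∃ q ∈ sumsOfSquares (d := d) V,
          ∀ b u v, (ρ b : ℂ) * κ b u v + p b u v = q b u v := by
  classical
  obtain ⟨r, e, he⟩ := hV.exists_frame x
  obtain ⟨f, hf, hfx, hfU⟩ := exists_bump (d := d) (U := {y | IsFrame d V e y}) he.eventually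
  -- the coordinate functionals, extended by zero
  have hco : ∀ b, ∃ ξ : Fin r → V.fiber b →ₗ[ℂ] ℂ, IsFrame d V e b →
      ∀ u, u = ∑ i, ξ i u • e i b := by
    intro b
    by_cases hb : IsFrame d V e b
    · let β := Module.Basis.mk hb.linearIndependent hb.span_eq_top.ge
      refine ⟨fun i => β.coord i, fun _ u => ?_⟩
      conv_lhs => rw [← β.sum_repr u]
      simp [β]
    · exact ⟨0, fun h => absurd h hb⟩
  choose ξ hξ using hco
  let up : (b : B) → ℂ →ₗ[ℂ] (trivialLine.{u, w} d B).fiber b := fun b =>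
    (ULift.moduleEquiv.symm : ℂ ≃ₗ[ℂ] ULift.{w} ℂ).toLinearMap
  -- a smooth coefficient times a cut-off coordinate is a smooth functional
  have hsm : ∀ (j : Fin r) (c : B → ℂ), (∀ y, IsFrame d V e y → SmoothNear d c y) →
      IsSmoothHom (V := V) (W := trivialLine.{u, w} d B)
        (fun b => ((f b : ℂ) * c b) • (up b).comp (ξ b j)) := by
    intro j c hc s y hs
    change SmoothNear d (fun b => ((f b : ℂ) * c b) * ξ b j (s b)) y
    by_cases hy : IsFrame d V e y
    · refine ((hf y).mul (hc y hy)).mul ?_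
      refine (hy.smoothAt_iff (c := fun i b => ξ b i (s b)) ?_).1 hs j
      filter_upwards [hy.eventually] with z hz using hξ z hz (s z)
    · have h0 : f =ᶠ[𝓝 y] 0 := notMem_tsupport_iff_eventuallyEq.1 fun h => hy (hfU h)
      refine (SmoothNear.const 0 y).congr ?_
      filter_upwards [h0] with z hz
      simp [hz]
  refine ⟨fun b => 2 * f b ^ 2, fun y => ?_, fun y => by positivity, by
    simp [hfx],
    fun κ hκ => ?_⟩
  · refine ((SmoothNear.const 2 y).mul ((hf y).mul (hf y))).congr (Eventually.of_forall fun z => ?_)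
    push_cast
    ring
  have hκs : ∀ i j y, IsFrame d V e y → SmoothNear d (fun b => κ b (e i b) (e j b)) y :=
    fun i j y hy => hκ.smooth _ _ y (hy.smooth i) (hy.smooth j)
  let α : Fin r → FiberHom V (trivialLine.{u, w} d B) := fun i b =>
    ((f b : ℂ) * 1) • (up b).comp (ξ b i)
  let β : Fin r → Fin r → FiberHom V (trivialLine.{u, w} d B) := fun i j b =>
    ((f b : ℂ) * κ b (e i b) (e j b)) • (up b).comp (ξ b j)
  have hα : ∀ i, IsSmoothHom (α i) := fun i => hsm i _ fun y _ => SmoothNear.const 1 y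
  have hβ : ∀ i j, IsSmoothHom (β i j) := fun i j => hsm j _ (hκs i j)
  have hαβ : ∀ i j, IsSmoothHom (fun b => α i b + β i j b) := fun i j s y hs =>
    SmoothNear.add (hα i s y hs) (hβ i j s y hs)
  have hmem : ∀ τ : FiberHom V (trivialLine.{u, w} d B), IsSmoothHom τ →
      squareOf τ ∈ sumsOfSquares (d := d) V := fun τ hτ =>
    AddSubmonoid.subset_closure ⟨τ, hτ, rfl⟩
  refine ⟨∑ i, ∑ j, (squareOf (α i) + squareOf (β i j)),
    sum_mem fun i _ => sum_mem fun j _ => add_mem (hmem _ (hα i)) (hmem _ (hβ i j)),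
    ∑ i, ∑ j, squareOf (fun b => α i b + β i j b),
    sum_mem fun i _ => sum_mem fun j _ => hmem _ (hαβ i j), fun b u v => ?_⟩
  have hα' : ∀ i u, (α i b u).down = f b * ξ b i u := fun i u => by
    change (f b : ℂ) * 1 * ξ b i u = _
    rw [mul_one]
  have hβ' : ∀ i j u, (β i j b u).down = f b * κ b (e i b) (e j b) * ξ b j u := fun i j u => rfl
  have hκb : (f b : ℂ) ^ 2 * κ b u v = (f b : ℂ) ^ 2 * ∑ i, ∑ j,
      (starRingEnd ℂ) (ξ b i u) * ξ b j v * κ b (e i b) (e j b) := by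
    by_cases hb : f b = 0
    · simp [hb]
    · have hfr : IsFrame d V e b := hfU (subset_tsupport f hb)
      congr 1
      conv_lhs => rw [hξ b hfr u, hξ b hfr v]
      rw [hκ.sum_left]
      refine Finset.sum_congr rfl fun i _ => ?_
      rw [hκ.sum_right, Finset.mul_sum]
      exact Finset.sum_congr rfl fun j _ => by ring
  have hswap : ∑ i, ∑ j, (starRingEnd ℂ) (ξ b i u) * ξ b j v * κ b (e i b) (e j b) =
      ∑ i, ∑ j, (starRingEnd ℂ) (ξ b j u) * ξ b i v * κ b (e j b) (e i b) :=
    Finset.sum_comm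
  have hL : ((2 * f b ^ 2 : ℝ) : ℂ) * κ b u v = ∑ i, ∑ j, (f b : ℂ) ^ 2 *
      ((starRingEnd ℂ) (ξ b i u) * ξ b j v * κ b (e i b) (e j b) +
        (starRingEnd ℂ) (ξ b j u) * ξ b i v * κ b (e j b) (e i b)) := by
    simp only [mul_add, Finset.sum_add_distrib, ← Finset.mul_sum]
    rw [← hswap, ← hκb]
    push_cast
    ring
  rw [hL]
  simp only [Finset.sum_apply, Pi.add_apply, ← Finset.sum_add_distrib, squareOf,
    LinearMap.add_apply, ULift.add_down, hα', hβ']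
  refine Finset.sum_congr rfl fun i _ => Finset.sum_congr rfl fun j _ => ?_
  rw [← hκ.conj_symm b (e i b) (e j b)]
  simp only [map_add, map_mul, Complex.conj_ofReal]
  ring

omit [IsManifold (𝓡 d) ∞ B] in
theorem IsHermitianMetric.smul_of_pos {V : Family.{u, w} B} {h : Pairing V}
    (hh : IsHermitianMetric d V h) {ρ : B → ℝ} (hρ : ∀ y, SmoothNear d (fun y => (ρ y : ℂ)) y)
    (hpos : ∀ y, 0 < ρ y) : IsHermitianMetric d V (fun b x y => (ρ b : ℂ) * h b x y) where
  add_right b x y z := by rw [hh.add_right, mul_add]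
  smul_right b x c y := by rw [hh.smul_right, mul_left_comm]
  conj_symm b x y := by rw [map_mul, hh.conj_symm, Complex.conj_ofReal]
  pos b x hx := by
    rw [Complex.re_ofReal_mul]
    exact mul_pos (hpos b) (hh.pos b x hx)
  smooth s t x hs ht := (hρ x).mul (hh.smooth s t x hs ht)

/-- Over a compact base, every Hermitian metric is a difference of sums of squares of smooth
functionals. -/
theorem exists_add_sumsOfSquares [T2Space B] [CompactSpace B] {V : Family.{u, w} B}
    (hV : IsVectorBundle d V) {k : Pairing V} (hk : IsHermitianMetric d V k) :
    ∃ p ∈ sumsOfSquares (d := d) V, ∃ q ∈ sumsOfSquares (d := d) V, k + p = q := by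
  choose ρ hρ hρ0 hρx H using exists_local_polarization (d := d) hV
  have hcont : ∀ x, Continuous (ρ x) := fun x => by
    have h1 : Continuous fun y => ((ρ x y : ℝ) : ℂ) :=
      continuous_iff_continuousAt.2 fun y => (hρ x y).contMDiffAt.continuousAt
    exact Complex.continuous_re.comp h1
  obtain ⟨t, ht⟩ := CompactSpace.elim_nhds_subcover (fun x => {y | 0 < ρ x y}) fun x =>
    (isOpen_lt continuous_const (hcont x)).mem_nhds (hρx x)
  let ψ : B → ℝ := fun b => ∑ x ∈ t, ρ x b
  have hψ : ∀ b, 0 < ψ b := fun b => by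
    have hb : b ∈ ⋃ x ∈ t, {y | 0 < ρ x y} := by rw [ht]; trivial
    simp only [Set.mem_iUnion] at hb
    obtain ⟨x, hx, hxb⟩ := hb
    exact Finset.sum_pos' (fun x _ => hρ0 x b) ⟨x, hx, hxb⟩
  have hψs : ∀ y, SmoothNear d (fun y => (((ψ y)⁻¹ : ℝ) : ℂ)) y := fun y => by
    have h1 : SmoothNear d (fun y => ((ψ y : ℝ) : ℂ)) y := by
      simp only [ψ, Complex.ofReal_sum]
      exact SmoothNear.sum fun x _ => hρ x y
    simp only [Complex.ofReal_inv]
    exact h1.inv (by exact_mod_cast (hψ y).ne')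
  choose p hp q hq hpq using fun x => H x _ (hk.smul_of_pos hψs fun y => inv_pos.2 (hψ y))
  refine ⟨∑ x ∈ t, p x, sum_mem fun x _ => hp x, ∑ x ∈ t, q x, sum_mem fun x _ => hq x, ?_⟩
  funext b u v
  have h1 : k b u v = ∑ x ∈ t, (ρ x b : ℂ) * ((((ψ b)⁻¹ : ℝ) : ℂ) * k b u v) := by
    rw [← Finset.sum_mul, ← mul_assoc, ← Complex.ofReal_sum, ← Complex.ofReal_mul,
      mul_inv_cancel₀ (hψ b).ne', Complex.ofReal_one, one_mul]
  simp only [Finset.sum_apply, Pi.add_apply]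
  rw [h1, ← Finset.sum_add_distrib]
  exact Finset.sum_congr rfl fun x _ => hpq x b u v

/-- The class of a flat bundle does not depend on the Hermitian metric. -/
theorem FlatBundle.cls_eq_cls [T2Space B] [CompactSpace B] (F : FlatBundle.{u, w} d B)
    {h k : Pairing F.V} (hh : IsHermitianMetric d F.V h) (hk : IsHermitianMetric d F.V k) :
    F.cls h hh = F.cls k hk := by
  have key : ∀ {h k : Pairing F.V} (hh : IsHermitianMetric d F.V h)
      (_ : IsHermitianMetric d F.V k),
      ∃ hhk : IsHermitianMetric d F.V (h + k), F.cls _ hhk = F.cls h hh := by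
    intro h k hh hk
    have hhk : IsHermitianMetric d F.V (h + k) :=
      { add_right := fun b x y z => by
          simp only [Pi.add_apply, hh.add_right, hk.add_right]
          ring
        smul_right := fun b x c y => by
          simp only [Pi.add_apply, hh.smul_right, hk.smul_right]
          ring
        conj_symm := fun b x y => by
          simp only [Pi.add_apply, map_add, hh.conj_symm, hk.conj_symm]
        pos := fun b x hx => add_pos (hh.pos b x hx) (hk.pos b x hx)
        smooth := fun s t x hs ht => (hh.smooth s t x hs ht).add (hk.smooth s t x hs ht) }
    obtain ⟨p, hp, q, hq, hpq⟩ := exists_add_sumsOfSquares F.bundle hk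
    obtain ⟨h1, e1⟩ := cls_add_sumsOfSquares hq hh
    obtain ⟨h2, e2⟩ := cls_add_sumsOfSquares hp hhk
    refine ⟨hhk, ?_⟩
    rw [← e1, ← e2]
    exact FlatBundle.cls_congr fun b x y => by rw [← hpq, add_assoc]
  obtain ⟨h1, e1⟩ := key hh hk
  obtain ⟨h2, e2⟩ := key hk hh
  rw [← e1, ← e2]
  exact FlatBundle.cls_congr fun b x y => by rw [add_comm]

/-- The class of a flat bundle is additive in flat exact sequences, whatever the metrics. -/
theorem IsFlatExact.cls_eq_add [T2Space B] [CompactSpace B] {F₁ F₂ F₃ : FlatBundle.{u, w} d B}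
    {i : FiberHom F₁.V F₂.V} {j : FiberHom F₂.V F₃.V} (hE : IsFlatExact i j) {h₁ : Pairing F₁.V}
    {h₂ : Pairing F₂.V} {h₃ : Pairing F₃.V} (hh₁ : IsHermitianMetric d F₁.V h₁)
    (hh₂ : IsHermitianMetric d F₂.V h₂) (hh₃ : IsHermitianMetric d F₃.V h₃) :
    F₂.cls h₂ hh₂ = F₁.cls h₁ hh₁ + F₃.cls h₃ hh₃ := by
  obtain ⟨q, hq, -, h⟩ := exists_quotient_metric hE hh₂
  rw [h, F₁.cls_eq_cls _ hh₁, F₃.cls_eq_cls hq hh₃]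

end MetricIndependence

/-! ### Parallel bundle maps have locally constant rank -/

section Gronwall

open Asymptotics

/-- A function vanishing at `y₀` whose derivative is `O` of the function vanishes near `y₀`, by
Grönwall's inequality along the rays from `y₀`. -/
theorem eventually_eq_zero_of_fderiv_isBigO {E F : Type*} [NormedAddCommGroup E] [NormedSpace ℝ E]
    [NormedAddCommGroup F] [NormedSpace ℝ F] {s : E → F} {y₀ : E} (h0 : s y₀ = 0)
    (hd : ∀ᶠ y in 𝓝 y₀, DifferentiableAt ℝ s y) (hb : fderiv ℝ s =O[𝓝 y₀] s) :
    ∀ᶠ y in 𝓝 y₀, s y = 0 := by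
  obtain ⟨K, hK⟩ := hb.bound
  obtain ⟨ε, hε, H⟩ := Metric.eventually_nhds_iff_ball.1 (hd.and hK)
  filter_upwards [Metric.ball_mem_nhds y₀ hε] with y hy
  let γ : ℝ → E := fun t => y₀ + t • (y - y₀)
  have hγ : ∀ t, HasDerivAt γ (y - y₀) t := fun t => by
    have h1 := ((hasDerivAt_id t).smul_const (y - y₀)).const_add y₀
    rwa [one_smul] at h1
  have hmem : ∀ t ∈ Set.Icc (0 : ℝ) 1, γ t ∈ Metric.ball y₀ ε := fun t ht => by
    rw [mem_ball_iff_norm, add_sub_cancel_left, norm_smul, Real.norm_of_nonneg ht.1]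
    rw [mem_ball_iff_norm] at hy
    exact (mul_le_of_le_one_left (norm_nonneg _) ht.2).trans_lt hy
  have hder : ∀ t ∈ Set.Icc (0 : ℝ) 1,
      HasDerivAt (fun t => s (γ t)) (fderiv ℝ s (γ t) (y - y₀)) t := fun t ht =>
    (H _ (hmem t ht)).1.hasFDerivAt.comp_hasDerivAt t (hγ t)
  have := eq_zero_of_abs_deriv_le_mul_abs_self_of_eq_zero_right (K := K * ‖y - y₀‖)
    (fun t ht => (hder t ht).continuousAt.continuousWithinAt)
    (fun t ht => (hder t (Set.Ico_subset_Icc_self ht)).hasDerivWithinAt)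
    (by simp [γ, h0]) (fun t ht => by
      refine (ContinuousLinearMap.le_opNorm _ _).trans ?_
      rw [mul_right_comm]
      exact mul_le_mul_of_nonneg_right (H _ (hmem t (Set.Ico_subset_Icc_self ht))).2
        (norm_nonneg _)) 1 ⟨zero_le_one, le_rfl⟩
  simpa [γ] using this

variable {d : ℕ} {B : Type u} [TopologicalSpace B] [ChartedSpace (EuclideanSpace ℝ (Fin d)) B]
  [IsManifold (𝓡 d) ∞ B]

/-- Smooth functions vanishing at `x` that satisfy a linear first order system near `x`, in all
coordinate directions, vanish near `x`. -/
theorem eventually_eq_zero_of_mvfderiv_isBigO {ι : Type*} [Fintype ι] {s : ι → B → ℂ} {x : B}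
    (hs : ∀ i, SmoothNear d (s i) x) (h0 : ∀ i, s i x = 0)
    (h : ∀ (X : TangentSpace (𝓡 d) x) (i : ι),
      (fun y => mvfderiv (𝓡 d) (s i) y (coordField x X y)) =O[𝓝 x] fun y j => s j y) :
    ∀ᶠ y in 𝓝 x, ∀ i, s i y = 0 := by
  set χ := extChartAt (𝓡 d) x with hχ
  have hx : x ∈ χ.source := mem_extChartAt_source x
  have htend : Tendsto χ.symm (𝓝 (χ x)) (𝓝 x) := by
    have := (continuousAt_extChartAt_symm (I := 𝓡 d) x).tendsto
    rwa [extChartAt_to_inv] at this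
  have hsrc : ∀ᶠ z in 𝓝 (χ x), z ∈ χ.target := extChartAt_target_mem_nhds x
  let σ : EuclideanSpace ℝ (Fin d) → ι → ℂ := fun z i => s i (χ.symm z)
  have hdi : ∀ᶠ z in 𝓝 (χ x), ∀ i, DifferentiableAt ℝ (s i ∘ χ.symm) z := by
    refine eventually_all.2 fun i => ?_
    filter_upwards [htend.eventually (hs i).eventually, hsrc] with z hz hz'
    have h1 := hz.contDiffAt_chart (χ.map_target hz')
    rw [← hχ, χ.right_inv hz'] at h1
    exact h1.differentiableAt (by simp)
  have hσd : ∀ᶠ z in 𝓝 (χ x), DifferentiableAt ℝ σ z := by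
    filter_upwards [hdi] with z hz using differentiableAt_pi.2 hz
  have hdir : ∀ v : EuclideanSpace ℝ (Fin d), (fun z => fderiv ℝ σ z v) =O[𝓝 (χ x)] σ := by
    intro v
    refine isBigO_pi.2 fun i => ?_
    refine ((h ((toModel x).symm v) i).comp_tendsto htend).congr' ?_ EventuallyEq.rfl
    filter_upwards [htend.eventually (hs i).eventually, hsrc, hdi] with z hz hz' hz''
    have h1 := mvfderiv_coordField hz (χ.map_target hz') ((toModel x).symm v)
    rw [← hχ, χ.right_inv hz', LinearEquiv.apply_symm_apply] at h1
    refine h1.trans ?_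
    have h2 : fderiv ℝ σ z = ContinuousLinearMap.pi fun i => fderiv ℝ (s i ∘ χ.symm) z :=
      fderiv_pi hz''
    rw [h2]; rfl
  have hσ : fderiv ℝ σ =O[𝓝 (χ x)] σ := by
    let b := (EuclideanSpace.basisFun (Fin d) ℝ).toBasis
    let c : Fin d → EuclideanSpace ℝ (Fin d) →L[ℝ] ℝ := fun a =>
      LinearMap.toContinuousLinearMap (b.coord a)
    have e : fderiv ℝ σ = fun z => ∑ a, (c a).smulRight (fderiv ℝ σ z (b a)) := by
      funext z
      ext1 v
      conv_lhs => rw [← b.sum_repr v, map_sum]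
      simp [c]
    rw [e]
    refine IsBigO.fun_sum fun a _ => ?_
    refine IsBigO.trans (IsBigO.of_bound ‖c a‖ (Eventually.of_forall fun z => ?_)) (hdir (b a))
    rw [ContinuousLinearMap.norm_smulRight_apply]
  have hzero := eventually_eq_zero_of_fderiv_isBigO
    (by funext i; simp only [σ, hχ, extChartAt_to_inv]; exact h0 i) hσd hσ
  filter_upwards [(continuousAt_extChartAt (I := 𝓡 d) x).eventually hzero,
    extChartAt_source_mem_nhds (I := 𝓡 d) x] with y hy hy' i
  have h1 : s i (χ.symm (χ y)) = 0 := congrFun hy i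
  rwa [χ.left_inv hy'] at h1

/-- The coordinate functionals of a basis, for a basis given as a family. -/
theorem exists_coordinate {K M ι : Type*} [Field K] [AddCommGroup M] [Module K M]
    [DecidableEq ι] {e : ι → M} (h : LinearIndependent K e)
    (h' : Submodule.span K (Set.range e) = ⊤) (i : ι) :
    ∃ L : M →ₗ[K] K, ∀ j, L (e j) = if i = j then 1 else 0 := by
  refine ⟨(Module.Basis.mk h h'.ge).coord i, fun j => ?_⟩
  have := (Module.Basis.mk h h'.ge).repr_self j
  rw [Module.Basis.mk_apply] at this
  simp [this, Finsupp.single_apply, eq_comm]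

variable {V W : Family.{u, w} B} {D : Oper d V} {D' : Oper d W} {φ : FiberHom V W}

/-- The local normal form of a parallel bundle map `φ` between flat bundles: a frame `(e, f)` such
that `φ f = 0` and `φ e` is part of a frame. One starts with sections whose values at `x` are
adapted to `ker φ`, and corrects the `f` by combinations of the `e`, so that `φ f` is a combination
`s g` of a complement `g` of `φ e`. The coefficients `s` satisfy a linear system with `s = 0` at
`x`. -/
theorem exists_adapted_frame (hV : IsVectorBundle d V) (hW : IsVectorBundle d W)
    (hD : IsConnection V D) (hD' : IsConnection W D') (hφ : IsSmoothHom φ)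
    (hp : IsParallel φ D D') (x : B) :
    ∃ (m n k : ℕ) (e : Fin m → V.Sec) (f : Fin n → V.Sec) (g : Fin k → W.Sec),
      IsFrame d V (Sum.elim e f) x ∧
      IsFrame d W (Sum.elim (fun j y => φ y (e j y)) g) x ∧
      ∀ᶠ y in 𝓝 x, ∀ l, φ y (f l y) = 0 := by
  classical
  have hfin := hV.finite_fiber x
  -- values at `x`
  obtain ⟨C, hC⟩ := Submodule.exists_isCompl (LinearMap.ker (φ x))
  let β := (Module.finBasis ℂ C).prod (Module.finBasis ℂ (LinearMap.ker (φ x)))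
  let β' := β.map (Submodule.prodEquivOfIsCompl _ _ hC.symm)
  choose e he hex using fun j => hV.exists_section x ((Module.finBasis ℂ C j : C) : V.fiber x)
  choose f hf hfx using fun l =>
    hV.exists_section x ((Module.finBasis ℂ (LinearMap.ker (φ x)) l : _) : V.fiber x)
  have hβ' : ∀ p, Sum.elim (fun j => e j x) (fun l => f l x) p = β' p := by
    rintro (j | l)
    · simp [β', β, hex]
    · simp [β', β, hfx]
  have hφe : LinearIndependent ℂ fun j => φ x (e j x) := by
    have h1 : LinearIndependent ℂ (Module.finBasis ℂ C) := (Module.finBasis ℂ C).linearIndependent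
    have h2 := h1.map' ((φ x).comp C.subtype) (by
      rw [LinearMap.ker_comp, ← Submodule.disjoint_iff_comap_eq_bot]
      exact hC.symm.disjoint)
    have e1 : (fun j => φ x (e j x)) =
        (φ x).comp C.subtype ∘ Module.finBasis ℂ C := by
      funext j
      simp [hex]
    rwa [e1]
  have hLI : LinearIndependent ℂ fun p => Sum.elim (fun j => e j x) (fun l => f l x) p := by
    simp only [hβ']
    exact β'.linearIndependent
  have hspan : Submodule.span ℂ
      (Set.range fun p => Sum.elim (fun j => e j x) (fun l => f l x) p) = ⊤ := by
    simp only [hβ']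
    exact β'.span_eq
  -- a frame of `W` that contains the `φ e`
  obtain ⟨k, g, hG⟩ := hW.exists_frame_extend (e := fun j y => φ y (e j y))
    (fun j => hφ _ x (he j)) hφe
  set G : Fin _ ⊕ Fin k → W.Sec := Sum.elim (fun j y => φ y (e j y)) g with hGdef
  choose c hc hcs using fun l => hG.exists_smooth_coeff (hφ _ x (hf l))
  have hcx : ∀ l q, c l q x = 0 := by
    intro l
    have h1 := (hc l).self_of_nhds
    rw [hfx, (LinearMap.mem_ker.1 (Subtype.mem _) : φ x _ = 0)] at h1
    exact Fintype.linearIndependent_iff.1 hG.linearIndependent _ h1.symm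
  -- the corrected sections
  let f' : Fin _ → V.Sec := fun l y => f l y - ∑ j, c l (Sum.inl j) y • e j y
  have hf' : ∀ l, V.SmoothAt (f' l) x := fun l =>
    hV.smoothAt_sub (hf l) (hV.smoothAt_sum_smul he fun j => hcs l _)
  have hf'x : ∀ l, f' l x = f l x := fun l => by simp [f', hcx]
  have hF : IsFrame d V (Sum.elim e f') x := by
    have e1 : (fun p => Sum.elim e f' p x) =
        fun p => Sum.elim (fun j => e j x) (fun l => f l x) p := by
      funext p
      rcases p with j | l
      · rfl
      · exact hf'x l
    refine hV.isFrame_of_basis ?_ (by rw [e1]; exact hLI) (by rw [e1]; exact hspan)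
    rintro (j | l)
    · exact he j
    · exact hf' l
  have hφf : ∀ l, ∀ᶠ y in 𝓝 x, φ y (f' l y) = ∑ q, c l (Sum.inr q) y • g q y := by
    intro l
    filter_upwards [hc l] with y hy
    simp only [f', map_sub, map_sum, map_smul]
    rw [hy, Fintype.sum_sum_type]
    simp [hGdef]
  have hzero : ∀ᶠ y in 𝓝 x, ∀ p : Fin _ × Fin k, c p.1 (Sum.inr p.2) y = 0 := by
    refine eventually_eq_zero_of_mvfderiv_isBigO (fun p => hcs _ _) (fun p => hcx _ _) ?_
    rintro X ⟨l, q⟩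
    choose θ hθ hθs using fun l => hF.exists_smooth_coeff (hD.smooth (f' l) x X (hf' l))
    choose θ' hθ' hθs' using fun q =>
      hG.exists_smooth_coeff (hD'.smooth (g q) x X (hG.smooth (Sum.inr q)))
    -- Compare the coefficients of `g q` in `φ (∇ f') = ∇' (φ f')`.
    have hsys : ∀ᶠ y in 𝓝 x, mvfderiv (𝓡 d) (c l (Sum.inr q)) y (coordField x X y) =
        ∑ l', θ l (Sum.inr l') y * c l' (Sum.inr q) y -
          ∑ q', c l (Sum.inr q') y * θ' q' (Sum.inr q) y := by
      filter_upwards [eventually_all.2 hφf, (hφf l).eventually_nhds, hθ l, eventually_all.2 hθ',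
        hG.eventually, hV.smoothAt_eventually (hf' l),
        eventually_all.2 fun q => (hcs l (Sum.inr q)).eventually]
        with y h1 h2 h3 h4 hGy hfy hcy
      obtain ⟨L, hL⟩ := exists_coordinate hGy.linearIndependent hGy.span_eq_top (Sum.inr q)
      have hLe : ∀ j, L (φ y (e j y)) = 0 := fun j => (hL (Sum.inl j)).trans (by simp)
      have hLg : ∀ q', L (g q' y) = if q = q' then 1 else 0 := fun q' =>
        (hL (Sum.inr q')).trans (by simp)
      have hgy : ∀ q', W.SmoothAt (g q') y := fun q' => hGy.smooth (Sum.inr q')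
      have h5 := hp (f' l) y (coordField x X y) hfy
      rw [hD'.congr hW (hW.smoothAt_sum_smul hgy hcy) h2, hD'.map_sum_smul hW hgy hcy, h3] at h5
      have h6 := congrArg L h5
      simp only [map_sum, map_add, map_smul, h4, Fintype.sum_sum_type, Sum.elim_inl,
        Sum.elim_inr, h1, hGdef, hLe, hLg, smul_eq_mul, mul_zero, Finset.sum_const_zero, zero_add,
        Finset.sum_add_distrib, mul_ite, mul_one, Finset.sum_ite_eq, Finset.mem_univ, if_true] at h6
      rw [← h6]
      ring
    refine IsBigO.congr' ?_ (hsys.mono fun y hy => hy.symm) EventuallyEq.rfl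
    have hone : ∀ {h : B → ℂ}, SmoothNear d h x → h =O[𝓝 x] fun _ => (1 : ℝ) := fun h =>
      h.contMDiffAt.continuousAt.isBigO_one ℝ
    have hcO : ∀ l q, (c l (Sum.inr q)) =O[𝓝 x]
        fun y (p : Fin _ × Fin k) => c p.1 (Sum.inr p.2) y := fun l q =>
      IsBigO.of_bound 1 (Eventually.of_forall fun y => by
        rw [one_mul]
        exact norm_le_pi_norm (fun p : Fin _ × Fin k => c p.1 (Sum.inr p.2) y) (l, q))
    refine IsBigO.sub (IsBigO.fun_sum fun l' _ => ?_) (IsBigO.fun_sum fun q' _ => ?_)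
    · simpa using ((hone (hθs l (Sum.inr l'))).mul (hcO l' q).norm_right)
    · simpa using ((hcO l q').norm_right.mul (hone (hθs' q' (Sum.inr q))))
  refine ⟨_, _, k, e, f', g, hF, hG, ?_⟩
  filter_upwards [eventually_all.2 hφf, hzero] with y hy hy' l
  rw [hy l]
  exact Finset.sum_eq_zero fun q _ => by rw [hy' (l, q), zero_smul]

end Gronwall

/-! ### Sub-bundles and quotient bundles -/

section Sub

variable {d : ℕ} {B : Type u} [TopologicalSpace B] [ChartedSpace (EuclideanSpace ℝ (Fin d)) B]

/-- A sub-bundle: near each point there is a frame a part of which spans the subspaces. -/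
def IsSubbundle (d : ℕ) {B : Type u} [TopologicalSpace B]
    [ChartedSpace (EuclideanSpace ℝ (Fin d)) B] (V : Family.{u, w} B)
    (S : (b : B) → Submodule ℂ (V.fiber b)) : Prop :=
  ∀ x : B, ∃ (m n : ℕ) (e : Fin m → V.Sec) (f : Fin n → V.Sec), IsFrame d V (Sum.elim e f) x ∧
    ∀ᶠ y in 𝓝 x, S y = Submodule.span ℂ (Set.range fun j => e j y)

/-- The family of the subspaces `S b`, with the smooth sections of `V`. -/
abbrev subFamily (V : Family.{u, w} B) (S : (b : B) → Submodule ℂ (V.fiber b)) :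
    Family.{u, w} B where
  fiber b := S b
  SmoothAt s x := V.SmoothAt (fun b => (s b : V.fiber b)) x

/-- The family of the quotients `V_b / S_b`; its smooth sections are locally the classes of smooth
sections of `V`. -/
abbrev quotientFamily (V : Family.{u, w} B) (S : (b : B) → Submodule ℂ (V.fiber b)) :
    Family.{u, w} B where
  fiber b := V.fiber b ⧸ S b
  SmoothAt s x := ∃ t : V.Sec, V.SmoothAt t x ∧ ∀ᶠ y in 𝓝 x, (S y).mkQ (t y) = s y

variable {V : Family.{u, w} B} {S : (b : B) → Submodule ℂ (V.fiber b)} {x : B}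

theorem isSubbundle_bot (hV : IsVectorBundle d V) : IsSubbundle d V fun _ => ⊥ := fun x => by
  obtain ⟨r, e, he⟩ := hV.exists_frame x
  refine ⟨0, r, Fin.elim0, e, ?_, Eventually.of_forall fun y => by simp⟩
  have h1 := he.reindex (Equiv.emptySum (Fin 0) (Fin r))
  convert h1 using 2 with p
  rcases p with j | j
  · exact j.elim0
  · rfl

/-- A section with values in `S`, completed by zero. -/
theorem exists_subFamily_section (hV : IsVectorBundle d V) {s : V.Sec} (hs : V.SmoothAt s x)
    (h : ∀ᶠ y in 𝓝 x, s y ∈ S y) :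
    ∃ t : (subFamily V S).Sec, (subFamily V S).SmoothAt t x ∧
      ∀ᶠ y in 𝓝 x, (t y : V.fiber y) = s y := by
  classical
  have h1 : ∀ᶠ y in 𝓝 x, ((if hy : s y ∈ S y then ⟨s y, hy⟩ else 0 : S y) : V.fiber y) = s y := by
    filter_upwards [h] with y hy
    rw [dif_pos hy]
  exact ⟨fun y => if hy : s y ∈ S y then ⟨s y, hy⟩ else 0, hV.smoothAt_congr hs h1, h1⟩

/-- A sub-bundle is a bundle: the part `e` of an adapted frame `(e, f)` is a frame. -/
theorem isVectorBundle_subFamily (hV : IsVectorBundle d V) (hS : IsSubbundle d V S) :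
    IsVectorBundle d (subFamily V S) := by
  refine isVectorBundle_of_frames fun x => ?_
  obtain ⟨m, n, e, f, hef, hSe⟩ := hS x
  have hmem : ∀ j, ∀ᶠ y in 𝓝 x, e j y ∈ S y := fun j => by
    filter_upwards [hSe] with y hy
    rw [hy]
    exact Submodule.subset_span ⟨j, rfl⟩
  choose e' he' hee' using fun j => exists_subFamily_section hV (hef.smooth (Sum.inl j)) (hmem j)
  refine ⟨m, e', ?_⟩
  filter_upwards [hef.eventually, hSe.eventually_nhds, (eventually_all.2 hee').eventually_nhds]
    with y hfr hSy hey
  have e1 : ((S y).subtype ∘ fun j => e' j y) = fun j => e j y := funext fun j =>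
    hey.self_of_nhds j
  have hLI : LinearIndependent ℂ fun j => e j y :=
    hfr.linearIndependent.comp Sum.inl Sum.inl_injective
  refine ⟨⟨LinearIndependent.of_comp (S y).subtype (by rwa [e1]), ?_⟩, fun s c hs => ?_⟩
  · refine Submodule.map_injective_of_injective (S y).injective_subtype ?_
    rw [Submodule.map_span, ← Set.range_comp, e1, Submodule.map_subtype_top]
    exact hSy.self_of_nhds.symm
  · have h1 := hfr.smoothAt_iff (s := fun b => (s b : V.fiber b))
      (c := Sum.elim c fun _ _ => 0) (by
        filter_upwards [hs, hey] with z hz hz'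
        have h2 : (s z : V.fiber z) = ∑ j, c j z • e j z := by
          simp only [hz, Submodule.coe_sum, Submodule.coe_smul, hz', Sum.elim_inl]
        rw [h2, Fintype.sum_sum_type]
        simp)
    refine h1.trans (Sum.forall.trans ⟨fun h => h.1, fun h => ⟨h, fun _ => SmoothNear.const 0 y⟩⟩)

theorem isSubbundle_submoduleOf {T : (b : B) → Submodule ℂ (V.fiber b)}
    (hV : IsVectorBundle d V) (hS : IsSubbundle d V S) (hT : IsSubbundle d V T)
    (hST : ∀ b, S b ≤ T b) :
    IsSubbundle d (subFamily V T) fun b => (S b).submoduleOf (T b) := by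
  intro x
  obtain ⟨m, n, e, f, hef, hSe⟩ := hS x
  have hmem : ∀ j, ∀ᶠ y in 𝓝 x, e j y ∈ T y := fun j => by
    filter_upwards [hSe] with y hy
    refine hST y ?_
    rw [hy]
    exact Submodule.subset_span ⟨j, rfl⟩
  choose e' he' hee' using fun j => exists_subFamily_section hV (hef.smooth (Sum.inl j)) (hmem j)
  have e1 : ∀ᶠ y in 𝓝 x, ((T y).subtype ∘ fun j => e' j y) = fun j => e j y := by
    filter_upwards [eventually_all.2 hee'] with y hy
    exact funext hy
  have hLI : LinearIndependent ℂ fun j => e' j x :=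
    LinearIndependent.of_comp (T x).subtype (by
      rw [e1.self_of_nhds]
      exact hef.linearIndependent.comp Sum.inl Sum.inl_injective)
  obtain ⟨k, g, hg⟩ := (isVectorBundle_subFamily hV hT).exists_frame_extend he' hLI
  refine ⟨m, k, e', g, hg, ?_⟩
  filter_upwards [e1, hSe] with y hy hy'
  refine Submodule.map_injective_of_injective (T y).injective_subtype ?_
  rw [Submodule.map_span, ← Set.range_comp, hy, Submodule.submoduleOf,
    Submodule.map_comap_subtype, inf_eq_right.2 (hST y), hy']

/-- A quotient by a sub-bundle is a bundle: the classes of the part `f` of an adapted frame `(e, f)`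
form a frame. -/
theorem isVectorBundle_quotientFamily (hS : IsSubbundle d V S) :
    IsVectorBundle d (quotientFamily V S) := by
  refine isVectorBundle_of_frames fun x => ?_
  obtain ⟨m, n, e, f, hef, hSe⟩ := hS x
  refine ⟨n, fun l y => (S y).mkQ (f l y), ?_⟩
  have hLI : ∀ᶠ y in 𝓝 x, LinearIndependent ℂ fun l => (S y).mkQ (f l y) := by
    filter_upwards [hef.eventually, hSe] with y hfr hSy
    rw [Fintype.linearIndependent_iff]
    intro c hc
    have h1 : ∑ l, c l • f l y ∈ S y := by
      rw [← (S y).ker_mkQ, LinearMap.mem_ker, map_sum]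
      simpa only [map_smul] using hc
    rw [hSy, Submodule.mem_span_range_iff_exists_fun] at h1
    obtain ⟨a, ha⟩ := h1
    have h2 := Fintype.linearIndependent_iff.1 hfr.linearIndependent
      (Sum.elim (fun j => -a j) c) (by
        rw [Fintype.sum_sum_type]
        simp [ha])
    exact fun l => h2 (Sum.inr l)
  have hzero : ∀ᶠ y in 𝓝 x, ∀ j, (S y).mkQ (e j y) = 0 := by
    filter_upwards [hSe] with y hy j
    rw [Submodule.mkQ_apply, Submodule.Quotient.mk_eq_zero, hy]
    exact Submodule.subset_span ⟨j, rfl⟩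
  filter_upwards [hef.eventually, hLI.eventually_nhds, hzero.eventually_nhds] with y hfr hLIy h0
  refine ⟨⟨hLIy.self_of_nhds, ?_⟩, fun s c hs => ⟨?_, fun hc => ?_⟩⟩
  · rw [eq_top_iff]
    intro z _
    obtain ⟨v, rfl⟩ := (S y).mkQ_surjective z
    obtain ⟨c, hc⟩ := exists_coeff_of_span_eq_top hfr.span_eq_top v
    rw [Submodule.mem_span_range_iff_exists_fun]
    refine ⟨fun l => c (Sum.inr l), ?_⟩
    rw [hc, Fintype.sum_sum_type, map_add, map_sum, map_sum]
    simp [h0.self_of_nhds, -Submodule.mkQ_apply]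
  · rintro ⟨t, ht, hts⟩ l
    obtain ⟨a, ha, has⟩ := hfr.exists_smooth_coeff ht
    refine (has (Sum.inr l)).congr ?_
    filter_upwards [hs, hts, ha, hLIy, h0] with z h1 h2 h3 h4 h5
    have h6 : ∑ l, (c l z - a (Sum.inr l) z) • (S z).mkQ (f l z) = 0 := by
      simp only [sub_smul, Finset.sum_sub_distrib]
      rw [← h1, ← h2, h3, Fintype.sum_sum_type, map_add, map_sum, map_sum]
      simp [h5, -Submodule.mkQ_apply]
    exact sub_eq_zero.1 (Fintype.linearIndependent_iff.1 h4 _ h6 l)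
  · refine ⟨fun z => ∑ p, Sum.elim (fun _ _ => (0 : ℂ)) c p z • Sum.elim e f p z, ?_, ?_⟩
    · refine (hfr.smoothAt_iff (Eventually.of_forall fun z => rfl)).2 ?_
      rintro (j | l)
      · exact SmoothNear.const 0 y
      · exact hc l
    · filter_upwards [hs] with z hz
      rw [hz, Fintype.sum_sum_type, map_add, map_sum, map_sum]
      simp [-Submodule.mkQ_apply]

variable [IsManifold (𝓡 d) ∞ B]

/-- The restriction of a connection to a sub-bundle that it preserves (and the value zero where the
derivative leaves the sub-bundle). -/
noncomputable def subConnection (S : (b : B) → Submodule ℂ (V.fiber b)) (D : Oper d V) :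
    Oper d (subFamily V S) := by
  classical
  exact fun s b X => if h : D (fun y => (s y : V.fiber y)) b X ∈ S b then ⟨_, h⟩ else 0

/-- The connection maps smooth sections of the sub-bundle to sections of the sub-bundle. -/
def Preserves (D : Oper d V) (S : (b : B) → Submodule ℂ (V.fiber b)) : Prop :=
  ∀ (s : V.Sec) (b : B) (X : TangentSpace (𝓡 d) b), V.SmoothAt s b → (∀ y, s y ∈ S y) →
    D s b X ∈ S b

omit [IsManifold (𝓡 d) ∞ B] in
theorem coe_subConnection {D : Oper d V} (hp : Preserves D S) {s : (subFamily V S).Sec} {b : B}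
    (hs : (subFamily V S).SmoothAt s b) (X : TangentSpace (𝓡 d) b) :
    (subConnection S D s b X : V.fiber b) = D (fun y => (s y : V.fiber y)) b X := by
  rw [subConnection, dif_pos (hp _ b X hs fun y => (s y).2)]

theorem isConnection_subConnection (hV : IsVectorBundle d V) (hS : IsSubbundle d V S)
    {D : Oper d V} (hD : IsConnection V D) (hp : Preserves D S) :
    IsConnection (subFamily V S) (subConnection S D) := by
  have hS' := isVectorBundle_subFamily hV hS
  exact
  { add := fun s t b X hs ht => Subtype.ext <| by
      rw [coe_subConnection (s := s + t) hp (hS'.smoothAt_add hs ht), Submodule.coe_add,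
        coe_subConnection hp hs, coe_subConnection hp ht]
      exact hD.add _ _ b X hs ht
    leibniz := fun f s b X hf hs => Subtype.ext <| by
      rw [coe_subConnection hp (hS'.smoothAt_smul hf hs), Submodule.coe_add, Submodule.coe_smul,
        Submodule.coe_smul, coe_subConnection hp hs]
      exact hD.leibniz f _ b X hf hs
    add_vector := fun s b X Y hs => Subtype.ext <| by
      rw [Submodule.coe_add, coe_subConnection hp hs, coe_subConnection hp hs,
        coe_subConnection hp hs]
      exact hD.add_vector _ b X Y hs
    smul_vector := fun s b c X hs => Subtype.ext <| by
      rw [Submodule.coe_smul, coe_subConnection hp hs, coe_subConnection hp hs]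
      exact hD.smul_vector _ b c X hs
    smooth := fun s b X hs => hV.smoothAt_congr (hD.smooth _ b X hs) <| by
      filter_upwards [hS'.smoothAt_eventually hs] with y hy
      exact coe_subConnection hp hy _ }

theorem isFlat_subConnection (hV : IsVectorBundle d V) (hS : IsSubbundle d V S)
    {D : Oper d V} (hD : IsConnection V D) (hf : IsFlat D) (hp : Preserves D S) :
    IsFlat (subConnection S D) := by
  intro s b X Y hs
  have hS' := isVectorBundle_subFamily hV hS
  have hc := isConnection_subConnection hV hS hD hp
  have h1 := curvatureOn_map (φ := fun b => (S b).subtype) hS' hV hc hD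
    (fun _ _ h => h) (fun t b X ht => (coe_subConnection hp ht X).symm) hs X Y
  refine Subtype.ext ?_
  exact h1.symm.trans (hf _ b X Y hs)

/-- The flat sub-bundle defined by a sub-bundle that the connection preserves. -/
noncomputable abbrev FlatBundle.sub (F : FlatBundle.{u, w} d B)
    {S : (b : B) → Submodule ℂ (F.V.fiber b)} (hS : IsSubbundle d F.V S)
    (hp : Preserves F.D S) : FlatBundle.{u, w} d B where
  V := subFamily F.V S
  D := subConnection S F.D
  bundle := isVectorBundle_subFamily F.bundle hS
  connection := isConnection_subConnection F.bundle hS F.connection hp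
  flat := isFlat_subConnection F.bundle hS F.connection F.flat hp

section Lift

variable {W : Family.{u, w} B} {j : FiberHom V W} {D : Oper d V} {D' : Oper d W}

/-- An operator that is computed from a connection by lifting sections is a connection. -/
theorem isConnection_of_lift (hV : IsVectorBundle d V) (hW : IsVectorBundle d W)
    (hD : IsConnection V D) (hj : IsSmoothHom j) (hsurj : ∀ b, Function.Surjective (j b))
    (h : ∀ (s : W.Sec) (t : V.Sec) (b : B) (X : TangentSpace (𝓡 d) b), V.SmoothAt t b →
      (∀ᶠ y in 𝓝 b, j y (t y) = s y) → D' s b X = j b (D t b X)) : IsConnection W D' where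
  add s s' b X hs hs' := by
    obtain ⟨t, ht, hts⟩ := exists_lift hV hW hj hsurj hs
    obtain ⟨t', ht', hts'⟩ := exists_lift hV hW hj hsurj hs'
    rw [h _ _ b X ht hts, h _ _ b X ht' hts', h _ _ b X (hV.smoothAt_add ht ht') (by
      filter_upwards [hts, hts'] with y hy hy'
      rw [map_add, hy, hy', Pi.add_apply]), hD.map_add ht ht', map_add]
  leibniz f s b X hf hs := by
    obtain ⟨t, ht, hts⟩ := exists_lift hV hW hj hsurj hs
    rw [h _ _ b X ht hts, h _ _ b X (hV.smoothAt_smul hf ht) (by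
      filter_upwards [hts] with y hy
      rw [map_smul, hy]), hD.leibniz f t b X hf ht, map_add, map_smul, map_smul, hts.self_of_nhds]
  add_vector s b X Y hs := by
    obtain ⟨t, ht, hts⟩ := exists_lift hV hW hj hsurj hs
    rw [h _ _ b _ ht hts, h _ _ b X ht hts, h _ _ b Y ht hts, hD.add_vector t b X Y ht, map_add]
  smul_vector s b c X hs := by
    obtain ⟨t, ht, hts⟩ := exists_lift hV hW hj hsurj hs
    rw [h _ _ b _ ht hts, h _ _ b X ht hts, hD.smul_vector t b c X ht, map_smul]
  smooth s b X hs := by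
    obtain ⟨t, ht, hts⟩ := exists_lift hV hW hj hsurj hs
    refine hW.smoothAt_congr (hj _ _ (hD.smooth t b X ht)) ?_
    filter_upwards [hV.smoothAt_eventually ht, hts.eventually_nhds] with y hy hy'
    exact h _ _ y _ hy hy'

theorem isFlat_of_lift (hV : IsVectorBundle d V) (hW : IsVectorBundle d W)
    (hD : IsConnection V D) (hf : IsFlat D) (hj : IsSmoothHom j)
    (hsurj : ∀ b, Function.Surjective (j b))
    (h : ∀ (s : W.Sec) (t : V.Sec) (b : B) (X : TangentSpace (𝓡 d) b), V.SmoothAt t b →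
      (∀ᶠ y in 𝓝 b, j y (t y) = s y) → D' s b X = j b (D t b X)) : IsFlat D' := by
  intro s b X Y hs
  obtain ⟨t, ht, hts⟩ := exists_lift hV hW hj hsurj hs
  have key : ∀ X Y : TangentSpace (𝓡 d) b, D' (fun y => D' s y (coordField b Y y)) b X =
      j b (D (fun y => D t y (coordField b Y y)) b X) := fun X Y => by
    refine h _ _ b X (hD.smooth t b Y ht) ?_
    filter_upwards [hV.smoothAt_eventually ht, hts.eventually_nhds] with y hy hy'
    exact (h _ _ y _ hy hy').symm
  have h1 := hf t b X Y ht
  rw [curvatureOn] at h1 ⊢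
  rw [key, key, ← map_sub, h1, map_zero]

end Lift

section KernelRange

variable {W : Family.{u, w} B} {φ : FiberHom V W} {D : Oper d V} {D' : Oper d W}

theorem isSubbundle_ker (hV : IsVectorBundle d V) (hW : IsVectorBundle d W)
    (hD : IsConnection V D) (hD' : IsConnection W D') (hφ : IsSmoothHom φ)
    (hp : IsParallel φ D D') : IsSubbundle d V fun b => LinearMap.ker (φ b) := by
  intro x
  obtain ⟨m, n, k, e, f, g, hef, hg, h0⟩ := exists_adapted_frame hV hW hD hD' hφ hp x
  refine ⟨n, m, f, e, ?_, ?_⟩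
  · convert hef.reindex (Equiv.sumComm (Fin n) (Fin m)) using 2 with p
    rcases p with j | j <;> rfl
  filter_upwards [hef.eventually, hg.eventually, h0] with y hy hgy h0y
  refine le_antisymm (fun v hv => ?_) (Submodule.span_le.2 ?_)
  · obtain ⟨c, hc⟩ := exists_coeff_of_span_eq_top hy.span_eq_top v
    rw [Fintype.sum_sum_type] at hc
    have h1 : ∑ j, c (Sum.inl j) • φ y (e j y) = 0 := by
      have h2 := LinearMap.mem_ker.1 hv
      rw [hc, map_add, map_sum, map_sum] at h2
      simpa [h0y] using h2
    have h2 := Fintype.linearIndependent_iff.1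
      (hgy.linearIndependent.comp Sum.inl Sum.inl_injective) (fun j => c (Sum.inl j)) h1
    rw [Submodule.mem_span_range_iff_exists_fun]
    refine ⟨fun l => c (Sum.inr l), ?_⟩
    rw [hc]
    simp [h2]
  · rintro _ ⟨l, rfl⟩
    exact h0y l

theorem isSubbundle_range (hV : IsVectorBundle d V) (hW : IsVectorBundle d W)
    (hD : IsConnection V D) (hD' : IsConnection W D') (hφ : IsSmoothHom φ)
    (hp : IsParallel φ D D') : IsSubbundle d W fun b => LinearMap.range (φ b) := by
  intro x
  obtain ⟨m, n, k, e, f, g, hef, hg, h0⟩ := exists_adapted_frame hV hW hD hD' hφ hp x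
  refine ⟨m, k, _, g, hg, ?_⟩
  filter_upwards [hef.eventually, h0] with y hy h0y
  refine le_antisymm ?_ (Submodule.span_le.2 ?_)
  · rintro _ ⟨v, rfl⟩
    obtain ⟨c, hc⟩ := exists_coeff_of_span_eq_top hy.span_eq_top v
    rw [Submodule.mem_span_range_iff_exists_fun]
    refine ⟨fun j => c (Sum.inl j), ?_⟩
    rw [hc, Fintype.sum_sum_type, map_add, map_sum, map_sum]
    simp [h0y]
  · rintro _ ⟨j, rfl⟩
    exact ⟨_, rfl⟩

theorem preserves_ker (hW : IsVectorBundle d W) (hD' : IsConnection W D')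
    (hp : IsParallel φ D D') : Preserves D fun b => LinearMap.ker (φ b) := by
  intro s b X hs h
  rw [LinearMap.mem_ker, ← hp s b X hs]
  have e : (fun y => φ y (s y)) = fun _ => 0 := funext fun y => LinearMap.mem_ker.1 (h y)
  rw [e, hD'.map_zero hW]

theorem preserves_range (hV : IsVectorBundle d V) (hW : IsVectorBundle d W)
    (hD : IsConnection V D) (hD' : IsConnection W D') (hφ : IsSmoothHom φ)
    (hp : IsParallel φ D D') : Preserves D' fun b => LinearMap.range (φ b) := by
  intro s b X hs h
  have hR := isSubbundle_range hV hW hD hD' hφ hp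
  obtain ⟨t, ht, hts⟩ := exists_lift (s := fun y => (⟨s y, h y⟩ : LinearMap.range (φ y)))
    (j := fun b => (φ b).rangeRestrict) hV (isVectorBundle_subFamily hW hR) hφ
    (fun b => (φ b).surjective_rangeRestrict) hs
  refine ⟨D t b X, ?_⟩
  rw [← hp t b X ht]
  refine (hD'.congr hW (hφ _ _ ht) ?_).symm
  filter_upwards [hts] with y hy
  exact (congrArg Subtype.val hy).symm

end KernelRange

end Sub

/-! ### The cohomology bundles of a flat complex -/

namespace FlatComplex

variable {d : ℕ} {B : Type u} [TopologicalSpace B] [ChartedSpace (EuclideanSpace ℝ (Fin d)) B]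
  [IsManifold (𝓡 d) ∞ B] (C : FlatComplex.{u, w} d B) (i : ℕ)

/-- The bundle `E^i` with its flat connection. -/
abbrev flatBundle : FlatBundle.{u, w} d B where
  V := C.E i
  D := C.D i
  bundle := C.bundle i
  connection := C.connection i
  flat := C.flat i

theorem isSubbundle_cycles : IsSubbundle d (C.E i) (C.cycles i) :=
  isSubbundle_ker (C.bundle i) (C.bundle (i + 1)) (C.connection i) (C.connection (i + 1))
    (C.smooth_v i) (C.commute i)

theorem preserves_cycles : Preserves (C.D i) (C.cycles i) :=
  preserves_ker (C.bundle (i + 1)) (C.connection (i + 1)) (C.commute i)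

theorem isSubbundle_boundaries : IsSubbundle d (C.E i) (C.boundaries i) := by
  cases i with
  | zero => exact isSubbundle_bot (C.bundle 0)
  | succ i =>
    exact isSubbundle_range (C.bundle i) (C.bundle (i + 1)) (C.connection i)
      (C.connection (i + 1)) (C.smooth_v i) (C.commute i)

theorem preserves_boundaries : Preserves (C.D i) (C.boundaries i) := by
  cases i with
  | zero =>
    intro s b X _ h
    have e : s = fun _ => 0 := funext fun y => (Submodule.mem_bot ℂ).1 (h y)
    rw [e, (C.connection 0).map_zero (C.bundle 0)]
    exact zero_mem _
  | succ i =>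
    exact preserves_range (C.bundle i) (C.bundle (i + 1)) (C.connection i)
      (C.connection (i + 1)) (C.smooth_v i) (C.commute i)

theorem boundaries_le_cycles (b : B) : C.boundaries i b ≤ C.cycles i b := by
  cases i with
  | zero => exact bot_le
  | succ i =>
    rintro _ ⟨x, rfl⟩
    exact C.v_comp_v i b x

/-- The flat bundle `ker v ⊂ E^i`. -/
noncomputable abbrev cyclesBundle : FlatBundle.{u, w} d B :=
  (C.flatBundle i).sub (C.isSubbundle_cycles i) (C.preserves_cycles i)

/-- The flat bundle `im v ⊂ E^i`. -/
noncomputable abbrev boundariesBundle : FlatBundle.{u, w} d B :=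
  (C.flatBundle i).sub (C.isSubbundle_boundaries i) (C.preserves_boundaries i)

theorem isVectorBundle_cohomology : IsVectorBundle d (C.H i) :=
  isVectorBundle_quotientFamily (isSubbundle_submoduleOf (C.bundle i)
    (C.isSubbundle_boundaries i) (C.isSubbundle_cycles i) (C.boundaries_le_cycles i))

theorem isSmoothHom_toCohomology :
    IsSmoothHom (V := (C.cyclesBundle i).V) (W := C.H i) (C.toCohomology i) :=
  fun t _ ht => ⟨t, ht, Eventually.of_forall fun _ => rfl⟩

theorem surjective_toCohomology (b : B) : Function.Surjective (C.toCohomology i b) :=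
  Submodule.mkQ_surjective _

theorem toCohomology_eq_zero_iff {b : B} {z : C.cycles i b} :
    C.toCohomology i b z = 0 ↔ (z : (C.E i).fiber b) ∈ C.boundaries i b := by
  rw [toCohomology, Submodule.mkQ_apply, Submodule.Quotient.mk_eq_zero]
  rfl

/-- `∇[t] = [∇t]`: the value that defines `C.DH` is unique, since the connection preserves `im v`. -/
theorem DH_eq {s : (C.H i).Sec} {t : (b : B) → C.cycles i b} {b : B} (X : TangentSpace (𝓡 d) b)
    (ht : (C.E i).SmoothAt (fun y => (t y : (C.E i).fiber y)) b)
    (hts : ∀ᶠ y in 𝓝 b, C.toCohomology i y (t y) = s y) :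
    C.DH i s b X = C.toCohomology i b ((C.cyclesBundle i).D t b X) := by
  have hcoe : ∀ t' : (b : B) → C.cycles i b,
      (C.E i).SmoothAt (fun y => (t' y : (C.E i).fiber y)) b →
      ((C.cyclesBundle i).D t' b X : (C.E i).fiber b) =
        C.D i (fun y => (t' y : (C.E i).fiber y)) b X := fun t' ht' =>
    coe_subConnection (C.preserves_cycles i) ht' X
  obtain ⟨t', ⟨ht', hts'⟩, z, hz, hc⟩ := Classical.epsilon_spec
    (p := fun c : C.cohomologyFiber i b => ∃ t : (b : B) → C.cycles i b, C.IsLift i t s b ∧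
      ∃ z : C.cycles i b, (z : (C.E i).fiber b) = C.D i (fun y => (t y : (C.E i).fiber y)) b X ∧
        c = C.toCohomology i b z)
    ⟨_, t, ⟨ht, hts⟩, (C.cyclesBundle i).D t b X, hcoe t ht, rfl⟩
  refine Eq.trans hc (sub_eq_zero.1 ?_)
  rw [← map_sub, toCohomology_eq_zero_iff, Submodule.coe_sub, hz, hcoe t ht,
    ← (C.connection i).map_sub (C.bundle i) ht' ht]
  obtain ⟨r, hr, hr'⟩ := exists_subFamily_section (S := C.boundaries i) (C.bundle i)
    ((C.bundle i).smoothAt_sub ht' ht) (by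
      filter_upwards [hts, hts'] with y hy hy'
      have := C.toCohomology_eq_zero_iff i (z := t' y - t y)
      rw [map_sub, hy, hy', sub_self] at this
      exact this.1 rfl)
  rw [← (C.connection i).congr (C.bundle i) ((C.bundle i).smoothAt_sub ht' ht) hr']
  exact C.preserves_boundaries i _ b X hr fun y => (r y).2

/-- The cohomology bundle with its canonical flat connection. -/
noncomputable abbrev cohomologyBundle : FlatBundle.{u, w} d B where
  V := C.H i
  D := C.DH i
  bundle := C.isVectorBundle_cohomology i
  connection := isConnection_of_lift (C.cyclesBundle i).bundle (C.isVectorBundle_cohomology i)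
    (C.cyclesBundle i).connection (C.isSmoothHom_toCohomology i) (C.surjective_toCohomology i)
    fun _ _ _ X ht hts => C.DH_eq i X ht hts
  flat := isFlat_of_lift (C.cyclesBundle i).bundle (C.isVectorBundle_cohomology i)
    (C.cyclesBundle i).connection (C.cyclesBundle i).flat (C.isSmoothHom_toCohomology i)
    (C.surjective_toCohomology i) fun _ _ _ X ht hts => C.DH_eq i X ht hts

/-- `0 → ker v → E^i → im v → 0` -/
theorem isFlatExact_cycles : IsFlatExact (F₁ := C.cyclesBundle i) (F₂ := C.flatBundle i)
    (F₃ := C.boundariesBundle (i + 1)) (fun b => (C.cycles i b).subtype)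
    (fun b => (C.v i b).rangeRestrict) where
  smooth_i _ _ hs := hs
  smooth_j := C.smooth_v i
  parallel_i _ _ X hs := (coe_subConnection (C.preserves_cycles i) hs X).symm
  parallel_j s b X hs := Subtype.ext <| by
    refine (coe_subConnection (C.preserves_boundaries (i + 1))
      (s := fun y => (C.v i y).rangeRestrict (s y)) (C.smooth_v i s b hs) X).trans ?_
    exact C.commute i s b X hs
  injective b := (C.cycles i b).injective_subtype
  exact b := by
    refine (Submodule.range_subtype _).trans ?_
    exact (LinearMap.ker_rangeRestrict (C.v i b)).symm
  surjective b := (C.v i b).surjective_rangeRestrict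

/-- `0 → im v → ker v → H^i → 0` -/
theorem isFlatExact_cohomology : IsFlatExact (F₁ := C.boundariesBundle i)
    (F₂ := C.cyclesBundle i) (F₃ := C.cohomologyBundle i)
    (fun b => Submodule.inclusion (C.boundaries_le_cycles i b)) (C.toCohomology i) where
  smooth_i _ _ hs := hs
  smooth_j := C.isSmoothHom_toCohomology i
  parallel_i s _ X hs := Subtype.ext <|
    (coe_subConnection (C.preserves_cycles i)
      (s := fun y => Submodule.inclusion (C.boundaries_le_cycles i y) (s y)) hs X).trans
      (coe_subConnection (C.preserves_boundaries i) hs X).symm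
  parallel_j _ _ X ht := C.DH_eq i X ht (Eventually.of_forall fun _ => rfl)
  injective _ := Submodule.inclusion_injective _
  exact b := (Submodule.range_inclusion (C.boundaries i b) (C.cycles i b) _).trans
    (Submodule.ker_mkQ _).symm
  surjective := C.surjective_toCohomology i

variable {i} {h : (i : ℕ) → Pairing (C.E i)}

theorem isHermitianMetric_sub {S : (b : B) → Submodule ℂ ((C.E i).fiber b)}
    (hh : IsHermitianMetric d (C.E i) (h i)) :
    IsHermitianMetric d (subFamily (C.E i) S) (fun b x y => h i b x y) :=
  hh.comap (V₁ := subFamily (C.E i) S) (i := fun b => (S b).subtype) (fun _ _ hs => hs) fun b => (S b).injective_subtype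

/-- The harmonic representatives form the orthogonal splitting of `ker v → H^i`. -/
theorem isHermitianMetric_hH (hh : IsHermitianMetric d (C.E i) (h i)) :
    IsHermitianMetric d (C.H i) (C.hH h i) := by
  have hE := C.isFlatExact_cohomology i
  obtain ⟨σ, p, hs, horth⟩ := exists_orthogonal_splitting (C.boundariesBundle i).bundle
    (C.cyclesBundle i).bundle (C.isVectorBundle_cohomology i) (C.isHermitianMetric_sub hh)
    hE.smooth_i hE.smooth_j hE.injective hE.exact hE.surjective
  have hσ : ∀ b c, C.harmonic h i b c = σ b c := by
    intro b c
    have hspec : C.toCohomology i b (σ b c) = c ∧ ∀ y ∈ C.boundaries i b,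
        h i b y ((σ b c : C.cycles i b) : (C.E i).fiber b) = 0 :=
      ⟨hs.splitting b c, fun y hy => horth b ⟨y, hy⟩ c⟩
    obtain ⟨h1, h2⟩ := Classical.epsilon_spec (p := fun z : C.cycles i b =>
      C.toCohomology i b z = c ∧ ∀ y ∈ C.boundaries i b, h i b y (z : (C.E i).fiber b) = 0)
      ⟨_, hspec⟩
    have h3 : ((C.harmonic h i b c - σ b c : C.cycles i b) : (C.E i).fiber b) ∈
        C.boundaries i b := by
      rw [← toCohomology_eq_zero_iff, map_sub, hspec.1]
      exact sub_eq_zero.2 h1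
    refine sub_eq_zero.1 (Subtype.ext ?_)
    refine hh.eq_zero_of_self ?_
    conv_lhs => enter [4]; rw [Submodule.coe_sub]
    rw [hh.sub_right]
    exact (congrArg₂ _ (h2 _ h3) (hspec.2 _ h3)).trans (sub_zero 0)
  have e : C.hH h i = fun b c c' => h i b ((σ b c : C.cycles i b) : (C.E i).fiber b)
      ((σ b c' : C.cycles i b) : (C.E i).fiber b) := by
    funext b c c'
    rw [hH, hσ, hσ]
  rw [e]
  exact (C.isHermitianMetric_sub hh).comap hs.smooth_splitting fun b =>
    Function.LeftInverse.injective (hs.splitting b)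

end FlatComplex

/-- In an alternating sum, terms that occur in two consecutive summands cancel. -/
theorem sum_alternating_eq {A : Type*} [AddCommGroup A] {a b f : ℕ → A} {n : ℕ}
    (h : ∀ i, a i = b i + (f i + f (i + 1))) (h0 : f 0 = 0) (hn : f n = 0) :
    ∑ i ∈ Finset.range n, (-1 : ℤ) ^ i • a i = ∑ i ∈ Finset.range n, (-1 : ℤ) ^ i • b i := by
  suffices H : ∀ n, ∑ i ∈ Finset.range n, (-1 : ℤ) ^ i • a i =
      ∑ i ∈ Finset.range n, (-1 : ℤ) ^ i • b i + f 0 - (-1 : ℤ) ^ n • f n by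
    rw [H, h0, hn, add_zero, smul_zero, sub_zero]
  intro n
  induction n with
  | zero => simp
  | succ n ih =>
    rw [Finset.sum_range_succ, Finset.sum_range_succ, ih, h, pow_succ]
    module

section Main

variable {d : ℕ} {B : Type u} [TopologicalSpace B] [ChartedSpace (EuclideanSpace ℝ (Fin d)) B]
  [IsManifold (𝓡 d) ∞ B]

/-- The alternating sum of the classes of the bundles of a flat complex is that of the cohomology
bundles: the contributions of the images of the differential cancel. -/
theorem FlatComplex.sum_cls_eq [T2Space B] [CompactSpace B] (C : FlatComplex.{u, w} d B)
    {h : (i : ℕ) → Pairing (C.E i)} (hh : ∀ i, IsHermitianMetric d (C.E i) (h i)) :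
    ∑ i ∈ Finset.range (C.n + 1), (-1 : ℤ) ^ i • (C.flatBundle i).cls (h i) (hh i) =
      ∑ i ∈ Finset.range (C.n + 1),
        (-1 : ℤ) ^ i • (C.cohomologyBundle i).cls (C.hH h i) (C.isHermitianMetric_hH (hh i)) := by
  have hZ : ∀ i, IsHermitianMetric d (C.cyclesBundle i).V _ := fun i =>
    C.isHermitianMetric_sub (hh i)
  have hB : ∀ i, IsHermitianMetric d (C.boundariesBundle i).V _ := fun i =>
    C.isHermitianMetric_sub (hh i)
  refine sum_alternating_eq (f := fun i => (C.boundariesBundle i).cls _ (hB i)) (fun i => ?_)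
    (FlatBundle.cls_eq_zero _ (fun b => inferInstanceAs
      (Subsingleton (⊥ : Submodule ℂ ((C.E 0).fiber b)))) _)
    (FlatBundle.cls_eq_zero _ (fun b => ?_) _)
  · rw [(C.isFlatExact_cycles i).cls_eq_add (hZ i) (hh i) (hB (i + 1)),
      (C.isFlatExact_cohomology i).cls_eq_add (hB i) (hZ i) (C.isHermitianMetric_hH (hh i))]
    abel
  · have := C.zero_of_gt (C.n + 1) C.n.lt_succ_self b
    exact inferInstanceAs (Subsingleton (C.boundaries (C.n + 1) b))

/-- Combinations of classes of generators whose ranks cancel lie in `K^{-1}_{R/Z}(B)`. -/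
theorem sum_classOf_sub_mem_KMinusOne {ι : Type*} (s : Finset ι) (a : ι → ℤ)
    {V : ι → Family.{u, w} B} {h : ∀ i, Pairing (V i)} {D : ∀ i, Oper d (V i)}
    {α : ι → OddClass d B} (g : ∀ i, IsKGenerator (V i) (h i) (D i) (α i))
    {L : Family.{u, w} B} {hL : Pairing L} {DL : Oper d L} {αL : OddClass d B}
    (gL : IsKGenerator L hL DL αL) (hrk : ∀ b, Module.finrank ℂ (L.fiber b) = 1) {m : ℤ}
    (hm : ∀ b, ∑ i ∈ s, a i * (Module.finrank ℂ ((V i).fiber b) : ℤ) = m) :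
    ∑ i ∈ s, a i • classOf (g i) - m • classOf gL ∈ KMinusOne d B := by
  refine ⟨∑ i ∈ s, a i • FreeAbelianGroup.of ⟨V i, h i, D i, α i, g i⟩ -
    m • FreeAbelianGroup.of ⟨L, hL, DL, αL, gL⟩, ?_, ?_⟩
  · rw [SetLike.mem_coe, AddMonoidHom.mem_ker]
    funext b
    simp [virtualRank, FreeAbelianGroup.lift_apply_of, hrk, hm b]
  · rw [map_sub, map_sum, map_zsmul]
    simp only [map_zsmul]
    rfl

end Main

end LottK

theorem theorem2p14 {d : ℕ} {B : Type*} [TopologicalSpace B] [T2Space B] [CompactSpace B]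
    [ChartedSpace (EuclideanSpace ℝ (Fin d)) B] [IsManifold (𝓡 d) ∞ B]
    (C : LottK.FlatComplex d B) (h : (i : ℕ) → LottK.Pairing (C.E i))
    (hh : ∀ i, LottK.IsHermitianMetric d (C.E i) (h i)) :
    ∃ (gE : ∀ i, LottK.IsKGenerator (C.E i) (h i)
        (LottK.unitaryConnection (h i) (C.D i)) 0)
      (gH : ∀ i, LottK.IsKGenerator (C.H i) (C.hH h i)
        (LottK.unitaryConnection (C.hH h i) (C.DH i)) 0)
      (gT : LottK.IsKGenerator (LottK.trivialLine d B) (LottK.trivialMetric d B)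
        (LottK.trivialConnection d B) 0),
      (∑ i ∈ Finset.range (C.n + 1), (-1 : ℤ) ^ i • LottK.classOf (gE i) =
        ∑ i ∈ Finset.range (C.n + 1), (-1 : ℤ) ^ i • LottK.classOf (gH i)) ∧
      ∀ m : ℤ, (∀ b : B, ∑ i ∈ Finset.range (C.n + 1),
          (-1 : ℤ) ^ i * (Module.finrank ℂ ((C.E i).fiber b) : ℤ) = m) →
        ∃ (kE : ∑ i ∈ Finset.range (C.n + 1), (-1 : ℤ) ^ i • LottK.classOf (gE i) -
            m • LottK.classOf gT ∈ LottK.KMinusOne d B)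
          (kH : ∑ i ∈ Finset.range (C.n + 1), (-1 : ℤ) ^ i • LottK.classOf (gH i) -
            m • LottK.classOf gT ∈ LottK.KMinusOne d B),
          (⟨_, kE⟩ : LottK.KMinusOne d B) = ⟨_, kH⟩ := by

  have gT := LottK.isKGenerator_trivialLine d B
  have hsum := C.sum_cls_eq hh
  refine ⟨fun i => LottK.isKGenerator_of_flat (C.bundle i) (hh i) (C.connection i) (C.flat i),
    fun i => LottK.isKGenerator_of_flat (C.isVectorBundle_cohomology i)
      (C.isHermitianMetric_hH (hh i)) (C.cohomologyBundle i).connection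
      (C.cohomologyBundle i).flat, gT, hsum, fun m hm => ?_⟩
  have kE := LottK.sum_classOf_sub_mem_KMinusOne (Finset.range (C.n + 1)) (fun i => (-1) ^ i)
    (fun i => LottK.isKGenerator_of_flat (C.bundle i) (hh i) (C.connection i) (C.flat i)) gT
    (fun b => by
      rw [LinearEquiv.finrank_eq ULift.moduleEquiv, Module.finrank_self]) hm
  have hdiff := congrArg (fun z => z - m • LottK.classOf gT) hsum
  exact ⟨kE, hdiff ▸ kE, Subtype.ext hdiff⟩
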